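/- **Setting.** Let $N$ be a compact $C^2$ manifold without boundary, with a fixed finite $C^2$ atlas $\varphi_i$ and a subordinate $C^2$ partition of unity $\psi_i$. For $s\in\{0,\tfrac12,1\}$ let $H^s=H^s(N)$ with the norm $\|u\|_s^2=\sum_i\int(1+|2\pi\xi|^2)^s\,|\mathcal F((\psi_iu)\circ\varphi_i^{-1})(\xi)|^2\,d\xi$. Let $\mu$ be a measure on $N$ with positive Lipschitz density in the charts, let $K>0$, and for $t\in[0,1]$ let $\langle u,v\rangle_t=\int_N uv\,\rho_t\,d\mu$. Consider linear operators $B_t,X_t,S_t:H^1\to L^2$, and assume the following for all $t\in[0,1]$, with constants controlled by $K$: 1. $\rho_t$ is Lipschitz in the charts and bounded above and away from $0$, and $\partial_t\langle u,v\rangle_t=\langle\gamma_tu,v\rangle_t$ for all $u,v\in L^2$, with bounded functions $\gamma_t$. 2. $B_t$ is self-adjoint for $\langle\cdot,\cdot\rangle_t$ with domain $H^1$, and for $u\in H^1$ $$K^{-1}\|u\|_1^2-K\|u\|_0^2\le\langle B_tu,B_tu\rangle_t\le K\|u\|_1^2,\qquad K^{-1}\|u\|_{1/2}^2-K\|u\|_0^2\le\langle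 B_tu,u\rangle_t\le K\|u\|_{1/2}^2;$$ the weak derivative $\dot B_t$ exists and is bounded $H^1\to H^0$. 3. $X_t$ is a derivation with Lipschitz coefficients (the extension to $H^1$ of $u\mapsto du(V_t)$ for a vector field $V_t$ that is bounded and Lipschitz in the charts). 4. $S_t$ maps $H^1$ to $H^1$, and is bounded for the $H^1$ norm and for the $H^0$ norm. 5. The commutator $[B_t,X_t]$ (in the weak sense) is bounded $H^1\to H^0$. Let $f\in L^2([0,1],H^1)$ with $\partial_tf\in L^2([0,1],L^2)$ (continuous representative) satisfy $$\partial_tf_t=-B_tf_t+X_tf_t+S_tf_t\quad\text{for a.e. }t\in[0,1],\qquad f_0\in H^1 .$$ **(a)** There are constants $C_1,C_2>0$, depending only on $N$, the atlas and partition of unity, $\mu$ and $K$, such that, if $f_0\ne0$, then for all $t\in[0,1]$ we have $f_t\in H^1$, $f_t\neq0$ and $$\frac{\langle B_tf_t,B_tf_t\rangle_t}{\langle f_t,f_t\rangle_t}\le e^{C_1t}\left[\frac{\langle B_0f_0,B_0f_0\rangle_0}{\langle f_0,f_0\rangle_0}+\frac{C_2}{C_1}\right]-\frac{C_2}{C_1}.$$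 **(b)** There are constants $C_2,C_3>0$ (not necessarily those of (a)), depending only on the same data, such that, whenever $\lambda\in\mathbb R$ and $\langle B_0f_0,B_0f_0\rangle_0\le\lambda\langle f_0,f_0\rangle_0$, for all $t\in[0,1]$ we have $f_t\in H^{1/2}$ and $$\|f_t\|_{1/2}^2\ge e^{-(C_2\lambda+C_3)t}\,\|f_0\|_{1/2}^2 .$$ -/

import Mathlib

open MeasureTheory Set
open scoped Manifold ENNReal NNReal FourierTransform

noncomputable section

/-- A finite atlas of `C²` charts of a `d`-manifold without boundary, with a subordinate `C²`
partition of unity. It is used to define Sobolev norms on the manifold. -/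
structure SobolevAtlas (d : ℕ) (N : Type*) [TopologicalSpace N]
    [ChartedSpace (EuclideanSpace ℝ (Fin d)) N] where
  card : ℕ
  chart : Fin card → OpenPartialHomeomorph N (EuclideanSpace ℝ (Fin d))
  chart_mem : ∀ i, chart i ∈ IsManifold.maximalAtlas (𝓡 d) 2 N
  psi : Fin card → N → ℝ
  psi_contMDiff : ∀ i, ContMDiff (𝓡 d) 𝓘(ℝ, ℝ) 2 (psi i)
  psi_nonneg : ∀ i x, 0 ≤ psi i x
  psi_tsupport : ∀ i, tsupport (psi i) ⊆ (chart i).source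
  psi_sum : ∀ x, ∑ i, psi i x = 1

namespace SobolevAtlas

variable {d : ℕ} {N : Type*} [TopologicalSpace N] [ChartedSpace (EuclideanSpace ℝ (Fin d)) N]

/-- The support of the `i`-th function of the partition, read in the `i`-th chart. -/
def piece (A : SobolevAtlas d N) (i : Fin A.card) : Set (EuclideanSpace ℝ (Fin d)) :=
  A.chart i '' tsupport (A.psi i)

/-- The localized function `(ψ_i u) ∘ φ_i⁻¹`, extended by zero to all of `ℝ^d`. -/
def loc (A : SobolevAtlas d N) (i : Fin A.card) (u : N → ℝ) : EuclideanSpace ℝ (Fin d) → ℝ :=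
  (A.chart i).target.indicator
    (fun y => A.psi i ((A.chart i).symm y) * u ((A.chart i).symm y))

/-- The square of the `H^s` norm,
`∑_i ∫ (1 + |2πξ|²)^s |𝓕((ψ_i u) ∘ φ_i⁻¹)(ξ)|² dξ`, with values in `[0, ∞]`. It is only applied
to `u` in `L²`, so that the localized functions are integrable. -/
def sobNormSq (A : SobolevAtlas d N) (s : ℝ) (u : N → ℝ) : ℝ≥0∞ :=
  ∑ i, ∫⁻ ξ : EuclideanSpace ℝ (Fin d),
    ENNReal.ofReal ((1 + (2 * Real.pi * ‖ξ‖) ^ 2) ^ s) *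
      ‖𝓕 (fun y : EuclideanSpace ℝ (Fin d) => ((A.loc i u y : ℝ) : ℂ)) ξ‖ₑ ^ 2

/-- `u ∈ H^s(N)`, for `u ∈ L²(N)`. -/
def MemSob (A : SobolevAtlas d N) (s : ℝ) (u : N → ℝ) : Prop := A.sobNormSq s u < ⊤

/-- The norm `‖u‖_s`. -/
def nrm (A : SobolevAtlas d N) (s : ℝ) (u : N → ℝ) : ℝ := Real.sqrt (A.sobNormSq s u).toReal

/-- The function `a` has Lipschitz constant `K` and is bounded by `K` in the charts of the atlas. -/
def LipBounded (A : SobolevAtlas d N) (K : ℝ≥0) (a : N → ℝ) : Prop :=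
  ∀ i, LipschitzOnWith K (fun y => a ((A.chart i).symm y)) (A.piece i) ∧
    ∀ y ∈ A.piece i, |a ((A.chart i).symm y)| ≤ K

/-- The coefficients of the vector field `V` in the `i`-th chart. -/
def coeff (A : SobolevAtlas d N) (V : (x : N) → TangentSpace (𝓡 d) x) (i : Fin A.card)
    (y : EuclideanSpace ℝ (Fin d)) : EuclideanSpace ℝ (Fin d) :=
  (mfderiv (𝓡 d) 𝓘(ℝ, EuclideanSpace ℝ (Fin d)) (A.chart i) ((A.chart i).symm y)
    (V ((A.chart i).symm y)) : EuclideanSpace ℝ (Fin d))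

/-- The coefficients of the vector field `V` in the charts of the atlas have Lipschitz constant `K`
and are bounded by `K`. -/
def LipField (A : SobolevAtlas d N) (K : ℝ≥0) (V : (x : N) → TangentSpace (𝓡 d) x) : Prop :=
  ∀ i, LipschitzOnWith K (A.coeff V i) (A.piece i) ∧ ∀ y ∈ A.piece i, ‖A.coeff V i y‖ ≤ K

/-- The measure `μ` has, in each chart, a positive Lipschitz density with respect to Lebesgue
measure (for instance, `μ` is the Riemannian volume of a Lipschitz metric tensor). -/
def LipDensity [MeasurableSpace N] (A : SobolevAtlas d N) (μ : Measure N) : Prop :=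
  ∃ (K : ℝ≥0) (J : Fin A.card → EuclideanSpace ℝ (Fin d) → ℝ), 0 < K ∧
    ∀ i, LipschitzOnWith K (J i) (A.piece i) ∧
      (∀ y ∈ A.piece i, (K : ℝ)⁻¹ ≤ J i y ∧ J i y ≤ K) ∧
      ∀ s : Set N, MeasurableSet s → s ⊆ tsupport (A.psi i) →
        μ s = ∫⁻ y in A.chart i '' s, ENNReal.ofReal (J i y)

end SobolevAtlas

/-- The inner product `⟨u, v⟩ = ∫ u v ρ dμ` of `L²` with respect to the measure `ρ μ`. -/
def wip {N : Type*} [MeasurableSpace N] (μ : Measure N) (ρ : N → ℝ) (u v : N → ℝ) : ℝ :=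
  ∫ x, u x * v x * ρ x ∂μ

/-- The measures `ρ_t μ`, `t ∈ [0,1]`, have densities that are positive and Lipschitz uniformly
in `t`, and `∂_t ⟨u, v⟩_t = ⟨γ_t u, v⟩_t` with functions `γ_t` bounded uniformly in `t`. -/
structure AdmissibleWeights {d : ℕ} {N : Type*} [TopologicalSpace N]
    [ChartedSpace (EuclideanSpace ℝ (Fin d)) N] [MeasurableSpace N]
    (A : SobolevAtlas d N) (μ : Measure N) (K : ℝ≥0) (ρ : ℝ → N → ℝ) : Prop where
  lip : ∀ t ∈ Icc (0 : ℝ) 1, A.LipBounded K (ρ t)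
  lower : ∀ t ∈ Icc (0 : ℝ) 1, ∀ x, (K : ℝ)⁻¹ ≤ ρ t x
  deriv : ∃ γ : ℝ → N → ℝ, ∀ t ∈ Icc (0 : ℝ) 1,
    Measurable (γ t) ∧ (∀ x, |γ t x| ≤ K) ∧
    ∀ u v : Lp ℝ 2 μ, HasDerivWithinAt (fun s => wip μ (ρ s) u v)
      (wip μ (ρ t) (fun x => γ t x * u x) v) (Icc 0 1) t

/-- The assumptions on `B_t`, uniformly in `t ∈ [0,1]`: it is self-adjoint with domain `H^1` for
`⟨·,·⟩_t`, comparable to a first-order operator, and has a weak time derivative that is bounded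
from `H^1` to `H^0`. The values of the linear map `B t` off `H^1` are irrelevant. -/
structure AdmissibleB {d : ℕ} {N : Type*} [TopologicalSpace N]
    [ChartedSpace (EuclideanSpace ℝ (Fin d)) N] [MeasurableSpace N]
    (A : SobolevAtlas d N) (μ : Measure N) (K : ℝ≥0) (ρ : ℝ → N → ℝ)
    (B : ℝ → Lp ℝ 2 μ →ₗ[ℝ] Lp ℝ 2 μ) : Prop where
  symm : ∀ t ∈ Icc (0 : ℝ) 1, ∀ u v : Lp ℝ 2 μ, A.MemSob 1 u → A.MemSob 1 v →
    wip μ (ρ t) (B t u) v = wip μ (ρ t) u (B t v)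
  adjoint_domain : ∀ t ∈ Icc (0 : ℝ) 1, ∀ u w : Lp ℝ 2 μ,
    (∀ v : Lp ℝ 2 μ, A.MemSob 1 v → wip μ (ρ t) u (B t v) = wip μ (ρ t) w v) → A.MemSob 1 u
  first_order : ∀ t ∈ Icc (0 : ℝ) 1, ∀ u : Lp ℝ 2 μ, A.MemSob 1 u →
    (K : ℝ)⁻¹ * A.nrm 1 u ^ 2 - K * A.nrm 0 u ^ 2 ≤ wip μ (ρ t) (B t u) (B t u) ∧
    wip μ (ρ t) (B t u) (B t u) ≤ K * A.nrm 1 u ^ 2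
  form : ∀ t ∈ Icc (0 : ℝ) 1, ∀ u : Lp ℝ 2 μ, A.MemSob 1 u →
    (K : ℝ)⁻¹ * A.nrm (1 / 2) u ^ 2 - K * A.nrm 0 u ^ 2 ≤ wip μ (ρ t) (B t u) u ∧
    wip μ (ρ t) (B t u) u ≤ K * A.nrm (1 / 2) u ^ 2
  deriv : ∃ D : ℝ → Lp ℝ 2 μ → Lp ℝ 2 μ, ∀ t ∈ Icc (0 : ℝ) 1, ∀ u : Lp ℝ 2 μ, A.MemSob 1 u →
    A.nrm 0 (D t u) ≤ K * A.nrm 1 u ∧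
    ∀ v : Lp ℝ 2 μ, HasDerivWithinAt (fun s => wip μ (ρ t) (B s u) v)
      (wip μ (ρ t) (D t u) v) (Icc 0 1) t

/-- `X_t`, `t ∈ [0,1]`, is a derivation with uniformly Lipschitz coefficients: it is the bounded
extension to `H^1 → H^0` of `u ↦ du(V_t)`, for a vector field `V_t` with Lipschitz coefficients. -/
def AdmissibleX {d : ℕ} {N : Type*} [TopologicalSpace N]
    [ChartedSpace (EuclideanSpace ℝ (Fin d)) N] [MeasurableSpace N]
    (A : SobolevAtlas d N) (μ : Measure N) (K : ℝ≥0)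
    (X : ℝ → Lp ℝ 2 μ →ₗ[ℝ] Lp ℝ 2 μ) : Prop :=
  ∃ V : ℝ → (x : N) → TangentSpace (𝓡 d) x, ∀ t ∈ Icc (0 : ℝ) 1,
    A.LipField K (V t) ∧
    (∀ (u : N → ℝ) (U : Lp ℝ 2 μ), ContMDiff (𝓡 d) 𝓘(ℝ, ℝ) 1 u → U =ᵐ[μ] u →
      X t U =ᵐ[μ] fun x => (mfderiv (𝓡 d) 𝓘(ℝ, ℝ) u x (V t x) : ℝ)) ∧
    ∀ u : Lp ℝ 2 μ, A.MemSob 1 u → A.nrm 0 (X t u) ≤ K * A.nrm 1 u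

/-- `S_t`, `t ∈ [0,1]`, is bounded on `H^1`, and bounded for the norm of `H^0`, uniformly in `t`. -/
def AdmissibleS {d : ℕ} {N : Type*} [TopologicalSpace N]
    [ChartedSpace (EuclideanSpace ℝ (Fin d)) N] [MeasurableSpace N]
    (A : SobolevAtlas d N) (μ : Measure N) (K : ℝ≥0)
    (S : ℝ → Lp ℝ 2 μ →ₗ[ℝ] Lp ℝ 2 μ) : Prop :=
  ∀ t ∈ Icc (0 : ℝ) 1, ∀ u : Lp ℝ 2 μ, A.MemSob 1 u →
    A.MemSob 1 (S t u) ∧ A.nrm 1 (S t u) ≤ K * A.nrm 1 u ∧ A.nrm 0 (S t u) ≤ K * A.nrm 0 u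

/-- The commutator `[B_t, X_t]` is bounded from `H^1` to `H^0`, uniformly in `t ∈ [0,1]`. It is
taken in the weak sense: `⟨[B, X] u, v⟩ = ⟨X u, B v⟩ - ⟨B u, X^* v⟩` for `u`, `v` in `H^1`, where
`w = X^* v` is the adjoint for `⟨·,·⟩_t`. -/
def CommutatorBounded {d : ℕ} {N : Type*} [TopologicalSpace N]
    [ChartedSpace (EuclideanSpace ℝ (Fin d)) N] [MeasurableSpace N]
    (A : SobolevAtlas d N) (μ : Measure N) (K : ℝ≥0) (ρ : ℝ → N → ℝ)
    (B X : ℝ → Lp ℝ 2 μ →ₗ[ℝ] Lp ℝ 2 μ) : Prop :=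
  ∀ t ∈ Icc (0 : ℝ) 1, ∀ u v w : Lp ℝ 2 μ, A.MemSob 1 u → A.MemSob 1 v →
    (∀ z : Lp ℝ 2 μ, A.MemSob 1 z → wip μ (ρ t) (X t z) v = wip μ (ρ t) z w) →
    |wip μ (ρ t) (X t u) (B t v) - wip μ (ρ t) (B t u) w| ≤ K * A.nrm 1 u * A.nrm 0 v

/-- `f` belongs to `L²([0,1], H^1)`, its time derivative belongs to `L²([0,1], L²)`, `f` is the
representative that is continuous into `L²`, and `∂_t f = -B_t f + X_t f + S_t f` for almost
every `t ∈ [0,1]`. -/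
def IsEvolutionSolution {d : ℕ} {N : Type*} [TopologicalSpace N]
    [ChartedSpace (EuclideanSpace ℝ (Fin d)) N] [MeasurableSpace N]
    (A : SobolevAtlas d N) (μ : Measure N) (B X S : ℝ → Lp ℝ 2 μ →ₗ[ℝ] Lp ℝ 2 μ)
    (f : ℝ → Lp ℝ 2 μ) : Prop :=
  (∀ᵐ t ∂(volume.restrict (Icc (0 : ℝ) 1)), A.MemSob 1 (f t)) ∧
  ∫⁻ t in Icc (0 : ℝ) 1, A.sobNormSq 1 (f t) < ⊤ ∧
  ∃ g : ℝ → Lp ℝ 2 μ, MemLp g 2 (volume.restrict (Icc (0 : ℝ) 1)) ∧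
    (∀ t ∈ Icc (0 : ℝ) 1, f t = f 0 + ∫ s in (0 : ℝ)..t, g s) ∧
    ∀ᵐ t ∂(volume.restrict (Icc (0 : ℝ) 1)),
      g t = -(B t (f t)) + X t (f t) + S t (f t)

/-- The frequency ratio `⟨B f, B f⟩ / ⟨f, f⟩`. -/
def freqRatio {N : Type*} [MeasurableSpace N] (μ : Measure N) (ρ : N → ℝ)
    (B : Lp ℝ 2 μ →ₗ[ℝ] Lp ℝ 2 μ) (f : Lp ℝ 2 μ) : ℝ :=
  wip μ ρ (B f) (B f) / wip μ ρ f f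

end

/-! Choose `c` so large that `A = B + c ≥ 1`, and replace `S` by `S + c`; the equation keeps its
form. Write `⟨·,·⟩` for the inner product at time `t`. Formally, the derivative of `⟨A f, A f⟩` is
`-2⟨A(A f), A f⟩` plus errors of size `⟨A f, A f⟩`: the commutator `[A, X]` is of first order, `X`
is skew up to a bounded operator, `S` is of order zero, and the coefficients are Lipschitz in time.
Likewise `⟨f, f⟩' = -2⟨A f, f⟩` up to `O(⟨f, f⟩)`. In the derivative of the quotient `R = ⟨A f, A f⟩
/ ⟨f, f⟩` the leading terms have the good sign, because the moments of the spectral measure of `f`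
satisfy `⟨A f, A f⟩⟨A f, f⟩ ≤ ⟨A(A f), A f⟩⟨f, f⟩`. Hence `R' ≤ C R`.

The computation is not legitimate as it stands, since `A f` need not lie in the domain and `f` is
only known to be in `H¹` for almost every `t`. It is carried out for the defect `y = f - (1 + ε A)⁻¹
f = ε w`, with `w = A (1 + ε A)⁻¹ f`. The map `t ↦ ⟨y, y⟩` is absolutely continuous, the flux
estimate `IsFirstOrderSystem.flux_le` and the moment inequality `IsFirstOrderSystem.moment_le` hold
for `w` with constants free of `ε`, and `IsEvolution.defect_growth` follows by integration. Letting
`ε → 0` in `IsEvolution.ratio_growth` shows at once that `f t` is in `H¹` for every `t` and that `R`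
grows at most exponentially.

The bound in (a) is an equality at `t = 0`, so no factor may be lost in the return from `A` to `B =
A - c`. Since `⟨B f, B f⟩ = ⟨A f, A f⟩ - 2c⟨A f, f⟩ + c²⟨f, f⟩`, a lower bound for `⟨A f, f⟩ / ⟨f,
f⟩` is needed; `IsEvolution.form_ratio_ge` shows that this quotient decreases at most linearly,
because a bounded `R` makes `f` Lipschitz in time relative to its size. The same Lipschitz bound
prevents `f` from reaching zero. For (b), the `H^{1/2}` norm interpolates between `L²` and `H¹`, so
bounded `R` also bounds the relative rate of decrease of its square
(`IsEvolution.interpolated_lower_bound`).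

It remains to place the manifold problem in this abstract frame. The closedness of the `H¹` norm is
Fatou's lemma on the Fourier side. The approximate skewness of `X` is an integration by parts in
charts for `C¹` functions, extended by their density in `H¹` (`SobolevAtlas.IsDensity.skew`). It
also provides the adjoint `X^* v` that the weak commutator hypothesis requires
(`SobolevAtlas.IsDensity.abs_commutator_le`). -/

/-! ### Resolvents, moments and the flux estimate at a fixed time. -/

section AbstractStatic

open Filter Topology

variable {H : Type*} [NormedAddCommGroup H] [InnerProductSpace ℝ H]

/-- A norm-like function `n` on a subspace `V` of a Hilbert space whose sublevel sets are closed. -/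
structure IsClosedNorm (V : Submodule ℝ H) (n : H → ℝ) : Prop where
  nonneg : ∀ u, 0 ≤ n u
  closed : ∀ (u : ℕ → H) (x : H) (C : ℝ), (∀ k, u k ∈ V) → (∀ k, n (u k) ≤ C) →
    Tendsto u atTop (𝓝 x) → x ∈ V ∧ n x ≤ C

/-- The operators of the evolution equation at a fixed time: `p` is an equivalent inner product,
`A ≥ 1` is self-adjoint for `p` with domain `V` and of first order, `X` is a first-order operator
that is skew-symmetric up to a bounded operator and has a first-order commutator with `A`, and `S`
is of order zero. -/
structure IsFirstOrderSystem (κ : ℝ) (V : Submodule ℝ H) (n : H → ℝ) (p : H →L[ℝ] H →L[ℝ] ℝ)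
    (A X S : H →ₗ[ℝ] H) : Prop where
  one_le : 1 ≤ κ
  p_symm : ∀ u v, p u v = p v u
  p_le : ∀ u v, |p u v| ≤ κ * ‖u‖ * ‖v‖
  le_p : ∀ u, ‖u‖ ^ 2 ≤ κ * p u u
  A_symm : ∀ u ∈ V, ∀ v ∈ V, p (A u) v = p u (A v)
  A_adjoint : ∀ u w, (∀ v ∈ V, p u (A v) = p w v) → u ∈ V
  A_pos : ∀ u ∈ V, p u u ≤ p (A u) u
  n_le : ∀ u ∈ V, n u ^ 2 ≤ κ * p (A u) (A u)
  A_le : ∀ u ∈ V, ‖A u‖ ≤ κ * n u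
  X_le : ∀ u ∈ V, ‖X u‖ ≤ κ * n u
  X_skew : ∀ u ∈ V, ∀ v ∈ V, |p (X u) v + p u (X v)| ≤ κ * ‖u‖ * ‖v‖
  X_comm : ∀ u ∈ V, A u ∈ V → ∀ v ∈ V, |p (X u) (A v) - p (X (A u)) v| ≤ κ * n u * ‖v‖
  S_mem : ∀ u ∈ V, S u ∈ V
  n_S_le : ∀ u ∈ V, n (S u) ≤ κ * n u
  S_le : ∀ u ∈ V, ‖S u‖ ≤ κ * ‖u‖

theorem sq_le_mul_of_quadratic_nonneg {a b c : ℝ} (h : ∀ t : ℝ, 0 ≤ a + 2 * b * t + c * t ^ 2) :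
    b ^ 2 ≤ a * c := by
  have := discrim_le_zero (a := c) (b := 2 * b) (c := a) (fun x => by have := h x; nlinarith)
  rw [discrim] at this
  nlinarith

theorem exists_eq_inner_of_coercive [CompleteSpace H] {κ : ℝ} {p : H →L[ℝ] H →L[ℝ] ℝ} (hκ : 0 < κ)
    (hp : ∀ u, ‖u‖ ^ 2 ≤ κ * p u u) (z : H) : ∃ z', ∀ w, p z' w = inner ℝ z w := by
  have hc : IsCoercive p := by
    refine ⟨κ⁻¹, inv_pos.2 hκ, fun u => ?_⟩
    rw [mul_assoc, inv_mul_le_iff₀ hκ, ← sq]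
    exact hp u
  refine ⟨hc.continuousLinearEquivOfBilin.symm z, fun w => ?_⟩
  rw [← hc.continuousLinearEquivOfBilin_apply, ContinuousLinearEquiv.apply_symm_apply]

namespace IsFirstOrderSystem

variable {κ : ℝ} {V : Submodule ℝ H} {n : H → ℝ} {p : H →L[ℝ] H →L[ℝ] ℝ} {A X S : H →ₗ[ℝ] H}

theorem kappa_pos (h : IsFirstOrderSystem κ V n p A X S) : 0 < κ := one_pos.trans_le h.one_le

theorem p_nonneg (h : IsFirstOrderSystem κ V n p A X S) (u : H) : 0 ≤ p u u := by
  have h1 := h.le_p u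
  have h2 := h.kappa_pos
  by_contra h3
  nlinarith [sq_nonneg ‖u‖]

theorem p_self_le (h : IsFirstOrderSystem κ V n p A X S) (u : H) : p u u ≤ κ * ‖u‖ ^ 2 := by
  have := (le_abs_self _).trans (h.p_le u u)
  nlinarith

theorem p_cauchy (h : IsFirstOrderSystem κ V n p A X S) (u v : H) :
    p u v ^ 2 ≤ p u u * p v v := by
  refine sq_le_mul_of_quadratic_nonneg fun t => ?_
  have := h.p_nonneg (u + t • v)
  simp only [map_add, map_smul, add_apply, smul_apply,
    smul_eq_mul, h.p_symm v u] at this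
  nlinarith

theorem A_nonneg (h : IsFirstOrderSystem κ V n p A X S) {u : H} (hu : u ∈ V) :
    0 ≤ p (A u) u := (h.p_nonneg u).trans (h.A_pos u hu)

theorem A_cauchy (h : IsFirstOrderSystem κ V n p A X S) {u v : H} (hu : u ∈ V) (hv : v ∈ V) :
    p (A u) v ^ 2 ≤ p (A u) u * p (A v) v := by
  refine sq_le_mul_of_quadratic_nonneg fun t => ?_
  have := h.A_nonneg (V.add_mem hu (V.smul_mem t hv))
  simp only [map_add, map_smul, add_apply, smul_apply,
    smul_eq_mul] at this
  rw [h.A_symm v hv u hu, h.p_symm v (A u)] at this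
  nlinarith

theorem p_self_le_A (h : IsFirstOrderSystem κ V n p A X S) {u : H} (hu : u ∈ V) :
    p u u ≤ p (A u) (A u) := by
  have h1 := h.A_pos u hu
  have h2 := h.p_cauchy (A u) u
  have h3 := h.p_nonneg u
  by_contra hlt
  push Not at hlt
  have h4 := h.p_nonneg (A u)
  nlinarith

/-- The energy identity for `u + ε A u = z`. -/
theorem resolvent_identity (h : IsFirstOrderSystem κ V n p A X S) {ε : ℝ} {u z : H}
    (hz : u + ε • A u = z) :
    p z z = p u u + 2 * ε * p (A u) u + ε ^ 2 * p (A u) (A u) := by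
  subst hz
  simp only [map_add, map_smul, add_apply, smul_apply,
    smul_eq_mul]
  rw [h.p_symm u (A u)]
  ring

theorem resolvent_p_le (h : IsFirstOrderSystem κ V n p A X S) {ε : ℝ} (hε : 0 < ε) {u z : H}
    (hu : u ∈ V) (hz : u + ε • A u = z) : p u u ≤ p z z := by
  have h1 := h.resolvent_identity hz
  have h2 := mul_nonneg hε.le (h.A_nonneg hu)
  have h3 := mul_nonneg (sq_nonneg ε) (h.p_nonneg (A u))
  linarith

theorem resolvent_A_le (h : IsFirstOrderSystem κ V n p A X S) {ε : ℝ} (hε : 0 < ε) {u z : H}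
    (hu : u ∈ V) (hz : u + ε • A u = z) : ε ^ 2 * p (A u) (A u) ≤ p z z := by
  have h1 := h.resolvent_identity hz
  have h2 := mul_nonneg hε.le (h.A_nonneg hu)
  have h3 := h.p_nonneg u
  linarith

theorem norm_le_of_p_le (h : IsFirstOrderSystem κ V n p A X S) {u z : H}
    (hp : p u u ≤ p z z) : ‖u‖ ≤ κ * ‖z‖ := by
  have h1 := h.le_p u
  have h2 := h.p_self_le z
  have h3 := h.kappa_pos
  refine abs_le_of_sq_le_sq' ?_ (by positivity) |>.2
  calc ‖u‖ ^ 2 ≤ κ * p u u := h1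
    _ ≤ κ * (κ * ‖z‖ ^ 2) := by gcongr; exact hp.trans h2
    _ = (κ * ‖z‖) ^ 2 := by ring

theorem resolvent_norm_le (h : IsFirstOrderSystem κ V n p A X S) {ε : ℝ} (hε : 0 < ε) {u z : H}
    (hu : u ∈ V) (hz : u + ε • A u = z) : ‖u‖ ≤ κ * ‖z‖ :=
  h.norm_le_of_p_le (h.resolvent_p_le hε hu hz)

theorem n_le_norm_A (h : IsFirstOrderSystem κ V n p A X S) {u : H} (hu : u ∈ V) :
    n u ≤ κ * ‖A u‖ := by
  have h1 := h.n_le u hu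
  have h2 := h.p_self_le (A u)
  have h3 := h.kappa_pos
  refine abs_le_of_sq_le_sq' ?_ (by positivity) |>.2
  calc n u ^ 2 ≤ κ * p (A u) (A u) := h1
    _ ≤ κ * (κ * ‖A u‖ ^ 2) := by gcongr
    _ = (κ * ‖A u‖) ^ 2 := by ring

/-- The bound degenerates like `1 / ε`. In the time estimates it is always multiplied by an `ε`
coming from `ε • A`, so these remain uniform in `ε`. -/
theorem resolvent_n_le (h : IsFirstOrderSystem κ V n p A X S) {ε : ℝ} (hε : 0 < ε) {u z : H}
    (hu : u ∈ V) (hz : u + ε • A u = z) : n u ≤ κ / ε * ‖z‖ := by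
  have h1 := h.n_le u hu
  have h2 := h.resolvent_A_le hε hu hz
  have h3 := h.p_self_le z
  have h4 := h.kappa_pos
  refine abs_le_of_sq_le_sq' ?_ (by positivity) |>.2
  calc n u ^ 2 ≤ κ * p (A u) (A u) := h1
    _ = κ / ε ^ 2 * (ε ^ 2 * p (A u) (A u)) := by field_simp
    _ ≤ κ / ε ^ 2 * (κ * ‖z‖ ^ 2) := mul_le_mul_of_nonneg_left (h2.trans h3) (by positivity)
    _ = (κ / ε * ‖z‖) ^ 2 := by field_simp

theorem resolvent_symm (h : IsFirstOrderSystem κ V n p A X S) {ε : ℝ} {u z u' z' : H}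
    (hu : u ∈ V) (hz : u + ε • A u = z) (hu' : u' ∈ V) (hz' : u' + ε • A u' = z') :
    p u z' = p z u' := by
  subst hz hz'
  simp only [map_add, map_smul, add_apply, smul_apply,
    smul_eq_mul, h.A_symm u hu u' hu']

theorem exists_riesz [CompleteSpace H] (h : IsFirstOrderSystem κ V n p A X S) (z : H) :
    ∃ z', ∀ w, p z' w = inner ℝ z w := exists_eq_inner_of_coercive h.kappa_pos h.le_p z

/-- The range of `1 + ε A` is closed by the a priori bounds, and its orthogonal complement vanishes
because `A` is self-adjoint and nonnegative. -/
theorem exists_resolvent [CompleteSpace H] (hn : IsClosedNorm V n)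
    (h : IsFirstOrderSystem κ V n p A X S) {ε : ℝ} (hε : 0 < ε) (z : H) :
    ∃ v ∈ V, v + ε • A v = z := by
  set R : Submodule ℝ H := V.map (LinearMap.id + ε • A) with hR
  have memR : ∀ z, z ∈ R ↔ ∃ v ∈ V, v + ε • A v = z := by
    intro z; simp [hR, Submodule.mem_map]
  have hclosed : IsClosed (R : Set H) := by
    refine IsSeqClosed.isClosed fun zs z hzs hlim => ?_
    choose u huV hu using fun k => (memR _).1 (hzs k)
    have hdiff : ∀ k l, (u k - u l) + ε • A (u k - u l) = zs k - zs l := by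
      intro k l; rw [← hu k, ← hu l, map_sub, smul_sub]; abel
    have hcau : CauchySeq u := by
      rw [Metric.cauchySeq_iff']
      intro η hη
      obtain ⟨N, hN⟩ := Metric.cauchySeq_iff'.1 hlim.cauchySeq (η / κ) (div_pos hη h.kappa_pos)
      refine ⟨N, fun k hk => ?_⟩
      have h1 := h.resolvent_norm_le hε (V.sub_mem (huV k) (huV N)) (hdiff k N)
      have h2 := hN k hk
      rw [dist_eq_norm] at h2 ⊢
      calc ‖u k - u N‖ ≤ κ * ‖zs k - zs N‖ := h1
        _ < κ * (η / κ) := by gcongr; exact h.kappa_pos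
        _ = η := by field_simp [h.kappa_pos.ne']
    obtain ⟨x, hx⟩ := cauchySeq_tendsto_of_complete hcau
    -- `n` is not assumed subadditive, so convergence of `u` in `n` comes from the bound on `u k - u
    -- l` by letting `l → ∞` and using closedness.
    have key : ∀ η > 0, ∃ N, ∀ k ≥ N, u k - x ∈ V ∧ n (u k - x) ≤ κ / ε * η := by
      intro η hη
      obtain ⟨N, hN⟩ := Metric.cauchySeq_iff.1 hlim.cauchySeq η hη
      refine ⟨N, fun k hk => hn.closed (fun l => u k - u (l + N)) _ _
        (fun l => V.sub_mem (huV _) (huV _)) (fun l => ?_)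
        (tendsto_const_nhds.sub (hx.comp (tendsto_add_atTop_nat N)))⟩
      refine (h.resolvent_n_le hε (V.sub_mem (huV _) (huV _)) (hdiff k _)).trans ?_
      have h2 := (hN k hk (l + N) (Nat.le_add_left _ _)).le
      rw [dist_eq_norm] at h2
      have := h.kappa_pos
      gcongr
    have hxV : x ∈ V := by
      obtain ⟨N, hN⟩ := key 1 one_pos
      have := V.sub_mem (huV N) (hN N le_rfl).1
      simpa using this
    refine (memR z).2 ⟨x, hxV, ?_⟩
    have hAx : Tendsto (fun k => A (u k)) atTop (𝓝 (A x)) := by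
      rw [Metric.tendsto_atTop]
      intro η hη
      have hκ := h.kappa_pos
      obtain ⟨N, hN⟩ := key (ε * η / (2 * κ ^ 2)) (by positivity)
      refine ⟨N, fun k hk => ?_⟩
      rw [dist_eq_norm, ← map_sub]
      calc ‖A (u k - x)‖ ≤ κ * n (u k - x) := h.A_le _ (hN k hk).1
        _ ≤ κ * (κ / ε * (ε * η / (2 * κ ^ 2))) := by gcongr; exact (hN k hk).2
        _ = η / 2 := by field_simp
        _ < η := by linarith
    have h1 : Tendsto (fun k => u k + ε • A (u k)) atTop (𝓝 (x + ε • A x)) :=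
      hx.add (hAx.const_smul ε)
    simp only [hu] at h1
    exact tendsto_nhds_unique h1 hlim
  have htop : R = ⊤ := by
    have : CompleteSpace R := hclosed.completeSpace_coe
    rw [← Submodule.orthogonal_eq_bot_iff, Submodule.eq_bot_iff]
    intro z hz
    obtain ⟨z', hz'⟩ := h.exists_riesz z
    have horth : ∀ v ∈ V, p z' (v + ε • A v) = 0 := by
      intro v hv
      rw [hz', real_inner_comm]
      exact hz _ ((memR _).2 ⟨v, hv, rfl⟩)
    -- Orthogonality says that `ε A z' = -z'` weakly. The adjoint-domain condition then puts `z'`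
    -- into `V`, where pairing with `z'` itself and positivity force `z' = 0`.
    have hzV : z' ∈ V := by
      refine h.A_adjoint z' (-(ε⁻¹ • z')) fun v hv => ?_
      have := horth v hv
      simp only [map_add, map_smul, smul_eq_mul] at this
      simp only [map_neg, map_smul, neg_apply, smul_apply,
        smul_eq_mul]
      field_simp
      linarith
    have h0 := horth z' hzV
    simp only [map_add, map_smul, smul_eq_mul] at h0
    rw [h.p_symm z' (A z')] at h0
    have h1 := mul_nonneg hε.le (h.A_nonneg hzV)
    have h2 := h.le_p z'
    have h3 : p z' z' ≤ 0 := by linarith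
    have h4 : ‖z'‖ ^ 2 ≤ 0 := h2.trans (mul_nonpos_of_nonneg_of_nonpos h.kappa_pos.le h3)
    have h5 : z' = 0 := by
      rw [← norm_eq_zero]; exact pow_eq_zero_iff two_ne_zero |>.1 (le_antisymm h4 (sq_nonneg _))
    have h6 := hz' z
    rw [h5] at h6
    simp only [map_zero, zero_apply] at h6
    exact inner_self_eq_zero.1 h6.symm
  exact (memR z).1 (htop ▸ Submodule.mem_top)

/-- The domain `V` is dense. -/
theorem exists_mem_near [CompleteSpace H] (hn : IsClosedNorm V n)
    (h : IsFirstOrderSystem κ V n p A X S) (z : H) {η : ℝ} (hη : 0 < η) :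
    ∃ v ∈ V, ‖v - z‖ < η := by
  have htop : V.topologicalClosure = ⊤ := by
    rw [Submodule.topologicalClosure_eq_top_iff, Submodule.eq_bot_iff]
    intro z hz
    obtain ⟨z', hz'⟩ := h.exists_riesz z
    -- With `v + A v = z'`, orthogonality to `v` reads `p v v + p (A v) v = 0`, so `v` and with it
    -- `z'` vanish.
    obtain ⟨v, hv, hvz⟩ := h.exists_resolvent hn one_pos z'
    have h0 : p z' v = 0 := by rw [hz', real_inner_comm]; exact hz v hv
    rw [← hvz] at h0
    simp only [one_smul, map_add, add_apply] at h0
    have h1 := h.A_nonneg hv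
    have h2 := h.le_p v
    have h4 : ‖v‖ ^ 2 ≤ 0 :=
      h2.trans (mul_nonpos_of_nonneg_of_nonpos h.kappa_pos.le (by linarith))
    have h5 : v = 0 := by
      rw [← norm_eq_zero]; exact pow_eq_zero_iff two_ne_zero |>.1 (le_antisymm h4 (sq_nonneg _))
    have h6 : z' = 0 := by rw [← hvz, h5]; simp
    have h7 := hz' z
    rw [h6] at h7
    simp only [map_zero, zero_apply] at h7
    exact inner_self_eq_zero.1 h7.symm
  have hz : z ∈ closure (V : Set H) := by
    rw [← Submodule.topologicalClosure_coe, htop]; trivial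
  obtain ⟨v, hv, hd⟩ := Metric.mem_closure_iff.1 hz η hη
  exact ⟨v, hv, by rwa [← dist_eq_norm, dist_comm]⟩

/-- The comparison of spectral moments `⟨A w, w⟩ ⟨f, f⟩ ≥ ⟨w, w⟩ ⟨A f, f⟩` for
`w = A (1 + ε A)⁻¹ f`. -/
theorem moment_le (h : IsFirstOrderSystem κ V n p A X S) {ε : ℝ} (hε : 0 < ε) {f v : H}
    (hf : f ∈ V) (hv : v ∈ V) (hvf : v + ε • A v = f) :
    p (A v) (A v) * p (A f) f ≤ p (A (A v)) (A v) * p f f := by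
  have hw : A v ∈ V := by
    have h1 : ε • A v ∈ V := by rw [← sub_eq_of_eq_add' hvf.symm]; exact V.sub_mem hf hv
    have := V.smul_mem ε⁻¹ h1
    rwa [smul_smul, inv_mul_cancel₀ hε.ne', one_smul] at this
  set w := A v with hwdef
  have hff := h.resolvent_identity hvf
  rw [← hwdef] at hff
  have hAf : p (A f) f = p w v + 2 * ε * p w w + ε ^ 2 * p (A w) w := by
    rw [← hvf]
    simp only [map_add, map_smul, add_apply, smul_apply,
      smul_eq_mul]
    rw [h.A_symm w hw v hv, ← hwdef]
    ring
  -- Let `a_k` be the moment `⟨A^k v, v⟩`. Cauchy–Schwarz gives `a_2² ≤ a_1 a_3` and `a_1² ≤ a_0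
  -- a_2`, hence `a_1 a_2 ≤ a_0 a_3`. After substituting `f = v + ε w`, the claim follows by
  -- comparing the coefficients of each power of `ε`.
  have h1 : p w w ^ 2 ≤ p w v * p (A w) w := h.A_cauchy hv hw
  have h2 : p w v ^ 2 ≤ p w w * p v v := h.p_cauchy w v
  have ha := h.p_nonneg v
  have hb : 0 ≤ p w v := h.A_nonneg hv
  have he := h.p_nonneg w
  have hh := h.A_nonneg hw
  have h3 : p w w * p w v ≤ p (A w) w * p v v := by
    rcases eq_or_lt_of_le hb with hb0 | hb0
    · rw [← hb0, mul_zero]; positivity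
    · rcases eq_or_lt_of_le he with he0 | he0
      · rw [← he0, zero_mul]; positivity
      · have h4 : p w w ^ 2 * p w v ^ 2 ≤ (p w v * p (A w) w) * (p w w * p v v) := by gcongr
        have h5 : (p w w * p w v) * (p w w * p w v) ≤
            (p w w * p w v) * (p (A w) w * p v v) := by nlinarith
        exact le_of_mul_le_mul_left h5 (by positivity)
  rw [hff, hAf]
  nlinarith [mul_le_mul_of_nonneg_left h1 hε.le]

/-- The main estimate: the contribution of the equation to the growth of `⟨w, w⟩`,
`w = A (1 + ε A)⁻¹ f`. -/
theorem flux_le (h : IsFirstOrderSystem κ V n p A X S) {ε : ℝ}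
    (hε : 0 < ε) {f v z : H} (hf : f ∈ V) (hv : v ∈ V) (hvf : v + ε • A v = f)
    (hz : z ∈ V) (hzw : z + ε • A z = A v) :
    p (-(A f) + X f + S f) (A z) ≤ -p (A (A v)) (A v) + 5 * κ ^ 6 * p (A v) (A v) := by
  have hw : A v ∈ V := by
    have h1 : ε • A v ∈ V := by rw [← sub_eq_of_eq_add' hvf.symm]; exact V.sub_mem hf hv
    have := V.smul_mem ε⁻¹ h1
    rwa [smul_smul, inv_mul_cancel₀ hε.ne', one_smul] at this
  have hcomm := h.X_comm v hv hw z hz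
  have hnv := h.n_le_norm_A hv
  have hzn := h.resolvent_norm_le hε hz hzw
  set w := A v with hwdef
  have hκ := h.one_le
  have hκ0 := h.kappa_pos
  have hpw : ∀ q : H, p q w = p q z + ε * p q (A z) := by
    intro q
    rw [← smul_eq_mul, ← map_smul, ← map_add, hzw]
  -- The dissipative term: expanding `f = v + ε w`, moving `A` by symmetry and recombining `z + ε A
  -- z = w`.
  have hA : p (A f) (A z) = p (A w) w := by
    rw [← hvf]
    simp only [map_add, map_smul, add_apply, smul_apply,
      smul_eq_mul]
    rw [← hwdef, ← h.A_symm w hw z hz, hpw]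
  -- Writing `f = v + ε w` isolates the commutator on the pair `v`, `z`, where it is available
  -- because `A v = w` is in `V`. What is left, `p (X w) w`, is controlled by skewness.
  have hX : p (X f) (A z) = (p (X v) (A z) - p (X w) z) + p (X w) w := by
    rw [← hvf, hpw (X w)]
    simp only [map_add, map_smul, add_apply, smul_apply,
      smul_eq_mul]
    ring
  -- On `S v` the operator `A` is absorbed by the bound of `S` for `n`; on `S w` only `ε A z = w -
  -- z` occurs, so the order-zero bound suffices.
  have hS : p (S f) (A z) = p (A (S v)) z + p (S w) (w - z) := by
    have hwz : w - z = ε • A z := by rw [← hzw]; abel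
    rw [hwz, ← hvf, h.A_symm _ (h.S_mem v hv) z hz]
    simp only [map_add, map_smul, add_apply, smul_apply,
      smul_eq_mul]
  have e1 : p (X v) (A z) - p (X w) z ≤ κ ^ 3 * ‖w‖ ^ 2 := by
    refine (le_abs_self _).trans (hcomm.trans ?_)
    calc κ * n v * ‖z‖ ≤ κ * (κ * ‖w‖) * (κ * ‖w‖) := by gcongr
      _ = κ ^ 3 * ‖w‖ ^ 2 := by ring
  have e2 : p (X w) w ≤ κ * ‖w‖ ^ 2 := by
    have h1 := (le_abs_self _).trans (h.X_skew w hw w hw)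
    rw [h.p_symm w (X w)] at h1
    nlinarith [mul_nonneg hκ0.le (sq_nonneg ‖w‖)]
  have e3 : p (A (S v)) z ≤ κ ^ 5 * ‖w‖ ^ 2 := by
    refine (le_abs_self _).trans ((h.p_le _ _).trans ?_)
    have h1 := h.A_le _ (h.S_mem v hv)
    have h2 := h.n_S_le v hv
    calc κ * ‖A (S v)‖ * ‖z‖ ≤ κ * (κ * (κ * (κ * ‖w‖))) * (κ * ‖w‖) := by
          gcongr
          refine h1.trans ?_
          gcongr
          refine h2.trans ?_
          gcongr
      _ = κ ^ 5 * ‖w‖ ^ 2 := by ring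
  have e4 : p (S w) (w - z) ≤ (κ ^ 2 + κ ^ 3) * ‖w‖ ^ 2 := by
    refine (le_abs_self _).trans ((h.p_le _ _).trans ?_)
    have h1 := h.S_le w hw
    have h2 : ‖w - z‖ ≤ ‖w‖ + κ * ‖w‖ := (norm_sub_le _ _).trans (by gcongr)
    calc κ * ‖S w‖ * ‖w - z‖ ≤ κ * (κ * ‖w‖) * (‖w‖ + κ * ‖w‖) := by gcongr
      _ = (κ ^ 2 + κ ^ 3) * ‖w‖ ^ 2 := by ring
  -- Five contributions, each at most `κ ^ 5` as `κ ≥ 1`. The sixth power of `κ` comes from `‖w‖ ^ 2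
  -- ≤ κ * p w w`.
  have e5 : κ ^ 3 + κ + κ ^ 5 + (κ ^ 2 + κ ^ 3) ≤ 5 * κ ^ 5 := by
    have a1 : κ ≤ κ ^ 5 := le_self_pow₀ hκ (by norm_num)
    have a2 : κ ^ 2 ≤ κ ^ 5 := pow_le_pow_right₀ hκ (by norm_num)
    have a3 : κ ^ 3 ≤ κ ^ 5 := pow_le_pow_right₀ hκ (by norm_num)
    linarith
  have e6 := h.le_p w
  have e7 : 5 * κ ^ 5 * ‖w‖ ^ 2 ≤ 5 * κ ^ 6 * p w w := by
    calc 5 * κ ^ 5 * ‖w‖ ^ 2 ≤ 5 * κ ^ 5 * (κ * p w w) := by gcongr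
      _ = 5 * κ ^ 6 * p w w := by ring
  simp only [map_add, map_neg, add_apply, neg_apply]
  rw [hA, hX, hS]
  nlinarith [mul_le_mul_of_nonneg_right e5 (sq_nonneg ‖w‖)]

end IsFirstOrderSystem

end AbstractStatic

/-! ### Absolute continuity in time of quadratic quantities. -/

section AbstractDynamics

open Filter Topology

theorem AbsolutelyContinuousOnInterval.of_abs_sub_le {F G : ℝ → ℝ} {a b c : ℝ}
    (hG : AbsolutelyContinuousOnInterval G a b)
    (h : ∀ s ∈ uIcc a b, ∀ t ∈ uIcc a b, |F s - F t| ≤ c * |G s - G t|) :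
    AbsolutelyContinuousOnInterval F a b := by
  have h0 := (hG.const_mul c)
  rw [AbsolutelyContinuousOnInterval] at h0 ⊢
  have h1 := h0.abs
  rw [abs_zero] at h1
  refine squeeze_zero' (Eventually.of_forall fun E => Finset.sum_nonneg fun _ _ => dist_nonneg)
    ?_ h1
  refine (eventually_inf_principal).2 (Eventually.of_forall fun E hE => ?_)
  refine le_trans (Finset.sum_le_sum fun i hi => ?_) (le_abs_self _)
  have hE1 := hE.1 i hi
  rw [Real.dist_eq, Real.dist_eq]
  refine (h _ hE1.1 _ hE1.2).trans ?_
  rw [← mul_sub, abs_mul]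
  gcongr
  exact le_abs_self c

/-- Absolutely continuous functions are differentiable almost everywhere. At such a point a bound on
right difference quotients is enough, which avoids differentiating the resolvent. -/
theorem HasDerivAt.le_of_eventually_sub_le {W U : ℝ → ℝ} {W' U₀ t : ℝ} (hW : HasDerivAt W W' t)
    (hU : Tendsto U (𝓝[>] t) (𝓝 U₀)) (h : ∀ᶠ s in 𝓝[>] t, W s - W t ≤ (s - t) * U s) :
    W' ≤ U₀ := by
  have h1 : Tendsto (slope W t) (𝓝[>] t) (𝓝 W') :=
    hW.tendsto_slope.mono_left (nhdsWithin_mono _ fun s hs => (ne_of_gt hs))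
  refine le_of_tendsto_of_tendsto h1 hU ?_
  filter_upwards [h, self_mem_nhdsWithin] with s hs hst
  rw [slope_def_field, div_le_iff₀ (sub_pos.2 hst), mul_comm]
  exact hs

variable {H : Type*} [NormedAddCommGroup H] [InnerProductSpace ℝ H]

/-- A solution `f` on `[0, 1]` of `∂ₜ f = -A f + X f + S f`, with coefficients that form a
first-order system at each time and are Lipschitz in time. -/
structure IsEvolution (κ : ℝ) (V : Submodule ℝ H) (n : H → ℝ) (p : ℝ → H →L[ℝ] H →L[ℝ] ℝ)
    (A X S : ℝ → H →ₗ[ℝ] H) (f g : ℝ → H) : Prop where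
  closed : IsClosedNorm V n
  system : ∀ t ∈ Icc (0 : ℝ) 1, IsFirstOrderSystem κ V n (p t) (A t) (X t) (S t)
  p_lip : ∀ s ∈ Icc (0 : ℝ) 1, ∀ t ∈ Icc (0 : ℝ) 1, ∀ u v,
    |p s u v - p t u v| ≤ κ * |s - t| * ‖u‖ * ‖v‖
  A_lip : ∀ s ∈ Icc (0 : ℝ) 1, ∀ t ∈ Icc (0 : ℝ) 1, ∀ u ∈ V, ‖A s u - A t u‖ ≤ κ * |s - t| * n u
  integrable : IntervalIntegrable g volume 0 1
  eq_integral : ∀ t ∈ Icc (0 : ℝ) 1, f t = f 0 + ∫ s in (0 : ℝ)..t, g s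
  ae_eq : ∀ᵐ t ∂(volume.restrict (Icc (0 : ℝ) 1)),
    f t ∈ V ∧ g t = -(A t (f t)) + X t (f t) + S t (f t)
  init : f 0 ∈ V

namespace IsEvolution

variable {κ : ℝ} {V : Submodule ℝ H} {n : H → ℝ} {p : ℝ → H →L[ℝ] H →L[ℝ] ℝ}
  {A X S : ℝ → H →ₗ[ℝ] H} {f g : ℝ → H}

theorem one_le (h : IsEvolution κ V n p A X S f g) : 1 ≤ κ :=
  (h.system 0 ⟨le_rfl, zero_le_one⟩).one_le

theorem sub_eq (h : IsEvolution κ V n p A X S f g) {s t : ℝ} (hs : s ∈ Icc (0 : ℝ) 1)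
    (ht : t ∈ Icc (0 : ℝ) 1) : f s - f t = ∫ r in t..s, g r := by
  have hi : ∀ r ∈ Icc (0 : ℝ) 1, IntervalIntegrable g volume 0 r := fun r hr =>
    h.integrable.mono_set (by rw [uIcc_of_le hr.1, uIcc_of_le zero_le_one]; exact Icc_subset_Icc_right hr.2)
  rw [h.eq_integral s hs, h.eq_integral t ht, add_sub_add_left_eq_sub,
    intervalIntegral.integral_interval_sub_left (hi s hs) (hi t ht)]

/-- The common modulus of absolute continuity, `t ↦ ∫₀ᵗ (‖g‖ + 1)`. -/
theorem exists_modulus (h : IsEvolution κ V n p A X S f g) :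
    ∃ G : ℝ → ℝ, AbsolutelyContinuousOnInterval G 0 1 ∧
      (∀ s ∈ Icc (0 : ℝ) 1, ∀ t ∈ Icc (0 : ℝ) 1, ‖f s - f t‖ + |s - t| ≤ |G s - G t|) := by
  have hi : IntervalIntegrable (fun r => ‖g r‖ + 1) volume 0 1 :=
    h.integrable.norm.add intervalIntegrable_const
  -- The summand `1` makes the modulus dominate `|s - t|`, the modulus of the coefficients.
  refine ⟨fun t => ∫ r in (0 : ℝ)..t, (‖g r‖ + 1),
    hi.absolutelyContinuousOnInterval_intervalIntegral (by simp), ?_⟩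
  have key : ∀ s ∈ Icc (0 : ℝ) 1, ∀ t ∈ Icc (0 : ℝ) 1, t ≤ s → ‖f s - f t‖ + |s - t| ≤
      |(∫ r in (0 : ℝ)..s, (‖g r‖ + 1)) - ∫ r in (0 : ℝ)..t, (‖g r‖ + 1)| := by
    intro s hs t ht hts
    have hsub : ∀ {a b : ℝ}, a ∈ Icc (0 : ℝ) 1 → b ∈ Icc (0 : ℝ) 1 → uIcc a b ⊆ uIcc 0 1 :=
      fun ha hb => by rw [uIcc_of_le (zero_le_one (α := ℝ))]; exact uIcc_subset_Icc ha hb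
    have h0 : (0 : ℝ) ∈ Icc (0 : ℝ) 1 := ⟨le_rfl, zero_le_one⟩
    rw [intervalIntegral.integral_interval_sub_left (hi.mono_set (hsub h0 hs))
      (hi.mono_set (hsub h0 ht)), h.sub_eq hs ht, abs_of_nonneg (sub_nonneg.2 hts),
      intervalIntegral.integral_add (h.integrable.norm.mono_set (hsub ht hs))
        intervalIntegrable_const]
    refine le_trans ?_ (le_abs_self _)
    have := intervalIntegral.norm_integral_le_integral_norm (f := g) (μ := volume) hts
    simpa using this
  intro s hs t ht
  rcases le_total t s with hts | hts
  · exact key s hs t ht hts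
  · have := key t ht s hs hts
    rwa [norm_sub_rev, abs_sub_comm, abs_sub_comm (∫ r in (0 : ℝ)..t, (‖g r‖ + 1))] at this

/-- Separates the motion of the form from that of the vector; the last term is a quadratic
remainder, negligible or dropped by positivity later. -/
theorem quad_sub (h : IsEvolution κ V n p A X S f g) {s t : ℝ} (ht : t ∈ Icc (0 : ℝ) 1) (a b : H) :
    p s a a - p t b b = (p s a a - p t a a) + 2 * p t (a - b) b + p t (a - b) (a - b) := by
  simp only [map_sub, sub_apply]
  rw [(h.system t ht).p_symm b a]
  ring

theorem quad_abs_sub_le (h : IsEvolution κ V n p A X S f g) {G : ℝ → ℝ}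
    (hG : AbsolutelyContinuousOnInterval G 0 1)
    (hfG : ∀ s ∈ Icc (0 : ℝ) 1, ∀ t ∈ Icc (0 : ℝ) 1, ‖f s - f t‖ + |s - t| ≤ |G s - G t|)
    {y : ℝ → H} {c : ℝ} (hc : 0 ≤ c)
    (hy : ∀ s ∈ Icc (0 : ℝ) 1, ∀ t ∈ Icc (0 : ℝ) 1, ‖y s - y t‖ ≤ c * |G s - G t|) :
    ∃ c' : ℝ, ∀ s ∈ Icc (0 : ℝ) 1, ∀ t ∈ Icc (0 : ℝ) 1,
      |p s (y s) (y s) - p t (y t) (y t)| ≤ c' * |G s - G t| := by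
  obtain ⟨C, hC⟩ := hG.exists_bound
  rw [uIcc_of_le (zero_le_one (α := ℝ))] at hC
  have h0 : (0 : ℝ) ∈ Icc (0 : ℝ) 1 := ⟨le_rfl, zero_le_one⟩
  have hC0 : 0 ≤ C := (norm_nonneg _).trans (hC 0 h0)
  have hGb : ∀ s ∈ Icc (0 : ℝ) 1, ∀ t ∈ Icc (0 : ℝ) 1, |G s - G t| ≤ 2 * C := fun s hs t ht => by
    have := hC s hs; have := hC t ht
    refine (norm_sub_le (G s) (G t)).trans ?_
    linarith
  set L := ‖y 0‖ + c * (2 * C) with hL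
  have hL0 : 0 ≤ L := by positivity
  have hyL : ∀ s ∈ Icc (0 : ℝ) 1, ‖y s‖ ≤ L := fun s hs => by
    have h1 : ‖y s‖ ≤ ‖y 0‖ + ‖y s - y 0‖ := by
      simpa using norm_add_le (y 0) (y s - y 0)
    refine h1.trans ?_
    rw [hL]
    gcongr
    exact (hy s hs 0 h0).trans (by gcongr; exact hGb s hs 0 h0)
  have hκ : 0 ≤ κ := zero_le_one.trans h.one_le
  refine ⟨κ * L * L + 2 * κ * c * L + κ * c * (2 * L), fun s hs t ht => ?_⟩
  rw [h.quad_sub ht]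
  have hst : |s - t| ≤ |G s - G t| := by
    have := hfG s hs t ht; linarith [norm_nonneg (f s - f t)]
  have e1 := h.p_lip s hs t ht (y s) (y s)
  have e2 := (h.system t ht).p_le (y s - y t) (y t)
  have e3 := (h.system t ht).p_le (y s - y t) (y s - y t)
  have e4 := hy s hs t ht
  have e5 : ‖y s - y t‖ ≤ 2 * L := (norm_sub_le _ _).trans (by linarith [hyL s hs, hyL t ht])
  have e6 := hyL s hs
  have e7 := hyL t ht
  have a1 : κ * |s - t| * ‖y s‖ * ‖y s‖ ≤ κ * |G s - G t| * L * L := by gcongr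
  have a2 : κ * ‖y s - y t‖ * ‖y t‖ ≤ κ * (c * |G s - G t|) * L := by gcongr
  have a3 : κ * ‖y s - y t‖ * ‖y s - y t‖ ≤ κ * (c * |G s - G t|) * (2 * L) := by gcongr
  refine (abs_add_le _ _).trans ((add_le_add_left (abs_add_le _ _) _).trans ?_)
  rw [abs_mul, abs_two]
  calc _ ≤ κ * |G s - G t| * L * L + 2 * (κ * (c * |G s - G t|) * L) +
        κ * (c * |G s - G t|) * (2 * L) := by gcongr <;> linarith
    _ = _ := by ring

theorem ae_hasDerivAt (h : IsEvolution κ V n p A X S f g) [CompleteSpace H] :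
    ∀ᵐ t, t ∈ Ioo (0 : ℝ) 1 → HasDerivAt f (g t) t ∧ f t ∈ V ∧
      g t = -(A t (f t)) + X t (f t) + S t (f t) := by
  have h1 := h.integrable.ae_hasDerivAt_integral
  have h2 := (ae_restrict_iff' measurableSet_Icc).1 h.ae_eq
  filter_upwards [h1, h2] with t ht1 ht2 ht
  refine ⟨?_, ht2 (Ioo_subset_Icc_self ht)⟩
  have h3 := ht1 (by rw [uIcc_of_le (zero_le_one (α := ℝ))]; exact Ioo_subset_Icc_self ht) 0 (by simp)
  refine (h3.const_add (f 0)).congr_of_eventuallyEq ?_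
  filter_upwards [Ioo_mem_nhds ht.1 ht.2] with s hs
  exact h.eq_integral s (Ioo_subset_Icc_self hs)

end IsEvolution

end AbstractDynamics

/-! ### Differential inequalities for the defect and for the mass. -/

section AbstractGrowth

open Filter Topology

variable {H : Type*} [NormedAddCommGroup H] [InnerProductSpace ℝ H]

namespace IsEvolution

variable {κ : ℝ} {V : Submodule ℝ H} {n : H → ℝ} {p : ℝ → H →L[ℝ] H →L[ℝ] ℝ}
  {A X S : ℝ → H →ₗ[ℝ] H} {f g : ℝ → H}

theorem exists_bound (h : IsEvolution κ V n p A X S f g) :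
    ∃ L, ∀ t ∈ Icc (0 : ℝ) 1, ‖f t‖ ≤ L := by
  obtain ⟨G, hG, hfG⟩ := h.exists_modulus
  obtain ⟨C, hC⟩ := hG.exists_bound
  rw [uIcc_of_le (zero_le_one (α := ℝ))] at hC
  have h0 : (0 : ℝ) ∈ Icc (0 : ℝ) 1 := ⟨le_rfl, zero_le_one⟩
  refine ⟨‖f 0‖ + 2 * C, fun t ht => ?_⟩
  have h1 : ‖f t‖ ≤ ‖f 0‖ + ‖f t - f 0‖ := by simpa using norm_add_le (f 0) (f t - f 0)
  have h2 := hfG t ht 0 h0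
  have h3 := norm_sub_le (G t) (G 0)
  rw [Real.norm_eq_abs (G t - G 0)] at h3
  linarith [hC t ht, hC 0 h0, abs_nonneg (t - 0)]

/-- The difference of two resolvents solves a resolvent equation at time `s` whose source contains
`ε • (A s - A t) (v t)`. Here `ε` cancels the `1 / ε` in the bound for `n (v t)`. -/
theorem resolvent_sub (h : IsEvolution κ V n p A X S f g) {ε : ℝ} (hε : 0 < ε) {L : ℝ}
    {v : ℝ → H} (hL : ∀ t ∈ Icc (0 : ℝ) 1, ‖f t‖ ≤ L)
    (hv : ∀ t ∈ Icc (0 : ℝ) 1, v t ∈ V ∧ v t + ε • A t (v t) = f t) {s t : ℝ}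
    (hs : s ∈ Icc (0 : ℝ) 1) (ht : t ∈ Icc (0 : ℝ) 1) :
    ‖(f s - f t) - ε • (A s (v t) - A t (v t))‖ ≤ ‖f s - f t‖ + κ ^ 2 * L * |s - t| ∧
    (v s - v t) + ε • A s (v s - v t) = (f s - f t) - ε • (A s (v t) - A t (v t)) := by
  have hκ : 0 ≤ κ := zero_le_one.trans h.one_le
  constructor
  · refine (norm_sub_le _ _).trans ?_
    gcongr
    rw [norm_smul, Real.norm_eq_abs, abs_of_pos hε]
    have h1 := h.A_lip s hs t ht _ (hv t ht).1
    have h2 := (h.system t ht).resolvent_n_le hε (hv t ht).1 (hv t ht).2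
    calc ε * ‖A s (v t) - A t (v t)‖ ≤ ε * (κ * |s - t| * (κ / ε * L)) := by
          gcongr
          refine h1.trans ?_
          gcongr
          refine h2.trans ?_
          gcongr
          exact hL t ht
      _ = κ ^ 2 * L * |s - t| := by field_simp
  · rw [← (hv s hs).2, ← (hv t ht).2, map_sub]
    simp only [smul_sub]
    abel

theorem norm_defect_sub_le (h : IsEvolution κ V n p A X S f g) {ε : ℝ} (hε : 0 < ε) {L : ℝ}
    {v : ℝ → H} (hL : ∀ t ∈ Icc (0 : ℝ) 1, ‖f t‖ ≤ L)
    (hv : ∀ t ∈ Icc (0 : ℝ) 1, v t ∈ V ∧ v t + ε • A t (v t) = f t) {s t : ℝ}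
    (hs : s ∈ Icc (0 : ℝ) 1) (ht : t ∈ Icc (0 : ℝ) 1) :
    ‖(f s - v s) - (f t - v t)‖ ≤ 2 * κ * (‖f s - f t‖ + κ ^ 2 * L * |s - t|) := by
  obtain ⟨h1, h2⟩ := h.resolvent_sub hε hL hv hs ht
  have h3 := (h.system s hs).resolvent_norm_le hε (V.sub_mem (hv s hs).1 (hv t ht).1) h2
  have hκ := h.one_le
  have hκ0 : 0 ≤ κ := zero_le_one.trans hκ
  have hL0 : 0 ≤ L := (norm_nonneg _).trans (hL t ht)
  set Q := ‖f s - f t‖ + κ ^ 2 * L * |s - t| with hQ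
  have hQ0 : 0 ≤ Q := by positivity
  have hfQ : ‖f s - f t‖ ≤ Q := by
    have : 0 ≤ κ ^ 2 * L * |s - t| := by positivity
    linarith
  have h4 : (f s - v s) - (f t - v t) = (f s - f t) - (v s - v t) := by abel
  rw [h4]
  refine (norm_sub_le _ _).trans ?_
  have h5 : ‖v s - v t‖ ≤ κ * Q := h3.trans (by gcongr)
  have h6 : Q ≤ κ * Q := le_mul_of_one_le_left hQ0 hκ
  linarith

/-- First-order expansion of the increment of the defect, tested against `w = A t (v t)`. Replacing
the resolvent at time `s` by that at time `t` costs only `|s - t|` times the size `Q` of the source,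
which is `o(|s - t|)` where `f` is continuous. The time-`t` resolvent is then moved onto `w` by
symmetry, and this produces `z`. -/
theorem defect_pairing_le [CompleteSpace H] (h : IsEvolution κ V n p A X S f g) {ε : ℝ}
    (hε : 0 < ε) {L : ℝ} {v : ℝ → H} (hL : ∀ t ∈ Icc (0 : ℝ) 1, ‖f t‖ ≤ L)
    (hv : ∀ t ∈ Icc (0 : ℝ) 1, v t ∈ V ∧ v t + ε • A t (v t) = f t) {s t : ℝ}
    (hs : s ∈ Icc (0 : ℝ) 1) (ht : t ∈ Icc (0 : ℝ) 1) {z : H} (hz : z ∈ V)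
    (hzw : z + ε • A t z = A t (v t)) :
    p t ((f s - v s) - (f t - v t)) (A t (v t)) ≤
      ε * p t (f s - f t) (A t z) + ε * κ ^ 4 * |s - t| * ‖A t (v t)‖ ^ 2 +
        κ ^ 4 * |s - t| * (‖f s - f t‖ + κ ^ 2 * L * |s - t|) * ‖A t (v t)‖ := by
  obtain ⟨h1, h2⟩ := h.resolvent_sub hε hL hv hs ht
  have hκ := h.one_le
  have hκ0 : 0 ≤ κ := zero_le_one.trans hκ
  have hT := h.system t ht
  set w := A t (v t) with hw
  set r := A s (v t) - w with hr
  set q := (f s - f t) - ε • r with hq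
  set Q := ‖f s - f t‖ + κ ^ 2 * L * |s - t| with hQ
  -- `d'` solves with `A t` the equation that `v s - v t` solves with `A s`. Their difference solves
  -- a resolvent equation with source `-(ε • (A s - A t) d')`.
  obtain ⟨d', hd'V, hd'⟩ := hT.exists_resolvent h.closed hε q
  have hdd : ((v s - v t) - d') + ε • A s ((v s - v t) - d') = -(ε • (A s d' - A t d')) := by
    rw [map_sub, smul_sub, smul_sub, neg_sub, sub_add_sub_comm, h2, ← hd']
    abel
  have e1 : ‖(v s - v t) - d'‖ ≤ κ ^ 3 * |s - t| * Q := by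
    refine ((h.system s hs).resolvent_norm_le hε
      (V.sub_mem (V.sub_mem (hv s hs).1 (hv t ht).1) hd'V) hdd).trans ?_
    rw [norm_neg, norm_smul, Real.norm_eq_abs, abs_of_pos hε]
    have a1 := h.A_lip s hs t ht d' hd'V
    have a2 := hT.resolvent_n_le hε hd'V hd'
    calc κ * (ε * ‖A s d' - A t d'‖) ≤ κ * (ε * (κ * |s - t| * (κ / ε * Q))) := by
          gcongr
          refine a1.trans ?_
          gcongr
          refine a2.trans ?_
          gcongr
      _ = κ ^ 3 * |s - t| * Q := by field_simp
  have e2 : p t d' w = p t q z := hT.resolvent_symm hd'V hd' hz hzw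
  have e3 : p t ((f s - v s) - (f t - v t)) w =
      ε * p t (f s - f t) (A t z) + ε * p t r z - p t ((v s - v t) - d') w := by
    have b1 : (f s - v s) - (f t - v t) = (f s - f t) - d' - ((v s - v t) - d') := by abel
    rw [b1, map_sub (p t), sub_apply, map_sub (p t), sub_apply, e2, hq]
    have b2 : p t (f s - f t) w = p t (f s - f t) z + ε * p t (f s - f t) (A t z) := by
      rw [← smul_eq_mul, ← map_smul, ← map_add, hzw]
    rw [b2]
    simp only [map_sub, map_smul, sub_apply, smul_apply, smul_eq_mul]
    ring
  have e4 : p t r z ≤ κ ^ 4 * |s - t| * ‖w‖ ^ 2 := by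
    refine (le_abs_self _).trans ((hT.p_le _ _).trans ?_)
    have a1 := h.A_lip s hs t ht (v t) (hv t ht).1
    have a2 := hT.n_le_norm_A (hv t ht).1
    have a3 := hT.resolvent_norm_le hε hz hzw
    calc κ * ‖r‖ * ‖z‖ ≤ κ * (κ * |s - t| * (κ * ‖w‖)) * (κ * ‖w‖) := by
          gcongr
          refine a1.trans ?_
          gcongr
      _ = κ ^ 4 * |s - t| * ‖w‖ ^ 2 := by ring
  have e5 : -p t ((v s - v t) - d') w ≤ κ ^ 4 * |s - t| * Q * ‖w‖ := by
    refine (neg_le_abs _).trans ((hT.p_le _ _).trans ?_)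
    calc κ * ‖(v s - v t) - d'‖ * ‖w‖ ≤ κ * (κ ^ 3 * |s - t| * Q) * ‖w‖ := by gcongr
      _ = κ ^ 4 * |s - t| * Q * ‖w‖ := by ring
  rw [e3]
  have e6 := mul_le_mul_of_nonneg_left e4 hε.le
  calc _ = ε * p t (f s - f t) (A t z) + ε * p t r z + -p t ((v s - v t) - d') w := by ring
    _ ≤ ε * p t (f s - f t) (A t z) + ε * (κ ^ 4 * |s - t| * ‖w‖ ^ 2) +
        κ ^ 4 * |s - t| * Q * ‖w‖ := by gcongr
    _ = _ := by ring

/-- The growth of `⟨y, y⟩` for the defect `y = f - (1 + ε A)⁻¹ f`. -/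
theorem deriv_defect_le [CompleteSpace H] (h : IsEvolution κ V n p A X S f g) {ε : ℝ}
    (hε : 0 < ε) {L : ℝ} {v : ℝ → H} (hL : ∀ t ∈ Icc (0 : ℝ) 1, ‖f t‖ ≤ L)
    (hv : ∀ t ∈ Icc (0 : ℝ) 1, v t ∈ V ∧ v t + ε • A t (v t) = f t) {t : ℝ}
    (ht : t ∈ Ioo (0 : ℝ) 1) (hft : HasDerivAt f (g t) t) (hfV : f t ∈ V)
    (hg : g t = -(A t (f t)) + X t (f t) + S t (f t)) {W' : ℝ}
    (hW : HasDerivAt (fun s => p s (f s - v s) (f s - v s)) W' t) :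
    W' ≤ -(2 * ε ^ 2 * p t (A t (A t (v t))) (A t (v t))) +
      14 * κ ^ 6 * p t (f t - v t) (f t - v t) := by
  have htI := Ioo_subset_Icc_self ht
  have hT := h.system t htI
  have hκ := h.one_le
  have hκ0 : 0 ≤ κ := zero_le_one.trans hκ
  obtain ⟨z, hz, hzw⟩ := hT.exists_resolvent h.closed hε (A t (v t))
  have hflux := hT.flux_le hε hfV (hv t htI).1 (hv t htI).2 hz hzw
  rw [← hg] at hflux
  have hyw : f t - v t = ε • A t (v t) := by
    rw [← (hv t htI).2]; abel
  set w := A t (v t) with hw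
  set y := f t - v t with hy
  let Q : ℝ → ℝ := fun s => ‖f s - f t‖ + κ ^ 2 * L * (s - t)
  -- Majorant of the right difference quotient. The term with `A t z` becomes the flux; `4 * κ ^ 4 *
  -- ‖y‖ ^ 2` collects the motion of `p` and of `A`, two each; the last bracket tends to zero with
  -- `Q`.
  let U : ℝ → ℝ := fun s => 2 * ε ^ 2 * p t ((s - t)⁻¹ • (f s - f t)) (A t z) +
    4 * κ ^ 4 * ‖y‖ ^ 2 + (8 * κ ^ 3 * Q s ^ 2 + 2 * κ ^ 4 * Q s * ‖y‖ +
      4 * κ ^ 3 * (Q s * (‖(s - t)⁻¹ • (f s - f t)‖ + κ ^ 2 * L)))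
  have hslope : Tendsto (fun s => (s - t)⁻¹ • (f s - f t)) (𝓝[>] t) (𝓝 (g t)) :=
    hft.tendsto_slope.mono_left (nhdsWithin_mono _ fun s hs => (ne_of_gt hs))
  have hQ0 : Tendsto Q (𝓝[>] t) (𝓝 0) := by
    have h1 : Tendsto Q (𝓝 t) (𝓝 (‖f t - f t‖ + κ ^ 2 * L * (t - t))) := by
      have := hft.continuousAt
      exact ((this.tendsto.sub_const _).norm).add
        ((tendsto_id.sub_const t).const_mul (κ ^ 2 * L))
    simp only [sub_self, norm_zero, mul_zero, add_zero] at h1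
    exact h1.mono_left nhdsWithin_le_nhds
  have hU : Tendsto U (𝓝[>] t) (𝓝 (2 * ε ^ 2 * p t (g t) (A t z) + 4 * κ ^ 4 * ‖y‖ ^ 2)) := by
    have h1 : Tendsto (fun s => p t ((s - t)⁻¹ • (f s - f t)) (A t z)) (𝓝[>] t)
        (𝓝 (p t (g t) (A t z))) :=
      ((((p t).flip (A t z)).continuous.tendsto _).comp hslope)
    have h2 : Tendsto (fun s => 8 * κ ^ 3 * Q s ^ 2 + 2 * κ ^ 4 * Q s * ‖y‖ +
        4 * κ ^ 3 * (Q s * (‖(s - t)⁻¹ • (f s - f t)‖ + κ ^ 2 * L))) (𝓝[>] t) (𝓝 (8 * κ ^ 3 * 0 ^ 2 +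
        2 * κ ^ 4 * 0 * ‖y‖ + 4 * κ ^ 3 * (0 * (‖g t‖ + κ ^ 2 * L)))) :=
      (((hQ0.pow 2).const_mul _).add ((hQ0.const_mul _).mul_const _)).add
        ((hQ0.mul (hslope.norm.add_const _)).const_mul _)
    have h3 := ((h1.const_mul (2 * ε ^ 2)).add_const (4 * κ ^ 4 * ‖y‖ ^ 2)).add h2
    convert h3 using 2
    ring
  have hle := hW.le_of_eventually_sub_le hU (by
    filter_upwards [Ioo_mem_nhdsGT ht.2] with s hs
    have hsI : s ∈ Icc (0 : ℝ) 1 := ⟨ht.1.le.trans hs.1.le, hs.2.le⟩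
    have hst : 0 < s - t := sub_pos.2 hs.1
    have a1 := h.norm_defect_sub_le hε hL hv hsI htI
    have a2 := h.defect_pairing_le hε hL hv hsI htI hz hzw
    rw [abs_of_pos hst] at a1 a2
    change ‖(f s - v s) - y‖ ≤ 2 * κ * Q s at a1
    rw [← hw] at a2
    have hQs : Q s = (s - t) * (‖(s - t)⁻¹ • (f s - f t)‖ + κ ^ 2 * L) := by
      simp only [Q, norm_smul, norm_inv, Real.norm_eq_abs, abs_of_pos hst]
      field_simp
    have hQnn : 0 ≤ Q s := by
      have : 0 ≤ L := (norm_nonneg _).trans (hL t htI)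
      simp only [Q]; positivity
    have hyn : ‖y‖ = ε * ‖w‖ := by rw [hyw, norm_smul, Real.norm_eq_abs, abs_of_pos hε]
    rw [h.quad_sub htI]
    have b1 : p s (f s - v s) (f s - v s) - p t (f s - v s) (f s - v s) ≤
        κ * (s - t) * (2 * ‖y‖ ^ 2 + 8 * κ ^ 2 * Q s ^ 2) := by
      refine (le_abs_self _).trans ((h.p_lip s hsI t htI _ _).trans ?_)
      rw [abs_of_pos hst, mul_assoc, ← sq]
      gcongr
      have c1 : ‖f s - v s‖ ≤ ‖y‖ + 2 * κ * Q s := by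
        have := norm_add_le y ((f s - v s) - y)
        rw [add_sub_cancel] at this
        linarith
      calc ‖f s - v s‖ ^ 2 ≤ (‖y‖ + 2 * κ * Q s) ^ 2 := by gcongr
        _ ≤ 2 * ‖y‖ ^ 2 + 8 * κ ^ 2 * Q s ^ 2 := by nlinarith [sq_nonneg (‖y‖ - 2 * κ * Q s)]
    have b2 : 2 * p t ((f s - v s) - y) y ≤ 2 * ε ^ 2 * p t (f s - f t) (A t z) +
        2 * κ ^ 4 * (s - t) * ‖y‖ ^ 2 + 2 * κ ^ 4 * (s - t) * Q s * ‖y‖ := by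
      have c1 : p t ((f s - v s) - y) y = ε * p t ((f s - v s) - y) w := by
        conv_lhs => rw [hyw]
        rw [map_smul, smul_eq_mul, ← hyw]
      have c2 := mul_le_mul_of_nonneg_left a2 hε.le
      rw [c1, hyn]
      calc 2 * (ε * p t ((f s - v s) - y) w) ≤ 2 * (ε * (ε * p t (f s - f t) (A t z) +
            ε * κ ^ 4 * (s - t) * ‖w‖ ^ 2 + κ ^ 4 * (s - t) * Q s * ‖w‖)) := by
            gcongr
        _ = _ := by ring
    have b3 : p t ((f s - v s) - y) ((f s - v s) - y) ≤
        (s - t) * (4 * κ ^ 3 * (Q s * (‖(s - t)⁻¹ • (f s - f t)‖ + κ ^ 2 * L))) := by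
      refine (hT.p_self_le _).trans ?_
      calc κ * ‖(f s - v s) - y‖ ^ 2 ≤ κ * (2 * κ * Q s) ^ 2 := by gcongr
        _ = 4 * κ ^ 3 * (Q s * Q s) := by ring
        _ = 4 * κ ^ 3 * (Q s * ((s - t) * (‖(s - t)⁻¹ • (f s - f t)‖ + κ ^ 2 * L))) := by
          rw [← hQs]
        _ = _ := by ring
    have b4 : (s - t) * (2 * ε ^ 2 * p t ((s - t)⁻¹ • (f s - f t)) (A t z)) =
        2 * ε ^ 2 * p t (f s - f t) (A t z) := by
      rw [map_smul, smul_apply, smul_eq_mul]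
      field_simp
    have b5 : κ * (s - t) * (2 * ‖y‖ ^ 2) ≤ 2 * κ ^ 4 * (s - t) * ‖y‖ ^ 2 := by
      have : κ ≤ κ ^ 4 := le_self_pow₀ hκ (by norm_num)
      calc κ * (s - t) * (2 * ‖y‖ ^ 2) ≤ κ ^ 4 * (s - t) * (2 * ‖y‖ ^ 2) := by gcongr
        _ = _ := by ring
    simp only [U]
    rw [mul_add, mul_add, b4]
    nlinarith [b1, b2, b3, b5])
  have hyy : p t y y = ε ^ 2 * p t w w := by
    rw [hyw]; simp only [map_smul, smul_apply, smul_eq_mul]; ring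
  have h7 : 4 * κ ^ 4 * ‖y‖ ^ 2 ≤ 4 * κ ^ 6 * p t y y := by
    have c1 := hT.le_p y
    have c2 : κ ^ 5 ≤ κ ^ 6 := pow_le_pow_right₀ hκ (by norm_num)
    have c3 := hT.p_nonneg y
    calc 4 * κ ^ 4 * ‖y‖ ^ 2 ≤ 4 * κ ^ 4 * (κ * p t y y) := by gcongr
      _ = 4 * κ ^ 5 * p t y y := by ring
      _ ≤ _ := by gcongr
  -- The constant `14` is `10 + 4`: twice the `5` of `flux_le`, plus the motion of the coefficients.
  have h8 := mul_le_mul_of_nonneg_left hflux (by positivity : 0 ≤ 2 * ε ^ 2)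
  have h9 : 2 * ε ^ 2 * (5 * κ ^ 6 * p t w w) = 10 * κ ^ 6 * p t y y := by rw [hyy]; ring
  nlinarith

/-- A lower bound, from right difference quotients of the negative of the mass; the quadratic
remainder has the favourable sign. The constant is chosen equal to that of `deriv_defect_le`. -/
theorem le_deriv_mass (h : IsEvolution κ V n p A X S f g) {t : ℝ}
    (ht : t ∈ Ioo (0 : ℝ) 1) (hft : HasDerivAt f (g t) t) (hfV : f t ∈ V)
    (hg : g t = -(A t (f t)) + X t (f t) + S t (f t)) {M' : ℝ}
    (hM : HasDerivAt (fun s => p s (f s) (f s)) M' t) :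
    -(2 * p t (A t (f t)) (f t)) - 14 * κ ^ 6 * p t (f t) (f t) ≤ M' := by
  have htI := Ioo_subset_Icc_self ht
  have hT := h.system t htI
  have hκ := h.one_le
  have hκ0 : 0 ≤ κ := zero_le_one.trans hκ
  have hslope : Tendsto (fun s => (s - t)⁻¹ • (f s - f t)) (𝓝[>] t) (𝓝 (g t)) :=
    hft.tendsto_slope.mono_left (nhdsWithin_mono _ fun s hs => (ne_of_gt hs))
  let U : ℝ → ℝ := fun s => κ * ‖f s‖ ^ 2 - 2 * p t ((s - t)⁻¹ • (f s - f t)) (f t)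
  have hU : Tendsto U (𝓝[>] t) (𝓝 (κ * ‖f t‖ ^ 2 - 2 * p t (g t) (f t))) := by
    have h1 : Tendsto (fun s => p t ((s - t)⁻¹ • (f s - f t)) (f t)) (𝓝[>] t)
        (𝓝 (p t (g t) (f t))) :=
      ((((p t).flip (f t)).continuous.tendsto _).comp hslope)
    have h2 : Tendsto f (𝓝[>] t) (𝓝 (f t)) := hft.continuousAt.tendsto.mono_left nhdsWithin_le_nhds
    exact ((h2.norm.pow 2).const_mul κ).sub (h1.const_mul 2)
  have hle := hM.neg.le_of_eventually_sub_le hU (by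
    filter_upwards [Ioo_mem_nhdsGT ht.2] with s hs
    have hsI : s ∈ Icc (0 : ℝ) 1 := ⟨ht.1.le.trans hs.1.le, hs.2.le⟩
    have hst : 0 < s - t := sub_pos.2 hs.1
    have a1 := (neg_le_abs _).trans (h.p_lip s hsI t htI (f s) (f s))
    rw [abs_of_pos hst] at a1
    have a2 := h.quad_sub (s := s) htI (f s) (f t)
    have a3 := hT.p_nonneg (f s - f t)
    have b4 : (s - t) * (2 * p t ((s - t)⁻¹ • (f s - f t)) (f t)) =
        2 * p t (f s - f t) (f t) := by
      rw [map_smul, smul_apply, smul_eq_mul]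
      field_simp
    simp only [U, Pi.neg_apply]
    rw [mul_sub, b4]
    nlinarith)
  have e1 : -(κ * ‖f t‖ ^ 2) ≤ 2 * p t (X t (f t)) (f t) := by
    have h1 := (neg_le_abs _).trans (hT.X_skew _ hfV _ hfV)
    rw [hT.p_symm (f t) (X t (f t))] at h1
    nlinarith
  have e2 : -(κ ^ 2 * ‖f t‖ ^ 2) ≤ p t (S t (f t)) (f t) := by
    have h1 := (neg_le_abs _).trans (hT.p_le (S t (f t)) (f t))
    have h2 := hT.S_le _ hfV
    have h3 : κ * ‖S t (f t)‖ * ‖f t‖ ≤ κ * (κ * ‖f t‖) * ‖f t‖ := by gcongr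
    nlinarith
  have e3 : (κ + κ + 2 * κ ^ 2) * ‖f t‖ ^ 2 ≤ 14 * κ ^ 6 * p t (f t) (f t) := by
    have c1 := hT.le_p (f t)
    have c3 := hT.p_nonneg (f t)
    have a1 : κ ≤ κ ^ 5 := le_self_pow₀ hκ (by norm_num)
    have a2 : κ ^ 2 ≤ κ ^ 5 := pow_le_pow_right₀ hκ (by norm_num)
    have a3 : 0 ≤ κ ^ 5 := by positivity
    calc (κ + κ + 2 * κ ^ 2) * ‖f t‖ ^ 2 ≤ (14 * κ ^ 5) * ‖f t‖ ^ 2 := by gcongr; linarith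
      _ ≤ (14 * κ ^ 5) * (κ * p t (f t) (f t)) := by gcongr
      _ = _ := by ring
  rw [hg] at hle
  simp only [map_add, map_neg, add_apply, neg_apply] at hle
  linarith

end IsEvolution

end AbstractGrowth

/-! ### Growth of the regularized ratio and removal of the regularization. -/

section AbstractRatio

open Filter Topology

variable {H : Type*} [NormedAddCommGroup H] [InnerProductSpace ℝ H] [CompleteSpace H]

/-- If the regularizations of `A f` are bounded then `f` is in the domain, with the same bound. -/
theorem IsFirstOrderSystem.mem_of_resolvent_bound {κ : ℝ} {V : Submodule ℝ H} {n : H → ℝ}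
    {p : H →L[ℝ] H →L[ℝ] ℝ} {A X S : H →ₗ[ℝ] H} (hn : IsClosedNorm V n)
    (h : IsFirstOrderSystem κ V n p A X S) {f : H} {Λ : ℝ}
    (hΛ : ∀ ε : ℝ, 0 < ε → ∀ v ∈ V, v + ε • A v = f → p (A v) (A v) ≤ Λ) :
    f ∈ V ∧ p (A f) (A f) ≤ Λ := by
  have hκ0 := h.kappa_pos
  let ε : ℕ → ℝ := fun k => 1 / ((k : ℝ) + 1)
  have hε : ∀ k, 0 < ε k := fun k => by positivity
  have hε0 : Tendsto ε atTop (𝓝 0) := tendsto_one_div_add_atTop_nhds_zero_nat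
  choose v hvV hv using fun k => h.exists_resolvent hn (hε k) f
  have hb : ∀ k, p (A (v k)) (A (v k)) ≤ Λ := fun k => hΛ _ (hε k) _ (hvV k) (hv k)
  have hΛ0 : 0 ≤ Λ := (h.p_nonneg _).trans (hb 0)
  have hvf : Tendsto v atTop (𝓝 f) := by
    rw [tendsto_iff_norm_sub_tendsto_zero]
    have h1 : Tendsto (fun k => ε k * √(κ * Λ)) atTop (𝓝 0) := by
      simpa using hε0.mul_const (√(κ * Λ))
    refine squeeze_zero (fun _ => norm_nonneg _) (fun k => ?_) h1
    have h2 : v k - f = -(ε k • A (v k)) := by rw [← hv k]; abel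
    rw [h2, norm_neg, norm_smul, Real.norm_eq_abs, abs_of_pos (hε k)]
    have := (hε k).le
    gcongr
    refine Real.le_sqrt_of_sq_le ((h.le_p _).trans ?_)
    gcongr
    exact hb k
  have hfV : f ∈ V := by
    refine (hn.closed v f (√(κ * Λ)) hvV (fun k => ?_) hvf).1
    refine Real.le_sqrt_of_sq_le ((h.n_le _ (hvV k)).trans ?_)
    gcongr
    exact hb k
  refine ⟨hfV, ?_⟩
  -- `A (v k)` is only seen to converge to `A f` weakly: tested with `x ∈ V`, the operator moves
  -- onto `x`. By density `x` may then approach `A f`, and the inequality becomes the claimed bound.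
  have hweak : ∀ x ∈ V, p (A f) x ^ 2 ≤ Λ * p x x := by
    intro x hx
    have h1 : Tendsto (fun k => p (A (v k)) x ^ 2) atTop (𝓝 (p (A f) x ^ 2)) := by
      have h2 : Tendsto (fun k => p (v k) (A x)) atTop (𝓝 (p f (A x))) :=
        ((p.flip (A x)).continuous.tendsto f).comp hvf
      rw [h.A_symm f hfV x hx]
      simp_rw [fun k => h.A_symm (v k) (hvV k) x hx]
      exact h2.pow 2
    refine le_of_tendsto h1 (Eventually.of_forall fun k => (h.p_cauchy _ _).trans ?_)
    have := h.p_nonneg x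
    gcongr
    exact hb k
  choose x hxV hx using fun k => h.exists_mem_near hn (A f) (hε k)
  have hxl : Tendsto x atTop (𝓝 (A f)) := by
    rw [tendsto_iff_norm_sub_tendsto_zero]
    exact squeeze_zero (fun _ => norm_nonneg _) (fun k => (hx k).le) hε0
  have h1 : Tendsto (fun k => p (A f) (x k) ^ 2) atTop (𝓝 (p (A f) (A f) ^ 2)) :=
    ((((p (A f)).continuous.tendsto _).comp hxl).pow 2)
  have h2 : Tendsto (fun k => Λ * p (x k) (x k)) atTop (𝓝 (Λ * p (A f) (A f))) := by
    have hc : Continuous fun u => p u u := p.continuous.clm_apply continuous_id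
    exact ((hc.tendsto _).comp hxl).const_mul Λ
  have h3 := le_of_tendsto_of_tendsto' h1 h2 fun k => hweak _ (hxV k)
  have h4 := h.p_nonneg (A f)
  by_contra hlt
  push Not at hlt
  nlinarith

namespace IsEvolution

variable {κ : ℝ} {V : Submodule ℝ H} {n : H → ℝ} {p : ℝ → H →L[ℝ] H →L[ℝ] ℝ}
  {A X S : ℝ → H →ₗ[ℝ] H} {f g : ℝ → H}

/-- The regularized form of the monotonicity of `e^{-Ct} ⟨A f, A f⟩ / ⟨f, f⟩`. -/
theorem defect_growth (h : IsEvolution κ V n p A X S f g) {ε δ : ℝ} (hε : 0 < ε) (hδ : 0 < δ)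
    {v : ℝ → H} (hv : ∀ t ∈ Icc (0 : ℝ) 1, v t ∈ V ∧ v t + ε • A t (v t) = f t) {t : ℝ}
    (ht : t ∈ Icc (0 : ℝ) 1) :
    p t (f t - v t) (f t - v t) * (p 0 (f 0) (f 0) + δ) ≤
      Real.exp (28 * κ ^ 6 * t) * p 0 (f 0 - v 0) (f 0 - v 0) * (p t (f t) (f t) + δ) := by
  obtain ⟨L, hL⟩ := h.exists_bound
  obtain ⟨G, hG, hfG⟩ := h.exists_modulus
  have h0 : (0 : ℝ) ∈ Icc (0 : ℝ) 1 := ⟨le_rfl, zero_le_one⟩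
  have hκ := h.one_le
  have hκ0 : 0 ≤ κ := zero_le_one.trans hκ
  have hL0 : 0 ≤ L := (norm_nonneg _).trans (hL 0 h0)
  set C := 28 * κ ^ 6 with hC
  set W : ℝ → ℝ := fun s => p s (f s - v s) (f s - v s) with hWdef
  set M : ℝ → ℝ := fun s => p s (f s) (f s) with hMdef
  have hfst : ∀ s ∈ Icc (0 : ℝ) 1, ∀ t ∈ Icc (0 : ℝ) 1, ‖f s - f t‖ ≤ 1 * |G s - G t| :=
    fun s hs t ht => by have := hfG s hs t ht; linarith [abs_nonneg (s - t)]
  have hsub01 : uIcc (0 : ℝ) 1 = Icc 0 1 := uIcc_of_le zero_le_one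
  obtain ⟨cM, hcM⟩ := h.quad_abs_sub_le hG hfG zero_le_one hfst
  obtain ⟨cW, hcW⟩ := h.quad_abs_sub_le hG hfG (y := fun s => f s - v s)
    (c := 2 * κ * (1 + κ ^ 2 * L)) (by positivity) (fun s hs t ht => by
      refine (h.norm_defect_sub_le hε hL hv hs ht).trans ?_
      have h1 := hfG s hs t ht
      have h2 : ‖f s - f t‖ ≤ |G s - G t| := by linarith [abs_nonneg (s - t)]
      have h3 : |s - t| ≤ |G s - G t| := by linarith [norm_nonneg (f s - f t)]
      calc 2 * κ * (‖f s - f t‖ + κ ^ 2 * L * |s - t|)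
          ≤ 2 * κ * (|G s - G t| + κ ^ 2 * L * |G s - G t|) := by gcongr
        _ = _ := by ring)
  have hWac : AbsolutelyContinuousOnInterval W 0 1 :=
    hG.of_abs_sub_le (by rw [hsub01]; exact hcW)
  have hMac : AbsolutelyContinuousOnInterval M 0 1 :=
    hG.of_abs_sub_le (by rw [hsub01]; exact hcM)
  have hM0 : ∀ s ∈ Icc (0 : ℝ) 1, 0 ≤ M s := fun s hs => (h.system s hs).p_nonneg _
  have hW0 : ∀ s ∈ Icc (0 : ℝ) 1, 0 ≤ W s := fun s hs => (h.system s hs).p_nonneg _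
  -- The constant `δ` keeps the denominator away from zero, since it is not yet known that `f` does
  -- not vanish.
  have hIac : AbsolutelyContinuousOnInterval (fun s => (M s + δ)⁻¹) 0 1 := by
    refine hMac.of_abs_sub_le (c := δ⁻¹ * δ⁻¹) ?_
    rw [hsub01]
    intro s hs t ht
    have h1 := hM0 s hs
    have h2 := hM0 t ht
    have h3 : (M s + δ)⁻¹ - (M t + δ)⁻¹ = (M s + δ)⁻¹ * (M t + δ)⁻¹ * (M t - M s) := by
      field_simp
      ring
    rw [h3, abs_mul, abs_mul, abs_sub_comm (M t), abs_of_pos (by positivity),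
      abs_of_pos (by positivity)]
    gcongr <;> linarith
  have hEac : AbsolutelyContinuousOnInterval (fun s => Real.exp (-C * s)) 0 1 := by
    refine ContDiffOn.absolutelyContinuousOnInterval ?_
    exact (by fun_prop : ContDiff ℝ 1 fun s : ℝ => Real.exp (-C * s)).contDiffOn
  set F : ℝ → ℝ := fun s => Real.exp (-C * s) * W s * (M s + δ)⁻¹ with hF
  have hFac : AbsolutelyContinuousOnInterval F 0 1 := (hEac.mul hWac).mul hIac
  have hFt := (hFac.mono (c := 0) (d := t) (by
    rw [hsub01, uIcc_of_le ht.1]; exact Icc_subset_Icc_right ht.2)).integral_deriv_eq_sub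
  have hneg : ∫ s in (0 : ℝ)..t, deriv F s ≤ 0 := by
    have hae : ∀ᵐ s ∂(volume.restrict (Ioc 0 t)), 0 ≤ -deriv F s := by
      rw [ae_restrict_iff' measurableSet_Ioc]
      have hne : ∀ᵐ s : ℝ, s ≠ 1 := by simp [ae_iff, measure_singleton]
      filter_upwards [hWac.ae_differentiableAt, hMac.ae_differentiableAt, h.ae_hasDerivAt, hne]
        with s hs1 hs2 hs3 hs4 hst
      have hsI : s ∈ Ioo (0 : ℝ) 1 := ⟨hst.1, lt_of_le_of_ne (hst.2.trans ht.2) hs4⟩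
      have hsI' := Ioo_subset_Icc_self hsI
      have hWd := (hs1 (by rw [hsub01]; exact hsI')).hasDerivAt
      have hMd := (hs2 (by rw [hsub01]; exact hsI')).hasDerivAt
      obtain ⟨hfd, hfV, hge⟩ := hs3 hsI
      have hT := h.system s hsI'
      have e1 := h.deriv_defect_le hε hL hv hsI hfd hfV hge hWd
      have e2 := h.le_deriv_mass hsI hfd hfV hge hMd
      have e3 := hT.moment_le hε hfV (hv s hsI').1 (hv s hsI').2
      have hw : A s (v s) ∈ V := by
        have h1 : ε • A s (v s) ∈ V := by
          rw [← sub_eq_of_eq_add' (hv s hsI').2.symm]; exact V.sub_mem hfV (hv s hsI').1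
        have := V.smul_mem ε⁻¹ h1
        rwa [smul_smul, inv_mul_cancel₀ hε.ne', one_smul] at this
      have e4 := hT.A_nonneg hw
      have hyy : W s = ε ^ 2 * p s (A s (v s)) (A s (v s)) := by
        have : f s - v s = ε • A s (v s) := by rw [← (hv s hsI').2]; abel
        simp only [hWdef]
        rw [this]; simp only [map_smul, smul_apply, smul_eq_mul]; ring
      have hMs := hM0 s hsI'
      have hWs := hW0 s hsI'
      have hMd' : HasDerivAt (fun s => M s + δ) (deriv M s) s := hMd.add_const δ
      have hpos : 0 < M s + δ := by linarith
      have hEd : HasDerivAt (fun s => Real.exp (-C * s)) (Real.exp (-C * s) * (-C)) s := by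
        have := ((hasDerivAt_id s).const_mul (-C)).exp
        simpa using this
      have hFd := (hEd.mul hWd).mul (hMd'.inv hpos.ne')
      have : deriv F s = Real.exp (-C * s) * ((M s + δ) ^ 2)⁻¹ *
          ((deriv W s) * (M s + δ) - W s * deriv M s - C * W s * (M s + δ)) := by
        have h9 := hFd.deriv
        refine Eq.trans ?_ (h9.trans ?_)
        · rfl
        · simp only [Pi.mul_apply, Pi.inv_apply]
          field_simp
          ring
      rw [this, neg_nonneg]
      refine mul_nonpos_of_nonneg_of_nonpos (by positivity) ?_
      -- By the moment inequality the gain from the dissipation of `W` outweighs the loss from the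
      -- decay of `M`. The remaining errors `14 + 14` make up the `28` in `C`.
      have e5 : W s * p s (A s (f s)) (f s) ≤
          ε ^ 2 * p s (A s (A s (v s))) (A s (v s)) * M s := by
        rw [hyy]
        have := mul_le_mul_of_nonneg_left e3 (sq_nonneg ε)
        simp only [hMdef]
        nlinarith
      have e6 := mul_le_mul_of_nonneg_right e1 hpos.le
      have e7 := mul_le_mul_of_nonneg_left e2 hWs
      have e8 : 0 ≤ ε ^ 2 * p s (A s (A s (v s))) (A s (v s)) * δ := by positivity
      have e9 : 0 ≤ κ ^ 6 * W s * δ := by positivity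
      change _ ≤ (-(2 * ε ^ 2 * _) + 14 * κ ^ 6 * W s) * _ at e6
      change W s * (-(2 * _) - 14 * κ ^ 6 * M s) ≤ _ at e7
      rw [hC]
      nlinarith
    have h5 : 0 ≤ ∫ s in (0 : ℝ)..t, -deriv F s := by
      rw [intervalIntegral.integral_of_le ht.1]
      exact integral_nonneg_of_ae hae
    rw [intervalIntegral.integral_neg] at h5
    linarith
  have hle : F t ≤ F 0 := by linarith
  simp only [hF, mul_zero, Real.exp_zero, one_mul] at hle
  have hMt := hM0 t ht
  have hM0' := hM0 0 h0
  have p1 : 0 < M t + δ := by linarith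
  have p2 : 0 < M 0 + δ := by linarith
  rw [← div_eq_mul_inv, ← div_eq_mul_inv, div_le_div_iff₀ p1 p2] at hle
  have h6 : Real.exp (C * t) * Real.exp (-C * t) = 1 := by
    rw [← Real.exp_add]; simp
  calc W t * (M 0 + δ) = Real.exp (C * t) * (Real.exp (-C * t) * W t * (M 0 + δ)) := by
        rw [← mul_assoc, ← mul_assoc, h6, one_mul]
    _ ≤ Real.exp (C * t) * (W 0 * (M t + δ)) := by gcongr
    _ = _ := by ring

/-- The solution stays in the domain, and `e^{-Ct} ⟨A f, A f⟩ / ⟨f, f⟩` is at most its initial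
value. -/
theorem ratio_growth (h : IsEvolution κ V n p A X S f g) {t : ℝ} (ht : t ∈ Icc (0 : ℝ) 1) :
    f t ∈ V ∧ p t (A t (f t)) (A t (f t)) * p 0 (f 0) (f 0) ≤
      Real.exp (28 * κ ^ 6 * t) * p 0 (A 0 (f 0)) (A 0 (f 0)) * p t (f t) (f t) := by
  have h0 : (0 : ℝ) ∈ Icc (0 : ℝ) 1 := ⟨le_rfl, zero_le_one⟩
  have hT := h.system t ht
  have hT0 := h.system 0 h0
  set E := Real.exp (28 * κ ^ 6 * t)
  have hE : 0 < E := Real.exp_pos _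
  have hM0 := hT0.p_nonneg (f 0)
  -- For fixed `δ` the bound on `p t (A t u) (A t u)` does not depend on `ε`, so membership in `V`
  -- is obtained before `δ → 0`.
  have key : ∀ δ > 0, f t ∈ V ∧ p t (A t (f t)) (A t (f t)) ≤
      E * p 0 (A 0 (f 0)) (A 0 (f 0)) * (p t (f t) (f t) + δ) / (p 0 (f 0) (f 0) + δ) := by
    intro δ hδ
    refine hT.mem_of_resolvent_bound h.closed fun ε hε u hu huf => ?_
    have hex : ∀ s ∈ Icc (0 : ℝ) 1, ∃ v, v ∈ V ∧ v + ε • A s v = f s := fun s hs => by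
      obtain ⟨v, hv1, hv2⟩ := (h.system s hs).exists_resolvent h.closed hε (f s)
      exact ⟨v, hv1, hv2⟩
    choose! v hv using hex
    have h1 := h.defect_growth hε hδ hv ht
    have huv : u = v t := by
      have h2 : (u - v t) + ε • A t (u - v t) = 0 := by
        rw [map_sub, smul_sub, sub_add_sub_comm, huf, (hv t ht).2, sub_self]
      have h3 := hT.resolvent_norm_le hε (V.sub_mem hu (hv t ht).1) h2
      rw [norm_zero, mul_zero] at h3
      exact sub_eq_zero.1 (norm_le_zero_iff.1 h3)
    have hyy : ∀ s ∈ Icc (0 : ℝ) 1, p s (f s - v s) (f s - v s) =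
        ε ^ 2 * p s (A s (v s)) (A s (v s)) := fun s hs => by
      have : f s - v s = ε • A s (v s) := by
        conv_lhs => rw [← (hv s hs).2]
        abel
      rw [this]; simp only [map_smul, smul_apply, smul_eq_mul]; ring
    rw [hyy t ht, hyy 0 h0, ← huv] at h1
    have hw0 : A 0 (v 0) ∈ V := by
      have h1 : ε • A 0 (v 0) ∈ V := by
        rw [← sub_eq_of_eq_add' (hv 0 h0).2.symm]; exact V.sub_mem h.init (hv 0 h0).1
      have := V.smul_mem ε⁻¹ h1
      rwa [smul_smul, inv_mul_cancel₀ hε.ne', one_smul] at this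
    -- `A 0 (v 0)` is the resolvent applied to `A 0 (f 0)`, because `f 0 ∈ V`, and the resolvent
    -- contracts `p`. The factor `ε ^ 2` then cancels on both sides.
    have h4 : p 0 (A 0 (v 0)) (A 0 (v 0)) ≤ p 0 (A 0 (f 0)) (A 0 (f 0)) :=
      hT0.resolvent_p_le hε hw0 (by conv_rhs => rw [← (hv 0 h0).2, map_add, map_smul])
    rw [le_div_iff₀ (by linarith)]
    have hMt := hT.p_nonneg (f t)
    have h5 : ε ^ 2 * (p t (A t u) (A t u) * (p 0 (f 0) (f 0) + δ)) ≤ ε ^ 2 *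
        (E * p 0 (A 0 (f 0)) (A 0 (f 0)) * (p t (f t) (f t) + δ)) := by
      calc _ = ε ^ 2 * p t (A t u) (A t u) * (p 0 (f 0) (f 0) + δ) := by ring
        _ ≤ E * (ε ^ 2 * p 0 (A 0 (v 0)) (A 0 (v 0))) * (p t (f t) (f t) + δ) := h1
        _ ≤ E * (ε ^ 2 * p 0 (A 0 (f 0)) (A 0 (f 0))) * (p t (f t) (f t) + δ) := by gcongr
        _ = _ := by ring
    exact le_of_mul_le_mul_left h5 (by positivity)
  refine ⟨(key 1 one_pos).1, ?_⟩
  have h2 : ∀ δ > 0, p t (A t (f t)) (A t (f t)) * (p 0 (f 0) (f 0) + δ) ≤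
      E * p 0 (A 0 (f 0)) (A 0 (f 0)) * (p t (f t) (f t) + δ) := by
    intro δ hδ
    have := (key δ hδ).2
    rwa [le_div_iff₀ (by linarith)] at this
  have hl : ∀ a b : ℝ, Tendsto (fun δ : ℝ => a * (b + δ)) (𝓝[>] 0) (𝓝 (a * b)) := by
    intro a b
    have : Tendsto (fun δ : ℝ => a * (b + δ)) (𝓝 0) (𝓝 (a * (b + 0))) :=
      (tendsto_id.const_add b).const_mul a
    rw [add_zero] at this
    exact this.mono_left nhdsWithin_le_nhds
  exact le_of_tendsto_of_tendsto (hl _ _) (hl _ _)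
    (by filter_upwards [self_mem_nhdsWithin] with δ hδ using h2 δ hδ)

end IsEvolution

end AbstractRatio

/-! ### Consequences of a bounded ratio: nonvanishing, frequency and interpolated norms. -/

section AbstractConclusion

open Filter Topology

/-- Grönwall's inequality needs only continuity and control of right difference quotients, so no
differentiability of the quotients below is required. -/
theorem le_add_mul_of_eventually_sub_le {F : ℝ → ℝ} {k : ℝ} (hF : ContinuousOn F (Icc 0 1))
    (h : ∀ t ∈ Ico (0 : ℝ) 1, ∀ᶠ s in 𝓝[>] t, F s - F t ≤ k * (s - t)) :
    ∀ t ∈ Icc (0 : ℝ) 1, F t ≤ F 0 + k * t := by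
  intro t ht
  have := le_gronwallBound_of_liminf_deriv_right_le (f := F) (f' := fun _ => k) (δ := F 0)
    (K := 0) (ε := k) hF (fun x hx r hr => ?_) le_rfl (fun x _ => by simp) t ht
  · simpa [gronwallBound_K0] using this
  · refine Eventually.frequently ?_
    filter_upwards [h x hx, self_mem_nhdsWithin] with s hs hxs
    have hxs' : 0 < s - x := sub_pos.2 hxs
    rw [inv_mul_lt_iff₀ hxs']
    nlinarith

theorem exp_mul_le_of_eventually_sub_le {F : ℝ → ℝ} {k : ℝ} (hF : ContinuousOn F (Icc 0 1))
    (h : ∀ t ∈ Ico (0 : ℝ) 1, ∀ᶠ s in 𝓝[>] t, F t - F s ≤ k * F t * (s - t)) :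
    ∀ t ∈ Icc (0 : ℝ) 1, Real.exp (-k * t) * F 0 ≤ F t := by
  intro t ht
  have := le_gronwallBound_of_liminf_deriv_right_le (f := fun t => -F t)
    (f' := fun t => k * F t) (δ := -F 0)
    (K := -k) (ε := 0) hF.neg (fun x hx r hr => ?_) le_rfl (fun x _ => by simp) t ht
  · rw [gronwallBound_ε0, sub_zero] at this
    nlinarith
  · refine Eventually.frequently ?_
    filter_upwards [h x hx, self_mem_nhdsWithin] with s hs hxs
    have hxs' : 0 < s - x := sub_pos.2 hxs
    rw [inv_mul_lt_iff₀ hxs']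
    nlinarith

variable {H : Type*} [NormedAddCommGroup H] [InnerProductSpace ℝ H]

namespace IsEvolution

variable {κ : ℝ} {V : Submodule ℝ H} {n : H → ℝ} {p : ℝ → H →L[ℝ] H →L[ℝ] ℝ}
  {A X S : ℝ → H →ₗ[ℝ] H} {f g : ℝ → H}

/-- Each of the three terms of the equation is at most `κ * σ * N`. Thus `f`, a priori only
absolutely continuous, is Lipschitz where its `n` is bounded. -/
theorem norm_sub_le (h : IsEvolution κ V n p A X S f g) {N σ : ℝ} (hσ : 1 ≤ σ) {s t : ℝ}
    (hs : s ∈ Icc (0 : ℝ) 1) (ht : t ∈ Icc (0 : ℝ) 1)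
    (hN : ∀ r ∈ uIcc t s, ‖f r‖ ≤ N ∧ n (f r) ≤ σ * N) :
    ‖f s - f t‖ ≤ 3 * κ * σ * N * |s - t| := by
  rw [h.sub_eq hs ht]
  refine intervalIntegral.norm_integral_le_of_norm_le_const_ae ?_
  have h2 := (ae_restrict_iff' measurableSet_Icc).1 h.ae_eq
  filter_upwards [h2] with r hr hrI
  have hrI' := uIoc_subset_uIcc hrI
  have hr01 : r ∈ Icc (0 : ℝ) 1 := uIcc_subset_Icc ht hs hrI'
  obtain ⟨hrV, hrg⟩ := hr hr01
  obtain ⟨hN1, hN2⟩ := hN r hrI'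
  have hT := h.system r hr01
  have hκ0 := hT.kappa_pos.le
  have hN0 : 0 ≤ N := (norm_nonneg _).trans hN1
  rw [hrg]
  have e1 : ‖A r (f r)‖ ≤ κ * (σ * N) := (hT.A_le _ hrV).trans (by gcongr)
  have e2 : ‖X r (f r)‖ ≤ κ * (σ * N) := (hT.X_le _ hrV).trans (by gcongr)
  have e3 : ‖S r (f r)‖ ≤ κ * (σ * N) := (hT.S_le _ hrV).trans (by
    gcongr; exact hN1.trans (le_mul_of_one_le_left hN0 hσ))
  calc ‖-(A r (f r)) + X r (f r) + S r (f r)‖ ≤ ‖A r (f r)‖ + ‖X r (f r)‖ + ‖S r (f r)‖ := by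
        refine (norm_add_le _ _).trans ?_
        gcongr
        refine (norm_add_le _ _).trans ?_
        rw [norm_neg]
    _ ≤ 3 * κ * σ * N := by linarith

theorem continuousOn_mass (h : IsEvolution κ V n p A X S f g) :
    ContinuousOn (fun t => p t (f t) (f t)) (Icc 0 1) := by
  obtain ⟨G, hG, hfG⟩ := h.exists_modulus
  obtain ⟨cM, hcM⟩ := h.quad_abs_sub_le hG hfG zero_le_one (y := f)
    (fun s hs t ht => by have := hfG s hs t ht; linarith [abs_nonneg (s - t)])
  have := (hG.of_abs_sub_le (c := cM) (F := fun t => p t (f t) (f t))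
    (by rw [uIcc_of_le (zero_le_one (α := ℝ))]; exact hcM)).continuousOn
  rwa [uIcc_of_le (zero_le_one (α := ℝ))] at this

theorem mass_sub_le (h : IsEvolution κ V n p A X S f g) {N σ : ℝ} (hσ : 1 ≤ σ) {s t : ℝ}
    (hs : s ∈ Icc (0 : ℝ) 1) (ht : t ∈ Icc (0 : ℝ) 1)
    (hN : ∀ r ∈ uIcc t s, ‖f r‖ ≤ N ∧ n (f r) ≤ σ * N) :
    |p s (f s) (f s) - p t (f t) (f t)| ≤ 13 * κ ^ 2 * σ * N ^ 2 * |s - t| := by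
  have hd := h.norm_sub_le hσ hs ht hN
  obtain ⟨hs1, hs2⟩ := hN s right_mem_uIcc
  obtain ⟨ht1, ht2⟩ := hN t left_mem_uIcc
  have hT := h.system t ht
  have hκ := h.one_le
  have hκ0 := hT.kappa_pos.le
  have hN0 : 0 ≤ N := (norm_nonneg _).trans hs1
  have hd2 : ‖f s - f t‖ ≤ 2 * N := (_root_.norm_sub_le _ _).trans (by linarith)
  rw [h.quad_sub ht]
  have e1 : |p s (f s) (f s) - p t (f s) (f s)| ≤ κ * |s - t| * N * N :=
    (h.p_lip s hs t ht _ _).trans (by gcongr)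
  have e2 : |2 * p t (f s - f t) (f t)| ≤ 2 * (κ * (3 * κ * σ * N * |s - t|) * N) := by
    rw [abs_mul, abs_two]
    gcongr
    exact (hT.p_le _ _).trans (by gcongr)
  have e3 : |p t (f s - f t) (f s - f t)| ≤ κ * (3 * κ * σ * N * |s - t|) * (2 * N) :=
    (hT.p_le _ _).trans (by gcongr)
  have a3 : κ ≤ κ ^ 2 * σ := by nlinarith [mul_le_mul hκ hσ zero_le_one hκ0]
  have a4 : 0 ≤ N ^ 2 * |s - t| := by positivity
  calc _ ≤ |p s (f s) (f s) - p t (f s) (f s)| + |2 * p t (f s - f t) (f t)| +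
        |p t (f s - f t) (f s - f t)| := by
        refine (abs_add_le _ _).trans ?_
        gcongr
        exact abs_add_le _ _
    _ ≤ κ * |s - t| * N * N + 2 * (κ * (3 * κ * σ * N * |s - t|) * N) +
        κ * (3 * κ * σ * N * |s - t|) * (2 * N) := by gcongr
    _ = (κ + 12 * κ ^ 2 * σ) * (N ^ 2 * |s - t|) := by ring
    _ ≤ (13 * κ ^ 2 * σ) * (N ^ 2 * |s - t|) := by gcongr; linarith
    _ = _ := by ring

variable [CompleteSpace H]

theorem mem (h : IsEvolution κ V n p A X S f g) {t : ℝ} (ht : t ∈ Icc (0 : ℝ) 1) : f t ∈ V :=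
  (h.ratio_growth ht).1

theorem form_sub_le (h : IsEvolution κ V n p A X S f g) {N σ : ℝ} (hσ : 1 ≤ σ) {s t : ℝ}
    (hs : s ∈ Icc (0 : ℝ) 1) (ht : t ∈ Icc (0 : ℝ) 1)
    (hN : ∀ r ∈ uIcc t s, ‖f r‖ ≤ N ∧ n (f r) ≤ σ * N) :
    |p s (A s (f s)) (f s) - p t (A t (f t)) (f t)| ≤ 8 * κ ^ 3 * σ ^ 2 * N ^ 2 * |s - t| := by
  have hd := h.norm_sub_le hσ hs ht hN
  obtain ⟨hs1, hs2⟩ := hN s right_mem_uIcc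
  obtain ⟨ht1, ht2⟩ := hN t left_mem_uIcc
  have hS := h.system s hs
  have hT := h.system t ht
  have hκ := h.one_le
  have hκ0 := hT.kappa_pos.le
  have hN0 : 0 ≤ N := (norm_nonneg _).trans hs1
  have hNσ : N ≤ σ * N := le_mul_of_one_le_left hN0 hσ
  -- Symmetry of `A s` arranges that operators act on `f s` and `f t` only and that the increment is
  -- measured in the norm of `H`. The value of `n` at an increment is never needed.
  have e0 : p s (A s (f s)) (f s) - p t (A t (f t)) (f t) =
      (p s (A s (f s)) (f s - f t) + p s (A s (f t)) (f s - f t)) +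
      (p s (A s (f t)) (f t) - p t (A s (f t)) (f t)) + p t (A s (f t) - A t (f t)) (f t) := by
    simp only [map_sub, sub_apply]
    have h1 : p s (A s (f s)) (f t) = p s (A s (f t)) (f s) := by
      rw [hS.A_symm _ (h.mem hs) _ (h.mem ht), hS.p_symm]
    rw [h1]; ring
  have e1 : |p s (A s (f s)) (f s - f t)| ≤ κ * (κ * (σ * N)) * (3 * κ * σ * N * |s - t|) :=
    (hS.p_le _ _).trans (by gcongr; exact (hS.A_le _ (h.mem hs)).trans (by gcongr))
  have e2 : |p s (A s (f t)) (f s - f t)| ≤ κ * (κ * (σ * N)) * (3 * κ * σ * N * |s - t|) :=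
    (hS.p_le _ _).trans (by gcongr; exact (hS.A_le _ (h.mem ht)).trans (by gcongr))
  have e3 : |p s (A s (f t)) (f t) - p t (A s (f t)) (f t)| ≤
      κ * |s - t| * (κ * (σ * N)) * (σ * N) :=
    (h.p_lip s hs t ht _ _).trans (by
      gcongr
      · exact (hS.A_le _ (h.mem ht)).trans (by gcongr)
      · linarith)
  have e4 : |p t (A s (f t) - A t (f t)) (f t)| ≤ κ * (κ * |s - t| * (σ * N)) * (σ * N) :=
    (hT.p_le _ _).trans (by
      gcongr
      · exact (h.A_lip s hs t ht _ (h.mem ht)).trans (by gcongr)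
      · linarith)
  rw [e0]
  have a3 : κ ^ 2 ≤ κ ^ 3 := pow_le_pow_right₀ hκ (by norm_num)
  have a4 : 0 ≤ σ ^ 2 * N ^ 2 * |s - t| := by positivity
  calc _ ≤ |p s (A s (f s)) (f s - f t)| + |p s (A s (f t)) (f s - f t)| +
        |p s (A s (f t)) (f t) - p t (A s (f t)) (f t)| + |p t (A s (f t) - A t (f t)) (f t)| := by
        refine (abs_add_le _ _).trans ?_
        gcongr
        refine (abs_add_le _ _).trans ?_
        gcongr
        exact abs_add_le _ _
    _ ≤ κ * (κ * (σ * N)) * (3 * κ * σ * N * |s - t|) +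
        κ * (κ * (σ * N)) * (3 * κ * σ * N * |s - t|) + κ * |s - t| * (κ * (σ * N)) * (σ * N) +
        κ * (κ * |s - t| * (σ * N)) * (σ * N) := by gcongr
    _ = (6 * κ ^ 3 + 2 * κ ^ 2) * (σ ^ 2 * N ^ 2 * |s - t|) := by ring
    _ ≤ (8 * κ ^ 3) * (σ ^ 2 * N ^ 2 * |s - t|) := by gcongr; linarith
    _ = _ := by ring

theorem bounds_of_mass_le (h : IsEvolution κ V n p A X S f g) {σ m : ℝ} (hσ : 1 ≤ σ)
    (hr : ∀ r ∈ Icc (0 : ℝ) 1, p r (A r (f r)) (A r (f r)) ≤ σ ^ 2 * p r (f r) (f r)) {r : ℝ}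
    (hrI : r ∈ Icc (0 : ℝ) 1) (hm : p r (f r) (f r) ≤ m) :
    ‖f r‖ ≤ √(κ * m) ∧ n (f r) ≤ σ * √(κ * m) := by
  have hT := h.system r hrI
  have hκ0 := hT.kappa_pos.le
  constructor
  · exact Real.le_sqrt_of_sq_le ((hT.le_p _).trans (by gcongr))
  · have hσ0 : 0 ≤ σ := zero_le_one.trans hσ
    have h1 : σ * √(κ * m) = √(σ ^ 2 * (κ * m)) := by
      rw [Real.sqrt_mul (sq_nonneg σ), Real.sqrt_sq hσ0]
    rw [h1]
    refine Real.le_sqrt_of_sq_le ((hT.n_le _ (h.mem hrI)).trans ?_)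
    calc κ * p r (A r (f r)) (A r (f r)) ≤ κ * (σ ^ 2 * m) := by
          gcongr
          exact (hr r hrI).trans (by gcongr)
      _ = _ := by ring

theorem exists_global_bounds (h : IsEvolution κ V n p A X S f g) {σ : ℝ} (hσ : 1 ≤ σ)
    (hr : ∀ r ∈ Icc (0 : ℝ) 1, p r (A r (f r)) (A r (f r)) ≤ σ ^ 2 * p r (f r) (f r)) :
    ∃ N, ∀ r ∈ Icc (0 : ℝ) 1, ‖f r‖ ≤ N ∧ n (f r) ≤ σ * N := by
  obtain ⟨m, hm⟩ := isCompact_Icc.exists_bound_of_continuousOn h.continuousOn_mass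
  exact ⟨√(κ * m), fun r hrI =>
    h.bounds_of_mass_le hσ hr hrI ((le_abs_self _).trans (hm r hrI))⟩

/-- For `s` close to `t` the mass has at most doubled or halved. Hence the bounds are proportional
to the mass at `t`, as Grönwall's inequality requires, with `N ^ 2 = 2 * κ * p t (f t) (f t)`. -/
theorem eventually_local_bounds (h : IsEvolution κ V n p A X S f g) {σ : ℝ} (hσ : 1 ≤ σ)
    (hr : ∀ r ∈ Icc (0 : ℝ) 1, p r (A r (f r)) (A r (f r)) ≤ σ ^ 2 * p r (f r) (f r)) {t : ℝ}
    (ht : t ∈ Ico (0 : ℝ) 1) (hpos : 0 < p t (f t) (f t)) :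
    ∀ᶠ s in 𝓝[>] t, s ∈ Icc (0 : ℝ) 1 ∧ t < s ∧ p t (f t) (f t) / 2 ≤ p s (f s) (f s) ∧
      ∀ r ∈ uIcc t s, ‖f r‖ ≤ √(κ * (2 * p t (f t) (f t))) ∧
        n (f r) ≤ σ * √(κ * (2 * p t (f t) (f t))) := by
  have htI : t ∈ Icc (0 : ℝ) 1 := ⟨ht.1, ht.2.le⟩
  have hc := Metric.continuousOn_iff.1 h.continuousOn_mass t htI (p t (f t) (f t) / 2) (by linarith)
  obtain ⟨η, hη, hc⟩ := hc
  have hlt : t < min 1 (t + η) := lt_min ht.2 (by linarith)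
  filter_upwards [Ioo_mem_nhdsGT hlt] with s hs
  have hs1 : s < 1 := hs.2.trans_le (min_le_left _ _)
  have hs2 : s < t + η := hs.2.trans_le (min_le_right _ _)
  have hsI : s ∈ Icc (0 : ℝ) 1 := ⟨ht.1.trans hs.1.le, hs1.le⟩
  have key : ∀ r ∈ Icc t s, |p r (f r) (f r) - p t (f t) (f t)| < p t (f t) (f t) / 2 := by
    intro r hrI
    have := hc r ⟨ht.1.trans hrI.1, hrI.2.trans hs1.le⟩ (by
      rw [Real.dist_eq, abs_of_nonneg (sub_nonneg.2 hrI.1)]; linarith [hrI.2])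
    rwa [Real.dist_eq] at this
  refine ⟨hsI, hs.1, ?_, fun r hrI => ?_⟩
  · have := (abs_lt.1 (key s ⟨hs.1.le, le_rfl⟩)).1
    linarith
  · rw [uIcc_of_le hs.1.le] at hrI
    have := (abs_lt.1 (key r hrI)).2
    exact h.bounds_of_mass_le hσ hr ⟨ht.1.trans hrI.1, hrI.2.trans hs1.le⟩ (by linarith)

/-- With a bounded ratio the relative rate of decrease of the mass is bounded, so it cannot reach
zero. The rate is the `13 * κ ^ 2 * σ` of `mass_sub_le` times the `2 * κ` of the local bounds. Where
the mass vanishes the inequality is trivial. -/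
theorem mass_pos (h : IsEvolution κ V n p A X S f g) {σ : ℝ} (hσ : 1 ≤ σ)
    (hr : ∀ r ∈ Icc (0 : ℝ) 1, p r (A r (f r)) (A r (f r)) ≤ σ ^ 2 * p r (f r) (f r))
    (h0 : 0 < p 0 (f 0) (f 0)) {t : ℝ} (ht : t ∈ Icc (0 : ℝ) 1) : 0 < p t (f t) (f t) := by
  refine lt_of_lt_of_le ?_ (exp_mul_le_of_eventually_sub_le (F := fun t => p t (f t) (f t))
    (k := 26 * κ ^ 3 * σ) h.continuousOn_mass (fun t ht => ?_) t ht)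
  · positivity
  · have htI : t ∈ Icc (0 : ℝ) 1 := ⟨ht.1, ht.2.le⟩
    have hT := h.system t htI
    rcases eq_or_lt_of_le (hT.p_nonneg (f t)) with hz | hpos
    · filter_upwards [Ioo_mem_nhdsGT ht.2] with s hs
      have hsI : s ∈ Icc (0 : ℝ) 1 := ⟨ht.1.trans hs.1.le, hs.2.le⟩
      have := (h.system s hsI).p_nonneg (f s)
      rw [← hz]
      linarith
    · filter_upwards [h.eventually_local_bounds hσ hr ht hpos] with s hs
      obtain ⟨hsI, hts, -, hb⟩ := hs
      have h1 := h.mass_sub_le hσ hsI htI hb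
      have hκ0 := hT.kappa_pos.le
      rw [abs_of_pos (sub_pos.2 hts), Real.sq_sqrt (by positivity)] at h1
      have h2 := (neg_le_abs _).trans h1
      calc _ = -(p s (f s) (f s) - p t (f t) (f t)) := by ring
        _ ≤ _ := h2
        _ = _ := by ring

/-- The ratio `⟨A f, f⟩ / ⟨f, f⟩` decreases at most linearly. -/
theorem form_ratio_ge (h : IsEvolution κ V n p A X S f g) {σ : ℝ} (hσ : 1 ≤ σ)
    (hr : ∀ r ∈ Icc (0 : ℝ) 1, p r (A r (f r)) (A r (f r)) ≤ σ ^ 2 * p r (f r) (f r))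
    (h0 : 0 < p 0 (f 0) (f 0)) {t : ℝ} (ht : t ∈ Icc (0 : ℝ) 1) :
    p 0 (A 0 (f 0)) (f 0) / p 0 (f 0) (f 0) - 84 * κ ^ 4 * σ ^ 2 * t ≤
      p t (A t (f t)) (f t) / p t (f t) (f t) := by
  have hpos := fun {t : ℝ} (ht : t ∈ Icc (0 : ℝ) 1) => h.mass_pos hσ hr h0 ht
  have hcont : ContinuousOn (fun t => p t (A t (f t)) (f t)) (Icc 0 1) := by
    obtain ⟨N, hN⟩ := h.exists_global_bounds hσ hr
    have : LipschitzOnWith (8 * κ ^ 3 * σ ^ 2 * N ^ 2).toNNReal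
        (fun t => p t (A t (f t)) (f t)) (Icc 0 1) := by
      refine LipschitzOnWith.of_dist_le_mul fun s hs t ht => ?_
      rw [Real.dist_eq, Real.dist_eq]
      refine (h.form_sub_le hσ hs ht fun r hrI => hN r (uIcc_subset_Icc ht hs hrI)).trans ?_
      gcongr
      exact Real.le_coe_toNNReal _
    exact this.continuousOn
  have hβ : ContinuousOn (fun t => -(p t (A t (f t)) (f t) / p t (f t) (f t))) (Icc 0 1) :=
    (hcont.div h.continuousOn_mass fun t ht => (hpos ht).ne').neg
  have := le_add_mul_of_eventually_sub_le (k := 84 * κ ^ 4 * σ ^ 2) hβ (fun t ht => ?_) t ht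
  · linarith
  · have htI : t ∈ Icc (0 : ℝ) 1 := ⟨ht.1, ht.2.le⟩
    have hT := h.system t htI
    have hM := hpos htI
    filter_upwards [h.eventually_local_bounds hσ hr ht hM] with s hs
    obtain ⟨hsI, hts, hhalf, hb⟩ := hs
    have hκ0 := hT.kappa_pos.le
    have hκ := h.one_le
    have hσ0 : 0 ≤ σ := zero_le_one.trans hσ
    have h1 := h.mass_sub_le hσ hsI htI hb
    have h2 := h.form_sub_le hσ hsI htI hb
    rw [abs_of_pos (sub_pos.2 hts), Real.sq_sqrt (by positivity)] at h1 h2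
    have h3 : p t (A t (f t)) (f t) ≤ σ * p t (f t) (f t) := by
      refine abs_le_of_sq_le_sq' ?_ (by positivity) |>.2
      calc p t (A t (f t)) (f t) ^ 2 ≤ p t (A t (f t)) (A t (f t)) * p t (f t) (f t) :=
            hT.p_cauchy _ _
        _ ≤ σ ^ 2 * p t (f t) (f t) * p t (f t) (f t) := by gcongr; exact hr t htI
        _ = _ := by ring
    have h4 := hT.A_nonneg (h.mem htI)
    have hMs := hpos hsI
    set M := p t (f t) (f t) with hMdef
    set b := p t (A t (f t)) (f t) with hbdef
    set M' := p s (f s) (f s) with hM'def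
    set b' := p s (A s (f s)) (f s) with hb'def
    have hτ : 0 < s - t := sub_pos.2 hts
    have e1 : b - b' ≤ 16 * κ ^ 4 * σ ^ 2 * M * (s - t) := by
      calc b - b' = -(b' - b) := by ring
        _ ≤ _ := (neg_le_abs _).trans h2
        _ = _ := by ring
    have e2 : (M' - M) ≤ 26 * κ ^ 3 * σ * M * (s - t) := by
      calc _ ≤ _ := (le_abs_self _).trans h1
        _ = _ := by ring
    have e3 : b * (M' - M) ≤ 26 * κ ^ 4 * σ ^ 2 * M * (s - t) * M := by
      calc b * (M' - M) ≤ b * (26 * κ ^ 3 * σ * M * (s - t)) := by gcongr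
        _ ≤ (σ * M) * (26 * κ ^ 3 * σ * M * (s - t)) := by gcongr
        _ = κ ^ 3 * (26 * σ ^ 2 * M * (s - t) * M) := by ring
        _ ≤ κ ^ 4 * (26 * σ ^ 2 * M * (s - t) * M) := by
          have : κ ^ 3 ≤ κ ^ 4 := pow_le_pow_right₀ hκ (by norm_num)
          gcongr
        _ = _ := by ring
    have e4 : -(b' / M') - -(b / M) = ((b - b') * M + b * (M' - M)) / (M * M') := by
      field_simp
      ring
    -- The numerator gives `16 + 26 = 42`, which `M' ≥ M / 2` in the denominator doubles to `84`.
    rw [e4, div_le_iff₀ (by positivity)]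
    calc (b - b') * M + b * (M' - M) ≤ 16 * κ ^ 4 * σ ^ 2 * M * (s - t) * M +
          26 * κ ^ 4 * σ ^ 2 * M * (s - t) * M := by gcongr
      _ = 84 * κ ^ 4 * σ ^ 2 * (s - t) * (M * (M / 2)) := by ring
      _ ≤ _ := by gcongr

theorem ratio_le (h : IsEvolution κ V n p A X S f g) (h0 : 0 < p 0 (f 0) (f 0)) :
    ∃ σ : ℝ, 1 ≤ σ ∧
      σ ^ 2 = Real.exp (28 * κ ^ 6) * (p 0 (A 0 (f 0)) (A 0 (f 0)) / p 0 (f 0) (f 0)) ∧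
      ∀ r ∈ Icc (0 : ℝ) 1, p r (A r (f r)) (A r (f r)) ≤ σ ^ 2 * p r (f r) (f r) := by
  have h01 : (0 : ℝ) ∈ Icc (0 : ℝ) 1 := ⟨le_rfl, zero_le_one⟩
  have hT := h.system 0 h01
  have hκ0 := hT.kappa_pos.le
  set Λ := Real.exp (28 * κ ^ 6) * (p 0 (A 0 (f 0)) (A 0 (f 0)) / p 0 (f 0) (f 0)) with hΛ
  have h1 : 1 ≤ p 0 (A 0 (f 0)) (A 0 (f 0)) / p 0 (f 0) (f 0) := by
    rw [le_div_iff₀ h0, one_mul]; exact hT.p_self_le_A h.init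
  have hΛ1 : 1 ≤ Λ := one_le_mul_of_one_le_of_one_le (Real.one_le_exp (by positivity)) h1
  refine ⟨√Λ, Real.one_le_sqrt.2 hΛ1, Real.sq_sqrt (by linarith), fun r hr => ?_⟩
  rw [Real.sq_sqrt (by linarith)]
  have h2 := (h.ratio_growth hr).2
  have h3 := (h.system r hr).p_nonneg (f r)
  have h4 := hT.p_nonneg (A 0 (f 0))
  rw [hΛ, mul_div_assoc', div_mul_eq_mul_div, le_div_iff₀ h0]
  have h5 : Real.exp (28 * κ ^ 6 * r) ≤ Real.exp (28 * κ ^ 6) :=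
    Real.exp_le_exp.2 (mul_le_of_le_one_right (by positivity) hr.2)
  refine h2.trans ?_
  gcongr

/-- The frequency bound for the shifted operator `A - c`. -/
theorem frequency_bound (h : IsEvolution κ V n p A X S f g) {c : ℝ} (hc : 0 ≤ c)
    (h0 : 0 < p 0 (f 0) (f 0)) {t : ℝ} (ht : t ∈ Icc (0 : ℝ) 1) {D : ℝ}
    (hD : D = Real.exp (28 * κ ^ 6) * (28 * κ ^ 6 + 168 * c * κ ^ 4) * (2 * (1 + c ^ 2))) :
    0 < p t (f t) (f t) ∧
    p t (A t (f t) - c • f t) (A t (f t) - c • f t) / p t (f t) (f t) ≤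
      Real.exp (D * t) *
        (p 0 (A 0 (f 0) - c • f 0) (A 0 (f 0) - c • f 0) / p 0 (f 0) (f 0) + 1) - 1 := by
  have h01 : (0 : ℝ) ∈ Icc (0 : ℝ) 1 := ⟨le_rfl, zero_le_one⟩
  obtain ⟨σ, hσ, hσ2, hr⟩ := h.ratio_le h0
  have hMt := h.mass_pos hσ hr h0 ht
  refine ⟨hMt, ?_⟩
  have hβ := h.form_ratio_ge hσ hr h0 ht
  have hg := (h.ratio_growth ht).2
  have hκ0 := (h.system 0 h01).kappa_pos.le
  have hexp : ∀ s ∈ Icc (0 : ℝ) 1, 0 < p s (f s) (f s) →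
      p s (A s (f s) - c • f s) (A s (f s) - c • f s) / p s (f s) (f s) =
      p s (A s (f s)) (A s (f s)) / p s (f s) (f s) -
        2 * c * (p s (A s (f s)) (f s) / p s (f s) (f s)) + c ^ 2 := by
    intro s hs hpos
    simp only [map_sub, map_smul, sub_apply, smul_apply, smul_eq_mul]
    rw [(h.system s hs).p_symm (f s) (A s (f s))]
    field_simp
    ring
  have hR0 : p 0 (A 0 (f 0)) (A 0 (f 0)) / p 0 (f 0) (f 0) ≤
      2 * (1 + c ^ 2) *
        (p 0 (A 0 (f 0) - c • f 0) (A 0 (f 0) - c • f 0) / p 0 (f 0) (f 0) + 1) := by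
    have h1 := (h.system 0 h01).p_nonneg (A 0 (f 0) - c • f 0 - c • f 0)
    have h2 := (h.system 0 h01).p_nonneg (A 0 (f 0) - c • f 0)
    have h3 : p 0 (A 0 (f 0)) (A 0 (f 0)) ≤ 2 * p 0 (A 0 (f 0) - c • f 0) (A 0 (f 0) - c • f 0) +
        2 * c ^ 2 * p 0 (f 0) (f 0) := by
      simp only [map_sub, map_smul, sub_apply, smul_apply, smul_eq_mul] at h1 ⊢
      rw [(h.system 0 h01).p_symm (f 0) (A 0 (f 0))] at h1 ⊢
      nlinarith
    rw [div_add_one h0.ne', mul_div_assoc']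
    gcongr
    nlinarith [mul_nonneg (sq_nonneg c) h2]
  rw [hexp t ht hMt]
  have hr0 := hexp 0 h01 h0
  set r0 := p 0 (A 0 (f 0) - c • f 0) (A 0 (f 0) - c • f 0) / p 0 (f 0) (f 0) with hr0def
  set R0 := p 0 (A 0 (f 0)) (A 0 (f 0)) / p 0 (f 0) (f 0) with hR0def
  set β0 := p 0 (A 0 (f 0)) (f 0) / p 0 (f 0) (f 0)
  set β := p t (A t (f t)) (f t) / p t (f t) (f t)
  set C := 28 * κ ^ 6 with hC
  have hC0 : 0 ≤ C := by positivity
  have hr0nn : 0 ≤ r0 := div_nonneg ((h.system 0 h01).p_nonneg _) h0.le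
  have hR0nn : 0 ≤ R0 := div_nonneg ((h.system 0 h01).p_nonneg _) h0.le
  have hRt : p t (A t (f t)) (A t (f t)) / p t (f t) (f t) ≤ Real.exp (C * t) * R0 := by
    rw [div_le_iff₀ hMt, hR0def, mul_div_assoc', div_mul_eq_mul_div, le_div_iff₀ h0]
    exact hg
  -- A bound with value exactly `1` at `t = 0`: the shift back by `c` tolerates additive errors of
  -- order `t` but no multiplicative loss.
  have hexp1 : Real.exp (C * t) ≤ 1 + C * Real.exp C * t := by
    have h1 : Real.exp (C * t) * (1 - C * t) ≤ 1 := by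
      have h2 := Real.add_one_le_exp (-(C * t))
      calc Real.exp (C * t) * (1 - C * t) ≤ Real.exp (C * t) * Real.exp (-(C * t)) := by
            gcongr; linarith
        _ = 1 := by rw [← Real.exp_add]; simp
    have h3 : Real.exp (C * t) ≤ Real.exp C :=
      Real.exp_le_exp.2 (mul_le_of_le_one_right hC0 ht.2)
    have h4 : C * t * Real.exp (C * t) ≤ C * t * Real.exp C := by
      have := ht.1
      gcongr
    linarith
  -- The growth of the ratio costs `C * exp C * R0 * t`, and the linear decrease of `β` costs `2 * c
  -- * 84 * κ ^ 4 * exp C * R0 * t`. With `R0 ≤ 2 * (1 + c ^ 2) * (r0 + 1)` the sum is `D * (r0 + 1)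
  -- * t`.
  have hmain : p t (A t (f t)) (A t (f t)) / p t (f t) (f t) - 2 * c * β + c ^ 2 ≤
      r0 + D * (r0 + 1) * t := by
    have h1 : 2 * c * (β0 - β) ≤ 2 * c * (84 * κ ^ 4 * σ ^ 2 * t) := by
      gcongr; linarith
    have h2 : Real.exp (C * t) * R0 ≤ (1 + C * Real.exp C * t) * R0 := by gcongr
    have h3 : Real.exp C * (C + 168 * c * κ ^ 4) * R0 * t ≤ D * (r0 + 1) * t := by
      rw [hD]
      have := ht.1
      calc Real.exp C * (C + 168 * c * κ ^ 4) * R0 * t ≤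
            Real.exp C * (C + 168 * c * κ ^ 4) * (2 * (1 + c ^ 2) * (r0 + 1)) * t := by gcongr
        _ = _ := by ring
    rw [hσ2] at h1
    nlinarith
  -- `1 + D * t ≤ exp (D * t)` turns `r0 + D * (r0 + 1) * t` into `exp (D * t) * (r0 + 1) - 1`.
  have h5 := Real.add_one_le_exp (D * t)
  nlinarith

/-- Lower bound for a quadratic functional that interpolates between the norm of `H` and `n`. -/
theorem interpolated_lower_bound (h : IsEvolution κ V n p A X S f g) (h0 : 0 < p 0 (f 0) (f 0))
    {q : H → ℝ} (hq : ∀ u ∈ V, ‖u‖ ^ 2 ≤ κ * q u)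
    (hqs : ∀ u ∈ V, ∀ v ∈ V, ∀ δ : ℝ, 0 < δ →
      q u ≤ q v + δ⁻¹ * (κ * ‖u - v‖ ^ 2) + δ * (n u ^ 2 + n v ^ 2))
    {t : ℝ} (ht : t ∈ Icc (0 : ℝ) 1) :
    Real.exp (-(22 * κ ^ 6 * (Real.exp (28 * κ ^ 6) *
      (p 0 (A 0 (f 0)) (A 0 (f 0)) / p 0 (f 0) (f 0)))) * t) * q (f 0) ≤ q (f t) := by
  obtain ⟨σ, hσ, hσ2, hr⟩ := h.ratio_le h0
  rw [← hσ2]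
  have hσ0 : 0 ≤ σ := zero_le_one.trans hσ
  have h01 : (0 : ℝ) ∈ Icc (0 : ℝ) 1 := ⟨le_rfl, zero_le_one⟩
  have hκ := h.one_le
  have hκ0 := (h.system 0 h01).kappa_pos.le
  have key : ∀ {s t N : ℝ}, s ∈ Icc (0 : ℝ) 1 → t ∈ Icc (0 : ℝ) 1 → s ≠ t →
      (∀ r ∈ uIcc t s, ‖f r‖ ≤ N ∧ n (f r) ≤ σ * N) →
      q (f t) - q (f s) ≤ 11 * κ ^ 3 * σ ^ 2 * N ^ 2 * |s - t| := by
    intro s t N hs ht hst hN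
    have hd := h.norm_sub_le hσ hs ht hN
    have hτ : 0 < |s - t| := abs_pos.2 (sub_ne_zero.2 hst)
    -- The choice `δ = |s - t|` balances the errors: `‖f s - f t‖ ^ 2` is quadratic in `|s - t|`, so
    -- both become linear.
    have h1 := hqs _ (h.mem ht) _ (h.mem hs) _ hτ
    obtain ⟨hs1, hs2⟩ := hN s right_mem_uIcc
    obtain ⟨ht1, ht2⟩ := hN t left_mem_uIcc
    have hN0 : 0 ≤ N := (norm_nonneg _).trans hs1
    have hn1 := h.closed.nonneg (f s)
    have hn2 := h.closed.nonneg (f t)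
    rw [norm_sub_rev] at h1
    have e1 : |s - t|⁻¹ * (κ * ‖f s - f t‖ ^ 2) ≤ 9 * κ ^ 3 * σ ^ 2 * N ^ 2 * |s - t| := by
      calc |s - t|⁻¹ * (κ * ‖f s - f t‖ ^ 2) ≤
            |s - t|⁻¹ * (κ * (3 * κ * σ * N * |s - t|) ^ 2) := by gcongr
        _ = _ := by field_simp; ring
    have e2 : |s - t| * (n (f t) ^ 2 + n (f s) ^ 2) ≤ κ ^ 3 * (2 * σ ^ 2 * N ^ 2 * |s - t|) := by
      calc |s - t| * (n (f t) ^ 2 + n (f s) ^ 2) ≤ |s - t| * ((σ * N) ^ 2 + (σ * N) ^ 2) := by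
            gcongr
        _ = 1 * (2 * σ ^ 2 * N ^ 2 * |s - t|) := by ring
        _ ≤ _ := by gcongr; exact one_le_pow₀ hκ
    linarith
  have hcont : ContinuousOn (fun t => q (f t)) (Icc 0 1) := by
    obtain ⟨N, hN⟩ := h.exists_global_bounds hσ hr
    have : LipschitzOnWith (11 * κ ^ 3 * σ ^ 2 * N ^ 2).toNNReal
        (fun t => q (f t)) (Icc 0 1) := by
      refine LipschitzOnWith.of_dist_le_mul fun s hs t ht => ?_
      rw [Real.dist_eq, Real.dist_eq]
      rcases eq_or_ne s t with rfl | hst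
      · simp
      · have h1 := key hs ht hst fun r hrI => hN r (uIcc_subset_Icc ht hs hrI)
        have h2 := key ht hs hst.symm fun r hrI => hN r (uIcc_subset_Icc hs ht hrI)
        rw [abs_sub_comm t s] at h2
        refine (abs_le.2 ⟨by linarith, h2⟩).trans ?_
        gcongr
        exact Real.le_coe_toNNReal _
    exact this.continuousOn
  refine exp_mul_le_of_eventually_sub_le (F := fun t => q (f t)) hcont (fun t ht => ?_) t ht
  have htI : t ∈ Icc (0 : ℝ) 1 := ⟨ht.1, ht.2.le⟩
  have hM := h.mass_pos hσ hr h0 htI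
  filter_upwards [h.eventually_local_bounds hσ hr ht hM] with s hs
  obtain ⟨hsI, hts, -, hb⟩ := hs
  have h1 := key hsI htI hts.ne' hb
  have hτ : 0 < s - t := sub_pos.2 hts
  rw [abs_of_pos hτ, Real.sq_sqrt (by positivity)] at h1
  refine h1.trans ?_
  -- Closes the inequality in terms of `q` alone. The exponent constant arises as `11 * κ ^ 3` times
  -- `2 * κ` times `κ ^ 2`.
  have h2 : p t (f t) (f t) ≤ κ ^ 2 * q (f t) := by
    calc p t (f t) (f t) ≤ κ * ‖f t‖ ^ 2 := (h.system t htI).p_self_le _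
      _ ≤ κ * (κ * q (f t)) := by gcongr; exact hq _ (h.mem htI)
      _ = _ := by ring
  calc 11 * κ ^ 3 * σ ^ 2 * (κ * (2 * p t (f t) (f t))) * (s - t) ≤
        11 * κ ^ 3 * σ ^ 2 * (κ * (2 * (κ ^ 2 * q (f t)))) * (s - t) := by gcongr
    _ = _ := by ring

end IsEvolution

end AbstractConclusion

/-! ### Sobolev norms on Euclidean space through the Fourier integral. -/

section FourierSobolev

open Filter Topology

variable {E : Type*} [NormedAddCommGroup E] [InnerProductSpace ℝ E] [FiniteDimensional ℝ E]
  [MeasurableSpace E] [BorelSpace E]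

theorem MeasureTheory.Integrable.complex {α : Type*} [MeasurableSpace α] {ν : Measure α}
    {k : α → ℝ} (hk : Integrable k ν) : Integrable (fun y => (k y : ℂ)) ν := hk.ofReal

theorem MeasureTheory.MemLp.complex {α : Type*} [MeasurableSpace α] {ν : Measure α} {q : ℝ≥0∞}
    {k : α → ℝ} (hk : MemLp k q ν) : MemLp (fun y => (k y : ℂ)) q ν := hk.ofReal

theorem Real.continuous_fourier {k : E → ℂ} (hk : Integrable k) : Continuous (𝓕 k) :=
  VectorFourier.fourierIntegral_continuous Real.continuous_fourierChar continuous_inner hk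

theorem Real.norm_fourier_le (k : E → ℂ) (ξ : E) : ‖𝓕 k ξ‖ ≤ ∫ x, ‖k x‖ :=
  VectorFourier.norm_fourierIntegral_le_integral_norm _ _ _ _ _

theorem Real.fourier_congr_ae' {k l : E → ℂ} (h : k =ᵐ[volume] l) : 𝓕 k = 𝓕 l := by
  ext ξ
  rw [Real.fourier_eq, Real.fourier_eq]
  refine integral_congr_ae ?_
  filter_upwards [h] with x hx
  rw [hx]

theorem Real.fourier_sub' {k l : E → ℂ} (hk : Integrable k) (hl : Integrable l) (ξ : E) :
    𝓕 (fun x => k x - l x) ξ = 𝓕 k ξ - 𝓕 l ξ := by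
  simp only [Real.fourier_eq, smul_sub]
  exact integral_sub ((Real.fourierIntegral_convergent_iff ξ).2 hk)
    ((Real.fourierIntegral_convergent_iff ξ).2 hl)

theorem Real.fourier_add' {k l : E → ℂ} (hk : Integrable k) (hl : Integrable l) (ξ : E) :
    𝓕 (fun x => k x + l x) ξ = 𝓕 k ξ + 𝓕 l ξ := by
  simp only [Real.fourier_eq, smul_add]
  exact integral_add ((Real.fourierIntegral_convergent_iff ξ).2 hk)
    ((Real.fourierIntegral_convergent_iff ξ).2 hl)

theorem Real.fourier_const_mul' (c : ℂ) (k : E → ℂ) (ξ : E) :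
    𝓕 (fun x => c * k x) ξ = c * 𝓕 k ξ := by
  simp only [Real.fourier_eq]
  rw [← integral_const_mul]
  congr 1 with x
  simp only [Circle.smul_def, smul_eq_mul]
  ring

/-- The unitary Fourier transform of `L²` and the Fourier integral define the same distribution, as
one sees by moving the transform onto a test function. This makes Plancherel available for the
integral used in the norms. -/
theorem MeasureTheory.Lp.fourier_toLp_ae_eq {k : E → ℂ} (hk : Integrable k) (hk2 : MemLp k 2) :
    (𝓕 (hk2.toLp k) : Lp ℂ 2 (volume : Measure E)) =ᵐ[volume] 𝓕 k := by
  refine ae_eq_of_integral_contDiff_smul_eq ?_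
    (Real.continuous_fourier hk).locallyIntegrable ?_
  · exact (Lp.memLp _).locallyIntegrable (by norm_num)
  intro g hg hgc
  have hgc' : HasCompactSupport fun x => (g x : ℂ) := hgc.comp_left Complex.ofReal_zero
  let ψ : SchwartzMap E ℂ := hgc'.toSchwartzMap (Complex.ofRealCLM.contDiff.comp hg)
  have hψ : ∀ x, ψ x = (g x : ℂ) := fun x => rfl
  have h1 := congrArg (fun T => T ψ) (Lp.fourier_toTemperedDistribution_eq (hk2.toLp k))
  simp only [TemperedDistribution.fourier_apply, Lp.toTemperedDistribution_apply] at h1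
  have h2 : ∫ x, (𝓕 ψ) x • (hk2.toLp k) x = ∫ x, 𝓕 (ψ : E → ℂ) x • k x := by
    refine integral_congr_ae ?_
    filter_upwards [hk2.coeFn_toLp] with x hx
    rw [hx, SchwartzMap.fourier_coe]
  have h3 : ∫ ξ, 𝓕 (ψ : E → ℂ) ξ • k ξ = ∫ x, ψ x • 𝓕 k x := by
    have := VectorFourier.integral_fourierIntegral_smul_eq_flip (μ := (volume : Measure E))
      (ν := (volume : Measure E)) (L := innerₗ E) (f := (ψ : E → ℂ)) (g := k)
      Real.continuous_fourierChar continuous_inner ψ.integrable hk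
    rw [flip_innerₗ] at this
    exact this
  rw [h2, h3] at h1
  simp only [hψ] at h1
  simp only [← Complex.coe_smul] at h1 ⊢
  exact h1.symm

theorem lintegral_fourier_sq {k : E → ℂ} (hk : Integrable k) (hk2 : MemLp k 2) :
    ∫⁻ ξ, ‖𝓕 k ξ‖ₑ ^ 2 = ∫⁻ x, ‖k x‖ₑ ^ 2 := by
  have h1 : eLpNorm (𝓕 k) 2 volume = eLpNorm k 2 volume := by
    rw [← eLpNorm_congr_ae (Lp.fourier_toLp_ae_eq hk hk2), ← eLpNorm_congr_ae hk2.coeFn_toLp,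
      ← Lp.enorm_def, ← Lp.enorm_def, ← ofReal_norm, ← ofReal_norm, Lp.norm_fourier_eq]
  rw [eLpNorm_eq_lintegral_rpow_enorm_toReal (by norm_num) (by norm_num),
    eLpNorm_eq_lintegral_rpow_enorm_toReal (by norm_num) (by norm_num)] at h1
  have h2 := (ENNReal.rpow_left_injective (by norm_num)) h1
  simpa using h2

/-- The square of the `H^s` norm of a function on Euclidean space. -/
noncomputable def fourierSobNormSq (s : ℝ) (k : E → ℝ) : ℝ≥0∞ :=
  ∫⁻ ξ : E, ENNReal.ofReal ((1 + (2 * Real.pi * ‖ξ‖) ^ 2) ^ s) *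
    ‖𝓕 (fun y : E => ((k y : ℝ) : ℂ)) ξ‖ₑ ^ 2

theorem enorm_sq_add_le (a b : ℂ) : ‖a + b‖ₑ ^ 2 ≤ 2 * ‖a‖ₑ ^ 2 + 2 * ‖b‖ₑ ^ 2 := by
  have : ‖a + b‖ ^ 2 ≤ 2 * ‖a‖ ^ 2 + 2 * ‖b‖ ^ 2 := by
    have h1 := norm_add_le a b
    nlinarith [sq_nonneg (‖a‖ - ‖b‖), norm_nonneg (a + b), norm_nonneg a, norm_nonneg b]
  have h2 := ENNReal.ofReal_le_ofReal this
  rw [ENNReal.ofReal_add (by positivity) (by positivity), ENNReal.ofReal_mul (by norm_num),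
    ENNReal.ofReal_mul (by norm_num), ENNReal.ofReal_pow (norm_nonneg _),
    ENNReal.ofReal_pow (norm_nonneg _), ENNReal.ofReal_pow (norm_nonneg _)] at h2
  simpa only [ofReal_norm, ENNReal.ofReal_ofNat] using h2

theorem measurable_sobolevWeight {G : Type*} [NormedAddCommGroup G] [MeasurableSpace G]
    [BorelSpace G] (s : ℝ) :
    Measurable fun ξ : G => ENNReal.ofReal ((1 + (2 * Real.pi * ‖ξ‖) ^ 2) ^ s) := by
  fun_prop

theorem measurable_sobolevIntegrand (s : ℝ) {k : E → ℝ} (hk : Integrable k) :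
    Measurable fun ξ : E => ENNReal.ofReal ((1 + (2 * Real.pi * ‖ξ‖) ^ 2) ^ s) *
      ‖𝓕 (fun y : E => ((k y : ℝ) : ℂ)) ξ‖ₑ ^ 2 :=
  (measurable_sobolevWeight s).mul
    ((Real.continuous_fourier hk.complex).measurable.enorm.pow_const 2)

theorem fourierSobNormSq_congr (s : ℝ) {k l : E → ℝ} (h : k =ᵐ[volume] l) :
    fourierSobNormSq s k = fourierSobNormSq s l := by
  have : (fun y => ((k y : ℝ) : ℂ)) =ᵐ[volume] fun y => ((l y : ℝ) : ℂ) := by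
    filter_upwards [h] with x hx; rw [hx]
  rw [fourierSobNormSq, fourierSobNormSq, Real.fourier_congr_ae' this]

theorem fourierSobNormSq_add_le (s : ℝ) {k l : E → ℝ} (hk : Integrable k) (hl : Integrable l) :
    fourierSobNormSq s (fun y => k y + l y) ≤
      2 * fourierSobNormSq s k + 2 * fourierSobNormSq s l := by
  simp only [fourierSobNormSq]
  rw [← lintegral_const_mul _ (measurable_sobolevIntegrand s hk),
    ← lintegral_const_mul _ (measurable_sobolevIntegrand s hl),
    ← lintegral_add_left ((measurable_sobolevIntegrand s hk).const_mul 2)]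
  refine lintegral_mono fun ξ => ?_
  simp only [Complex.ofReal_add]
  rw [Real.fourier_add' hk.complex hl.complex]
  exact (mul_le_mul' le_rfl (enorm_sq_add_le _ _)).trans (le_of_eq (by ring))

theorem fourierSobNormSq_const_mul (s c : ℝ) (k : E → ℝ) :
    fourierSobNormSq s (fun y => c * k y) = ENNReal.ofReal (c ^ 2) * fourierSobNormSq s k := by
  simp only [fourierSobNormSq]
  rw [← lintegral_const_mul' _ _ ENNReal.ofReal_ne_top]
  refine lintegral_congr fun ξ => ?_
  simp only [Complex.ofReal_mul]
  rw [Real.fourier_const_mul', enorm_mul, mul_pow ‖(c : ℂ)‖ₑ]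
  have : ‖(c : ℂ)‖ₑ ^ 2 = ENNReal.ofReal (c ^ 2) := by
    rw [← ofReal_norm, ← ENNReal.ofReal_pow (norm_nonneg _), Complex.norm_real, Real.norm_eq_abs,
      sq_abs]
  rw [this]
  ring

theorem fourierSobNormSq_zero {k : E → ℝ} (hk : Integrable k) (hk2 : MemLp k 2) :
    fourierSobNormSq 0 k = ∫⁻ x, ‖k x‖ₑ ^ 2 := by
  simp only [fourierSobNormSq, Real.rpow_zero, ENNReal.ofReal_one, one_mul]
  rw [lintegral_fourier_sq hk.complex hk2.complex]
  refine lintegral_congr fun x => ?_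
  rw [← ofReal_norm, ← ofReal_norm, Complex.norm_real]

theorem one_le_sobolevWeight {G : Type*} [NormedAddCommGroup G] (ξ : G) : 1 ≤ 1 + (2 * Real.pi * ‖ξ‖) ^ 2 := by
  have := sq_nonneg (2 * Real.pi * ‖ξ‖); linarith

theorem fourierSobNormSq_mono {s s' : ℝ} (h : s ≤ s') (k : E → ℝ) :
    fourierSobNormSq s k ≤ fourierSobNormSq s' k := by
  refine lintegral_mono fun ξ => ?_
  simp only
  gcongr
  exact one_le_sobolevWeight ξ

theorem lintegral_linear_combination {α : Type*} [MeasurableSpace α] {ν : Measure α}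
    {F₁ F₂ F₃ F₄ : α → ℝ≥0∞} (h₂ : Measurable F₂) (h₃ : Measurable F₃)
    (h₄ : Measurable F₄) {c d : ℝ≥0∞} :
    ∫⁻ x, (F₁ x + c * F₂ x + d * (F₃ x + F₄ x)) ∂ν =
      ∫⁻ x, F₁ x ∂ν + c * ∫⁻ x, F₂ x ∂ν + d * (∫⁻ x, F₃ x ∂ν + ∫⁻ x, F₄ x ∂ν) := by
  rw [lintegral_add_right _ (by fun_prop), lintegral_add_right _ (by fun_prop),
    lintegral_const_mul _ h₂, lintegral_const_mul _ (by fun_prop), lintegral_add_right _ h₄]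

/-- Pointwise in frequency, with `m` the square root of the `H¹` weight, `m (|a|² - |b|²) ≤ |a - b|
· m (|a| + |b|)`; Young's inequality with parameter `δ` splits the product. -/
theorem fourierSobNormSq_interp {k l : E → ℝ} (hk : Integrable k) (hl : Integrable l) {δ : ℝ}
    (hδ : 0 < δ) :
    fourierSobNormSq (1 / 2) k ≤ fourierSobNormSq (1 / 2) l +
      ENNReal.ofReal δ⁻¹ * fourierSobNormSq 0 (fun y => k y - l y) +
      ENNReal.ofReal δ * (fourierSobNormSq 1 k + fourierSobNormSq 1 l) := by
  have hkl : Integrable fun y => k y - l y := hk.sub hl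
  simp only [fourierSobNormSq]
  rw [← lintegral_linear_combination
    (measurable_sobolevIntegrand 0 hkl) (measurable_sobolevIntegrand 1 hk)
    (measurable_sobolevIntegrand 1 hl)]
  refine lintegral_mono fun ξ => ?_
  simp only [Complex.ofReal_sub]
  rw [Real.fourier_sub' hk.complex hl.complex]
  set a := 𝓕 (fun y => (k y : ℂ)) ξ
  set b := 𝓕 (fun y => (l y : ℂ)) ξ
  have hw := one_le_sobolevWeight ξ
  set w := 1 + (2 * Real.pi * ‖ξ‖) ^ 2
  set m := w ^ (1 / 2 : ℝ) with hm
  have hm0 : 0 ≤ m := by positivity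
  have hm2 : w ^ (1 : ℝ) = m ^ 2 := by
    rw [hm, ← Real.rpow_natCast, ← Real.rpow_mul (by linarith)]; norm_num
  rw [hm2, Real.rpow_zero]
  have key : m * ‖a‖ ^ 2 ≤ m * ‖b‖ ^ 2 + δ⁻¹ * (1 * ‖a - b‖ ^ 2) +
      δ * (m ^ 2 * ‖a‖ ^ 2 + m ^ 2 * ‖b‖ ^ 2) := by
    have h1 : ‖a‖ ≤ ‖b‖ + ‖a - b‖ := by simpa using norm_add_le b (a - b)
    have h2 : ‖a‖ ^ 2 - ‖b‖ ^ 2 ≤ ‖a - b‖ * (‖a‖ + ‖b‖) := by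
      nlinarith [norm_nonneg a, norm_nonneg b, norm_nonneg (a - b)]
    have h3 : ‖a - b‖ * (m * (‖a‖ + ‖b‖)) ≤ δ⁻¹ * ‖a - b‖ ^ 2 / 2 +
        δ * (m * (‖a‖ + ‖b‖)) ^ 2 / 2 := by
      have h4 : 0 ≤ δ⁻¹ * (‖a - b‖ - δ * (m * (‖a‖ + ‖b‖))) ^ 2 := by positivity
      have h5 : δ⁻¹ * (‖a - b‖ - δ * (m * (‖a‖ + ‖b‖))) ^ 2 = δ⁻¹ * ‖a - b‖ ^ 2 -
          2 * (‖a - b‖ * (m * (‖a‖ + ‖b‖))) + δ * (m * (‖a‖ + ‖b‖)) ^ 2 := by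
        field_simp
        ring
      linarith
    have h6 : (m * (‖a‖ + ‖b‖)) ^ 2 ≤ 2 * (m ^ 2 * ‖a‖ ^ 2 + m ^ 2 * ‖b‖ ^ 2) := by
      nlinarith [sq_nonneg (m * (‖a‖ - ‖b‖))]
    have h7 := mul_le_mul_of_nonneg_left h6 hδ.le
    have h8 := mul_le_mul_of_nonneg_left h2 hm0
    have h9 : 0 ≤ δ⁻¹ * ‖a - b‖ ^ 2 := by positivity
    nlinarith
  have h2 := ENNReal.ofReal_le_ofReal key
  rw [ENNReal.ofReal_add (by positivity) (by positivity),
    ENNReal.ofReal_add (by positivity) (by positivity), ENNReal.ofReal_mul hm0,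
    ENNReal.ofReal_mul hm0, ENNReal.ofReal_mul (by positivity),
    ENNReal.ofReal_mul zero_le_one, ENNReal.ofReal_mul hδ.le,
    ENNReal.ofReal_add (by positivity) (by positivity),
    ENNReal.ofReal_mul (by positivity), ENNReal.ofReal_mul (by positivity),
    ENNReal.ofReal_pow (norm_nonneg _),
    ENNReal.ofReal_pow (norm_nonneg _), ENNReal.ofReal_pow (norm_nonneg _)] at h2
  simpa only [ofReal_norm] using h2

/-- Convergence in `L¹` gives pointwise convergence of the Fourier transforms, and Fatou's lemma
does the rest. -/
theorem sum_fourierSobNormSq_le_of_tendsto {ι : Type*} [Fintype ι] (s : ℝ) {k : ℕ → ι → E → ℝ}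
    {l : ι → E → ℝ} (hk : ∀ n i, Integrable (k n i)) (hl : ∀ i, Integrable (l i))
    (hlim : ∀ i, Tendsto (fun n => ∫ x, ‖k n i x - l i x‖) atTop (𝓝 0)) :
    ∑ i, fourierSobNormSq s (l i) ≤ liminf (fun n => ∑ i, fourierSobNormSq s (k n i)) atTop := by
  have hpt : ∀ i ξ, Tendsto (fun n => 𝓕 (fun y => (k n i y : ℂ)) ξ) atTop
      (𝓝 (𝓕 (fun y => (l i y : ℂ)) ξ)) := by
    intro i ξ
    rw [tendsto_iff_norm_sub_tendsto_zero]
    refine squeeze_zero (fun _ => norm_nonneg _) (fun n => ?_) (hlim i)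
    rw [← Real.fourier_sub' (hk n i).complex (hl i).complex]
    refine (Real.norm_fourier_le _ _).trans (le_of_eq ?_)
    refine integral_congr_ae (Eventually.of_forall fun x => ?_)
    simp only
    rw [← Complex.ofReal_sub, Complex.norm_real]
  simp only [fourierSobNormSq]
  rw [← lintegral_finsetSum _ fun i _ => measurable_sobolevIntegrand s (hl i)]
  simp_rw [fun n => (lintegral_finsetSum (μ := (volume : Measure E)) (Finset.univ : Finset ι)
    fun i _ => measurable_sobolevIntegrand s (hk n i)).symm]
  refine le_trans (lintegral_mono fun ξ => ?_) (lintegral_liminf_le fun n =>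
    Finset.measurable_sum _ fun i _ => measurable_sobolevIntegrand s (hk n i))
  refine le_of_eq (Tendsto.liminf_eq ?_).symm
  refine tendsto_finsetSum _ fun i _ => ?_
  refine ENNReal.Tendsto.const_mul ?_ (Or.inr ENNReal.ofReal_ne_top)
  exact ENNReal.Tendsto.pow ((continuous_enorm.tendsto _).comp (hpt i ξ))

end FourierSobolev

/-! ### Gradients and mollification on Euclidean space. -/

section FourierRegularity

open Filter Topology

variable {d : ℕ}

local notation "𝔼" => EuclideanSpace ℝ (Fin d)

/-- Plancherel for the gradient of a compactly supported `C¹` function. -/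
theorem fourierSobNormSq_one {k : 𝔼 → ℝ} (hk : ContDiff ℝ 1 k) (hkc : HasCompactSupport k) :
    fourierSobNormSq 1 k = (∫⁻ x, ‖k x‖ₑ ^ 2) +
      ∑ j : Fin d, ∫⁻ x, ‖fderiv ℝ k x (EuclideanSpace.single j 1)‖ₑ ^ 2 := by
  have hki : Integrable k := hk.continuous.integrable_of_hasCompactSupport hkc
  have hk2 : MemLp k 2 := hk.continuous.memLp_of_hasCompactSupport hkc
  let kc : 𝔼 → ℂ := fun y => (k y : ℂ)
  have hkcd : ∀ x, HasFDerivAt kc (Complex.ofRealCLM.comp (fderiv ℝ k x)) x := fun x =>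
    Complex.ofRealCLM.hasFDerivAt.comp x (hk.differentiable one_ne_zero x).hasFDerivAt
  have hfd : ∀ x, fderiv ℝ kc x = Complex.ofRealCLM.comp (fderiv ℝ k x) := fun x => (hkcd x).fderiv
  have hD : Differentiable ℝ kc := fun x => (hkcd x).differentiableAt
  have hkcC : ContDiff ℝ 1 kc := Complex.ofRealCLM.contDiff.comp hk
  have hkcs : HasCompactSupport kc := hkc.comp_left Complex.ofReal_zero
  have hfi : Integrable (fderiv ℝ kc) :=
    (hkcC.continuous_fderiv one_ne_zero).integrable_of_hasCompactSupport
      (hkcs.fderiv ℝ)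
  have hF := Real.fourier_fderiv hki.complex hD hfi
  let e : Fin d → 𝔼 := fun j => EuclideanSpace.single j 1
  have hdc : ∀ j, Continuous fun x => fderiv ℝ k x (e j) := fun j =>
    (hk.continuous_fderiv one_ne_zero).clm_apply continuous_const
  have hds : ∀ j, HasCompactSupport fun x => fderiv ℝ k x (e j) := fun j =>
    (hkc.fderiv ℝ).comp_left (g := fun L : 𝔼 →L[ℝ] ℝ => L (e j)) rfl
  have hdi : ∀ j, Integrable fun x => fderiv ℝ k x (e j) := fun j =>
    (hdc j).integrable_of_hasCompactSupport (hds j)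
  have hd2 : ∀ j, MemLp (fun x => fderiv ℝ k x (e j)) 2 := fun j =>
    (hdc j).memLp_of_hasCompactSupport (hds j)
  -- Each partial derivative multiplies the transform by `2πi ξ_j`, so the squares add up to the
  -- factor `(2π‖ξ‖)²` of the weight.
  have hFj : ∀ j ξ, ‖𝓕 (fun x => ((fderiv ℝ k x (e j) : ℝ) : ℂ)) ξ‖ =
      2 * Real.pi * |ξ j| * ‖𝓕 kc ξ‖ := by
    intro j ξ
    have h1 := congrArg (fun L => L (e j)) (congrFun hF ξ)
    rw [Real.fourier_continuousLinearMap_apply hfi, VectorFourier.fourierSMulRight_apply] at h1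
    simp only [hfd] at h1
    change 𝓕 (fun x => ((fderiv ℝ k x (e j) : ℝ) : ℂ)) ξ = _ at h1
    have h2 : (innerSL ℝ ξ) (e j) = ξ j := by
      change inner ℝ ξ (EuclideanSpace.single j 1) = ξ j
      rw [EuclideanSpace.inner_single_right]
      simp
    have h3 : ((-innerSL ℝ) ξ) (e j) = -ξ j := by rw [← h2]; rfl
    rw [h1, h3]
    simp only [norm_smul, norm_neg, norm_mul, Complex.norm_real, Complex.norm_I, Real.norm_eq_abs,
      abs_of_pos Real.pi_pos, mul_one, Complex.norm_ofNat, kc]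
    ring
  have hpl : ∀ j, ∫⁻ x, ‖fderiv ℝ k x (e j)‖ₑ ^ 2 =
      ∫⁻ ξ, ‖𝓕 (fun x => ((fderiv ℝ k x (e j) : ℝ) : ℂ)) ξ‖ₑ ^ 2 := by
    intro j
    rw [lintegral_fourier_sq (hdi j).complex (hd2 j).complex]
    refine lintegral_congr fun x => ?_
    rw [← ofReal_norm, ← ofReal_norm, Complex.norm_real]
  have hpl0 : ∫⁻ x, ‖k x‖ₑ ^ 2 = ∫⁻ ξ, ‖𝓕 kc ξ‖ₑ ^ 2 := by
    rw [lintegral_fourier_sq hki.complex hk2.complex]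
    refine lintegral_congr fun x => ?_
    rw [← ofReal_norm, ← ofReal_norm, Complex.norm_real]
  change _ = (∫⁻ x, ‖k x‖ₑ ^ 2) + ∑ j : Fin d, ∫⁻ x, ‖fderiv ℝ k x (e j)‖ₑ ^ 2
  simp only [hpl, hpl0]
  rw [← lintegral_finsetSum _ fun j _ =>
      ((Real.continuous_fourier (hdi j).complex).measurable.enorm.pow_const 2),
    ← lintegral_add_left ((Real.continuous_fourier hki.complex).measurable.enorm.pow_const 2)]
  refine lintegral_congr fun ξ => ?_
  rw [Real.rpow_one]
  have key : (1 + (2 * Real.pi * ‖ξ‖) ^ 2) * ‖𝓕 kc ξ‖ ^ 2 = ‖𝓕 kc ξ‖ ^ 2 +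
      ∑ j, ‖𝓕 (fun x => ((fderiv ℝ k x (e j) : ℝ) : ℂ)) ξ‖ ^ 2 := by
    simp only [hFj, mul_pow]
    rw [EuclideanSpace.norm_sq_eq, ← Finset.sum_mul, ← Finset.mul_sum]
    simp only [Real.norm_eq_abs]
    ring
  have h2 := congrArg ENNReal.ofReal key
  rw [ENNReal.ofReal_add (by positivity) (by positivity), ENNReal.ofReal_mul (by positivity),
    ENNReal.ofReal_sum_of_nonneg (fun _ _ => by positivity)] at h2
  simp only [ENNReal.ofReal_pow (norm_nonneg _), ofReal_norm] at h2
  exact h2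

theorem lintegral_fderiv_sq_le {k : 𝔼 → ℝ} (hk : ContDiff ℝ 1 k) (hkc : HasCompactSupport k) :
    ∫⁻ x, ‖fderiv ℝ k x‖ₑ ^ 2 ≤ d * fourierSobNormSq 1 k := by
  rw [fourierSobNormSq_one hk hkc]
  refine le_trans ?_ (mul_le_mul' le_rfl le_add_self)
  have hdc : ∀ j : Fin d, Continuous fun x => fderiv ℝ k x (EuclideanSpace.single j 1) := fun j =>
    (hk.continuous_fderiv one_ne_zero).clm_apply continuous_const
  rw [← lintegral_finsetSum _ fun j _ => ((hdc j).measurable.enorm.pow_const 2),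
    ← lintegral_const_mul' _ _ (by simp)]
  refine lintegral_mono fun x => ?_
  set L := fderiv ℝ k x
  have h1 : ‖L‖ ≤ ∑ j : Fin d, ‖L (EuclideanSpace.single j 1)‖ := by
    refine L.opNorm_le_bound (Finset.sum_nonneg fun _ _ => norm_nonneg _) fun v => ?_
    have hv : v = ∑ j, v j • EuclideanSpace.single j (1 : ℝ) := by
      ext i; simp [Finset.sum_apply, Pi.single_apply]
    conv_lhs => rw [hv, map_sum]
    rw [Finset.sum_mul]
    refine (norm_sum_le _ _).trans (Finset.sum_le_sum fun j _ => ?_)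
    rw [map_smul, norm_smul, mul_comm]
    gcongr
    exact PiLp.norm_apply_le v j
  have h2 : ‖L‖ ^ 2 ≤ d * ∑ j : Fin d, ‖L (EuclideanSpace.single j 1)‖ ^ 2 := by
    have h3 := sq_sum_le_card_mul_sum_sq (s := (Finset.univ : Finset (Fin d)))
      (f := fun j => ‖L (EuclideanSpace.single j 1)‖)
    simp only [Finset.card_univ, Fintype.card_fin] at h3
    exact (pow_le_pow_left₀ (norm_nonneg _) h1 2).trans h3
  have h4 := ENNReal.ofReal_le_ofReal h2
  rw [ENNReal.ofReal_mul (by positivity), ENNReal.ofReal_natCast,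
    ENNReal.ofReal_sum_of_nonneg (fun _ _ => by positivity)] at h4
  simpa only [ENNReal.ofReal_pow (norm_nonneg _), ofReal_norm] using h4

theorem fourierSobNormSq_one_le {k : 𝔼 → ℝ} (hk : ContDiff ℝ 1 k) (hkc : HasCompactSupport k) :
    fourierSobNormSq 1 k ≤ (∫⁻ x, ‖k x‖ₑ ^ 2) + d * ∫⁻ x, ‖fderiv ℝ k x‖ₑ ^ 2 := by
  rw [fourierSobNormSq_one hk hkc]
  gcongr
  calc _ ≤ ∑ j : Fin d, ∫⁻ x, ‖fderiv ℝ k x‖ₑ ^ 2 := by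
        gcongr with j _ x
        have := (fderiv ℝ k x).le_opNorm (EuclideanSpace.single j 1)
        rw [PiLp.norm_single, norm_one, mul_one] at this
        rw [← ofReal_norm, ← ofReal_norm]
        exact ENNReal.ofReal_le_ofReal this
    _ = _ := by simp

theorem fourierSobNormSq_one_lt_top {k : 𝔼 → ℝ} (hk : ContDiff ℝ 1 k)
    (hkc : HasCompactSupport k) : fourierSobNormSq 1 k < ⊤ := by
  refine (fourierSobNormSq_one_le hk hkc).trans_lt ?_
  have aux : ∀ {F : Type} [NormedAddCommGroup F] {l : 𝔼 → F}, Continuous l →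
      HasCompactSupport l → ∫⁻ x, ‖l x‖ₑ ^ 2 < ⊤ := by
    intro F _ l hl hlc
    have := (hl.memLp_of_hasCompactSupport (p := 2) (μ := volume) hlc).2
    rw [eLpNorm_lt_top_iff_lintegral_rpow_enorm_lt_top (by norm_num) (by norm_num)] at this
    simpa using this
  refine ENNReal.add_lt_top.2 ⟨aux hk.continuous hkc, ENNReal.mul_lt_top (ENNReal.natCast_ne_top d).lt_top ?_⟩
  exact aux (hk.continuous_fderiv one_ne_zero) (hkc.fderiv ℝ)

/-- Mollification of a compactly supported function converges in every Sobolev norm that is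
finite. -/
theorem exists_mollification {k : 𝔼 → ℝ} (hk : Integrable k) :
    ∃ l : ℕ → 𝔼 → ℝ, (∀ n, ContDiff ℝ 2 (l n)) ∧ (∀ n, Integrable (l n)) ∧
      (∀ n, Function.support (l n) ⊆ Metric.cthickening (1 / ((n : ℝ) + 1)) (Function.support k)) ∧
      ∀ s, fourierSobNormSq s k < ⊤ →
        Tendsto (fun n => fourierSobNormSq s fun y => l n y - k y) atTop (𝓝 0) := by
  let φ : ℕ → ContDiffBump (0 : 𝔼) := fun n =>
    { rIn := 1 / ((n : ℝ) + 1) / 2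
      rOut := 1 / ((n : ℝ) + 1)
      rIn_pos := by positivity
      rIn_lt_rOut := by exact half_lt_self (by positivity) }
  have hφ : Tendsto (fun n => (φ n).rOut) atTop (𝓝 0) := tendsto_one_div_add_atTop_nhds_zero_nat
  let η : ℕ → 𝔼 → ℝ := fun n => (φ n).normed volume
  let l : ℕ → 𝔼 → ℝ := fun n => convolution (η n) k (ContinuousLinearMap.lsmul ℝ ℝ) volume
  have hηc : ∀ n, Continuous (η n) := fun n => (φ n).continuous_normed
  have hηs : ∀ n, HasCompactSupport (η n) := fun n => (φ n).hasCompactSupport_normed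
  have hηi : ∀ n, Integrable (η n) := fun n => (hηc n).integrable_of_hasCompactSupport (hηs n)
  have hli : ∀ n, Integrable (l n) := fun n => (hηi n).integrable_convolution _ hk
  have hlF : ∀ n ξ, 𝓕 (fun y => (l n y : ℂ)) ξ =
      𝓕 (fun y => (η n y : ℂ)) ξ * 𝓕 (fun y => (k y : ℂ)) ξ := by
    intro n ξ
    rw [← Real.fourier_mul_convolution_eq (hηi n).complex hk.complex]
    refine congrArg (fun F : 𝔼 → ℂ => 𝓕 F ξ) (funext fun x => ?_)
    simp only [l, convolution_def, ContinuousLinearMap.lsmul_apply, smul_eq_mul,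
      ContinuousLinearMap.mul_apply']
    rw [← integral_complex_ofReal]
    simp only [Complex.ofReal_mul]
  have hη1 : ∀ n ξ, ‖𝓕 (fun y => (η n y : ℂ)) ξ‖ ≤ 1 := by
    intro n ξ
    refine (Real.norm_fourier_le _ _).trans (le_of_eq ?_)
    rw [← (φ n).integral_normed (μ := (volume : Measure 𝔼))]
    refine integral_congr_ae (Eventually.of_forall fun x => ?_)
    simp only [Complex.norm_real]
    exact Real.norm_of_nonneg ((φ n).nonneg_normed x)
  have hηlim : ∀ ξ, Tendsto (fun n => 𝓕 (fun y => (η n y : ℂ)) ξ) atTop (𝓝 1) := by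
    intro ξ
    have hcont : Continuous fun y : 𝔼 => ((Real.fourierChar (inner ℝ y ξ) : Circle) : ℂ) := by
      fun_prop
    have h1 := ContDiffBump.convolution_tendsto_right_of_continuous (μ := (volume : Measure 𝔼))
      hφ hcont 0
    simp only [inner_zero_left, AddChar.map_zero_eq_one, Circle.coe_one] at h1
    refine h1.congr fun n => ?_
    rw [Real.fourier_eq, convolution_def]
    refine integral_congr_ae (Eventually.of_forall fun x => ?_)
    simp only [ContinuousLinearMap.lsmul_apply, zero_sub, inner_neg_left, Circle.smul_def, η,
      smul_eq_mul, Complex.real_smul]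
    ring
  refine ⟨l, fun n => ?_, hli, fun n => ?_, fun s hs => ?_⟩
  · exact (hηs n).contDiff_convolution_left _ (φ n).contDiff_normed hk.locallyIntegrable
  · refine (support_convolution_subset _).trans ?_
    rintro x ⟨a, ha, b, hb, rfl⟩
    have ha' : a ∈ Metric.ball (0 : 𝔼) (φ n).rOut := by
      rw [← (φ n).support_normed_eq (μ := (volume : Measure 𝔼))]; exact ha
    refine Metric.mem_cthickening_of_dist_le _ b _ _ hb ?_
    rw [dist_eq_norm, add_sub_cancel_right]
    exact (mem_ball_zero_iff.1 ha').le
  -- On the Fourier side mollification is multiplication by a function of modulus at most `1` that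
  -- tends to `1` pointwise; the dominating constant `4` is `(1 + 1)²`.
  · have h0 : (0 : ℝ≥0∞) = ∫⁻ ξ : 𝔼, 0 := by simp
    rw [h0]
    refine tendsto_lintegral_of_dominated_convergence
      (fun ξ => 4 * (ENNReal.ofReal ((1 + (2 * Real.pi * ‖ξ‖) ^ 2) ^ s) *
        ‖𝓕 (fun y => ((k y : ℝ) : ℂ)) ξ‖ₑ ^ 2))
      (fun n => measurable_sobolevIntegrand s ((hli n).sub hk)) (fun n => ?_) ?_ ?_
    · refine Eventually.of_forall fun ξ => ?_
      simp only [Complex.ofReal_sub]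
      rw [Real.fourier_sub' (hli n).complex hk.complex, hlF]
      set a := 𝓕 (fun y => (η n y : ℂ)) ξ with ha
      set b := 𝓕 (fun y => (k y : ℂ)) ξ
      have h1 : ‖a * b - b‖ ^ 2 ≤ 4 * ‖b‖ ^ 2 := by
        have h2 : ‖a * b - b‖ ≤ 2 * ‖b‖ := by
          refine (norm_sub_le _ _).trans ?_
          rw [norm_mul]
          nlinarith [hη1 n ξ, norm_nonneg b]
        nlinarith [norm_nonneg (a * b - b)]
      have h2 := ENNReal.ofReal_le_ofReal h1
      rw [ENNReal.ofReal_mul (by norm_num)] at h2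
      simp only [ENNReal.ofReal_pow (norm_nonneg _), ofReal_norm, ENNReal.ofReal_ofNat] at h2
      exact (mul_le_mul' le_rfl h2).trans (le_of_eq (by ring))
    · rw [lintegral_const_mul _ (measurable_sobolevIntegrand s hk)]
      exact ENNReal.mul_ne_top (by norm_num) hs.ne
    · refine Eventually.of_forall fun ξ => ?_
      simp only [Complex.ofReal_sub]
      simp_rw [fun n => Real.fourier_sub' (hli n).complex hk.complex ξ, hlF]
      have h1 : Tendsto (fun n => 𝓕 (fun y => (η n y : ℂ)) ξ * 𝓕 (fun y => (k y : ℂ)) ξ -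
          𝓕 (fun y => (k y : ℂ)) ξ) atTop (𝓝 0) := by
        have := ((hηlim ξ).mul_const (𝓕 (fun y => (k y : ℂ)) ξ)).sub_const
          (𝓕 (fun y => (k y : ℂ)) ξ)
        simpa using this
      have h2 := ENNReal.Tendsto.pow (n := 2) ((continuous_enorm.tendsto _).comp h1)
      have h3 := ENNReal.Tendsto.const_mul
        (a := ENNReal.ofReal ((1 + (2 * Real.pi * ‖ξ‖) ^ 2) ^ s)) h2
        (Or.inr ENNReal.ofReal_ne_top)
      simpa using h3

end FourierRegularity

/-! ### The measure in charts and equivalence of the order-zero norm with `L²`. -/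

section ManifoldNorms

open Filter Topology

variable {d : ℕ} {N : Type*} [TopologicalSpace N] [ChartedSpace (EuclideanSpace ℝ (Fin d)) N]

local notation "𝔼" => EuclideanSpace ℝ (Fin d)

namespace SobolevAtlas

theorem exists_mem_tsupport (A : SobolevAtlas d N) (x : N) : ∃ i, x ∈ tsupport (A.psi i) := by
  by_contra h
  push Not at h
  have h1 := A.psi_sum x
  rw [Finset.sum_eq_zero fun i _ => image_eq_zero_of_notMem_tsupport (h i)] at h1
  exact zero_ne_one h1

theorem isCompact_piece [CompactSpace N] (A : SobolevAtlas d N) (i : Fin A.card) :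
    IsCompact (A.piece i) :=
  (isClosed_tsupport _).isCompact.image_of_continuousOn
    ((A.chart i).continuousOn.mono (A.psi_tsupport i))

theorem measurableSet_piece [CompactSpace N] (A : SobolevAtlas d N) (i : Fin A.card) :
    MeasurableSet (A.piece i) := (A.isCompact_piece i).isClosed.measurableSet

theorem piece_subset_target (A : SobolevAtlas d N) (i : Fin A.card) :
    A.piece i ⊆ (A.chart i).target := by
  rintro _ ⟨x, hx, rfl⟩
  exact (A.chart i).map_source (A.psi_tsupport i hx)

theorem symm_mem_tsupport (A : SobolevAtlas d N) {i : Fin A.card} {y : 𝔼} (hy : y ∈ A.piece i) :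
    (A.chart i).symm y ∈ tsupport (A.psi i) := by
  obtain ⟨x, hx, rfl⟩ := hy
  rwa [(A.chart i).left_inv (A.psi_tsupport i hx)]

theorem mem_piece_of_symm_mem (A : SobolevAtlas d N) {i : Fin A.card} {y : 𝔼}
    (hy : y ∈ (A.chart i).target) (h : (A.chart i).symm y ∈ tsupport (A.psi i)) : y ∈ A.piece i :=
  ⟨_, h, (A.chart i).right_inv hy⟩

theorem continuousOn_symm (A : SobolevAtlas d N) (i : Fin A.card) :
    ContinuousOn (A.chart i).symm (A.piece i) :=
  (A.chart i).continuousOn_symm.mono (A.piece_subset_target i)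

theorem psi_le_one (A : SobolevAtlas d N) (i : Fin A.card) (x : N) : A.psi i x ≤ 1 := by
  rw [← A.psi_sum x]
  exact Finset.single_le_sum (fun j _ => A.psi_nonneg j x) (Finset.mem_univ i)

theorem loc_eq_indicator (A : SobolevAtlas d N) (i : Fin A.card) (u : N → ℝ) :
    A.loc i u = (A.piece i).indicator
      (fun y => A.psi i ((A.chart i).symm y) * u ((A.chart i).symm y)) := by
  ext y
  by_cases hy : y ∈ A.piece i
  · rw [loc, indicator_of_mem hy, indicator_of_mem (A.piece_subset_target i hy)]
  · rw [indicator_of_notMem hy, loc]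
    by_cases hyt : y ∈ (A.chart i).target
    · rw [indicator_of_mem hyt, image_eq_zero_of_notMem_tsupport
        fun h => hy (A.mem_piece_of_symm_mem hyt h), zero_mul]
    · rw [indicator_of_notMem hyt]

theorem loc_add (A : SobolevAtlas d N) (i : Fin A.card) (u v : N → ℝ) :
    A.loc i (fun x => u x + v x) = fun y => A.loc i u y + A.loc i v y := by
  ext y
  simp only [loc, indicator]
  split_ifs <;> ring

theorem loc_sub (A : SobolevAtlas d N) (i : Fin A.card) (u v : N → ℝ) :
    A.loc i (fun x => u x - v x) = fun y => A.loc i u y - A.loc i v y := by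
  ext y
  simp only [loc, indicator]
  split_ifs <;> ring

theorem loc_const_mul (A : SobolevAtlas d N) (i : Fin A.card) (c : ℝ) (u : N → ℝ) :
    A.loc i (fun x => c * u x) = fun y => c * A.loc i u y := by
  ext y
  simp only [loc, indicator]
  split_ifs <;> ring

theorem sobNormSq_eq (A : SobolevAtlas d N) (s : ℝ) (u : N → ℝ) :
    A.sobNormSq s u = ∑ i, fourierSobNormSq s (A.loc i u) := rfl

theorem continuous_psi (A : SobolevAtlas d N) (i : Fin A.card) : Continuous (A.psi i) :=
  (A.psi_contMDiff i).continuous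

theorem lintegral_loc_sq [CompactSpace N] (A : SobolevAtlas d N) (i : Fin A.card) (u : N → ℝ) :
    ∫⁻ y, ‖A.loc i u y‖ₑ ^ 2 =
      ∫⁻ y in A.piece i, ‖A.psi i ((A.chart i).symm y) * u ((A.chart i).symm y)‖ₑ ^ 2 := by
  rw [← lintegral_indicator (A.measurableSet_piece i), A.loc_eq_indicator]
  refine lintegral_congr fun y => ?_
  by_cases hy : y ∈ A.piece i
  · simp [indicator_of_mem hy]
  · simp [indicator_of_notMem hy]

/-- The upper bound uses `0 ≤ ψ_i ≤ 1`, the lower one Cauchy–Schwarz for `a = ∑ ψ_i a`. Integrated,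
they compare the norm of order zero with that of `L²(μ)`. -/
theorem sum_enorm_sq_le (A : SobolevAtlas d N) (x : N) (a : ℝ) :
    ∑ i, ‖A.psi i x * a‖ₑ ^ 2 ≤ ‖a‖ₑ ^ 2 ∧ ‖a‖ₑ ^ 2 ≤ A.card * ∑ i, ‖A.psi i x * a‖ₑ ^ 2 := by
  have e : ∀ b : ℝ, ‖b‖ₑ ^ 2 = ENNReal.ofReal (b ^ 2) := fun b => by
    rw [← ofReal_norm, ← ENNReal.ofReal_pow (norm_nonneg _), Real.norm_eq_abs, sq_abs]
  simp only [e]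
  rw [← ENNReal.ofReal_sum_of_nonneg (fun _ _ => sq_nonneg _), ← ENNReal.ofReal_natCast,
    ← ENNReal.ofReal_mul (by positivity)]
  have hs := A.psi_sum x
  constructor
  · refine ENNReal.ofReal_le_ofReal ?_
    simp only [mul_pow]
    rw [← Finset.sum_mul]
    refine mul_le_of_le_one_left (sq_nonneg _) ?_
    rw [← hs]
    refine Finset.sum_le_sum fun i _ => ?_
    nlinarith [A.psi_nonneg i x, A.psi_le_one i x]
  · refine ENNReal.ofReal_le_ofReal ?_
    have h1 := sq_sum_le_card_mul_sum_sq (s := (Finset.univ : Finset (Fin A.card)))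
      (f := fun i => A.psi i x * a)
    rw [← Finset.sum_mul, hs, one_mul] at h1
    simpa using h1

variable [MeasurableSpace N]

/-- `J i` is a density of `μ` in the `i`-th chart, Lipschitz and between `κ⁻¹` and `κ`. -/
structure IsDensity (A : SobolevAtlas d N) (μ : Measure N) (κ : ℝ≥0)
    (J : Fin A.card → 𝔼 → ℝ) : Prop where
  pos : 0 < κ
  lip : ∀ i, LipschitzOnWith κ (J i) (A.piece i)
  lower : ∀ i, ∀ y ∈ A.piece i, (κ : ℝ)⁻¹ ≤ J i y
  upper : ∀ i, ∀ y ∈ A.piece i, J i y ≤ κ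
  apply_eq : ∀ i, ∀ s : Set N, MeasurableSet s → s ⊆ tsupport (A.psi i) →
    μ s = ∫⁻ y in A.chart i '' s, ENNReal.ofReal (J i y)

theorem LipDensity.exists_isDensity {A : SobolevAtlas d N} {μ : Measure N}
    (h : A.LipDensity μ) : ∃ κ J, A.IsDensity μ κ J := by
  obtain ⟨κ, J, hκ, h⟩ := h
  exact ⟨κ, J, hκ, fun i => (h i).1, fun i y hy => ((h i).2.1 y hy).1,
    fun i y hy => ((h i).2.1 y hy).2, fun i => (h i).2.2⟩

namespace IsDensity

variable {A : SobolevAtlas d N} {μ : Measure N} {κ : ℝ≥0}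
  {J : Fin A.card → EuclideanSpace ℝ (Fin d) → ℝ}

theorem J_pos (h : A.IsDensity μ κ J) {i : Fin A.card} {y : 𝔼} (hy : y ∈ A.piece i) :
    0 < J i y :=
  lt_of_lt_of_le (inv_pos.2 (NNReal.coe_pos.2 h.pos)) (h.lower i y hy)

theorem aemeasurable_J [CompactSpace N] (h : A.IsDensity μ κ J) (i : Fin A.card) :
    AEMeasurable (fun y => ENNReal.ofReal (J i y)) (volume.restrict (A.piece i)) :=
  ((h.lip i).continuousOn.aemeasurable (A.measurableSet_piece i)).ennreal_ofReal

theorem aemeasurable_psi_mul_sq [BorelSpace N] (A : SobolevAtlas d N) {u : N → ℝ}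
    (hu : AEStronglyMeasurable u μ) (i : Fin A.card) :
    AEMeasurable (fun x => ‖A.psi i x * u x‖ₑ ^ 2) μ :=
  ((continuous_psi A i).aestronglyMeasurable.mul hu).enorm.pow_const 2

/-- Positivity of the density: null sets of the weighted measure in the chart are Lebesgue null, so
statements that hold `μ`-almost everywhere can be read in charts. -/
theorem volume_ac [CompactSpace N] (h : A.IsDensity μ κ J) (i : Fin A.card) :
    volume.restrict (A.piece i) ≪
      (volume.restrict (A.piece i)).withDensity (fun y => ENNReal.ofReal (J i y)) := by
  refine withDensity_absolutelyContinuous' (h.aemeasurable_J i) ?_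
  filter_upwards [ae_restrict_mem (A.measurableSet_piece i)] with y hy
  simpa using h.J_pos hy

variable [CompactSpace N] [BorelSpace N]

theorem aemeasurable_symm (A : SobolevAtlas d N) (i : Fin A.card) :
    AEMeasurable (A.chart i).symm (volume.restrict (A.piece i)) :=
  (A.continuousOn_symm i).aemeasurable (A.measurableSet_piece i)

theorem restrict_eq_map (h : A.IsDensity μ κ J) (i : Fin A.card) :
    μ.restrict (tsupport (A.psi i)) =
      ((volume.restrict (A.piece i)).withDensity (fun y => ENNReal.ofReal (J i y))).map
        (A.chart i).symm := by
  have hT : MeasurableSet (tsupport (A.psi i)) := (isClosed_tsupport _).measurableSet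
  ext s hs
  rw [Measure.map_apply_of_aemeasurable
    ((aemeasurable_symm A i).mono_ac (withDensity_absolutelyContinuous _ _)) hs,
    withDensity_apply', Measure.restrict_restrict' (A.measurableSet_piece i),
    Measure.restrict_apply hs, h.apply_eq i _ (hs.inter hT) inter_subset_right]
  have : A.chart i '' (s ∩ tsupport (A.psi i)) = (A.chart i).symm ⁻¹' s ∩ A.piece i := by
    ext y
    constructor
    · rintro ⟨x, ⟨hxs, hxT⟩, rfl⟩
      refine ⟨?_, x, hxT, rfl⟩
      rw [mem_preimage, (A.chart i).left_inv (A.psi_tsupport i hxT)]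
      exact hxs
    · rintro ⟨hys, hyp⟩
      exact ⟨_, ⟨hys, A.symm_mem_tsupport hyp⟩, (A.chart i).right_inv (A.piece_subset_target i hyp)⟩
  rw [this]

theorem ae_comp (h : A.IsDensity μ κ J) (i : Fin A.card) {P : N → Prop} (hP : ∀ᵐ x ∂μ, P x) :
    ∀ᵐ y ∂(volume.restrict (A.piece i)), P ((A.chart i).symm y) := by
  refine (h.volume_ac i).ae_le ?_
  have h1 : ∀ᵐ x ∂(μ.restrict (tsupport (A.psi i))), P x := ae_restrict_of_ae hP
  rw [h.restrict_eq_map i] at h1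
  exact ae_of_ae_map ((aemeasurable_symm A i).mono_ac (withDensity_absolutelyContinuous _ _)) h1

theorem aestronglyMeasurable_comp (h : A.IsDensity μ κ J) (i : Fin A.card) {u : N → ℝ}
    (hu : AEStronglyMeasurable u μ) :
    AEStronglyMeasurable (fun y => u ((A.chart i).symm y)) (volume.restrict (A.piece i)) := by
  have h1 : AEStronglyMeasurable u (μ.restrict (tsupport (A.psi i))) := hu.restrict
  rw [h.restrict_eq_map i] at h1
  exact (h1.comp_aemeasurable
    ((aemeasurable_symm A i).mono_ac (withDensity_absolutelyContinuous _ _))).mono_ac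
      (h.volume_ac i)

theorem aemeasurable_comp (h : A.IsDensity μ κ J) (i : Fin A.card) {F : N → ℝ≥0∞}
    (hF : AEMeasurable F μ) :
    AEMeasurable (fun y => F ((A.chart i).symm y)) (volume.restrict (A.piece i)) := by
  have h1 : AEMeasurable F (μ.restrict (tsupport (A.psi i))) := hF.restrict
  rw [h.restrict_eq_map i] at h1
  exact (h1.comp_aemeasurable
    ((aemeasurable_symm A i).mono_ac (withDensity_absolutelyContinuous _ _))).mono_ac
      (h.volume_ac i)

theorem setLIntegral_eq (h : A.IsDensity μ κ J) (i : Fin A.card) {F : N → ℝ≥0∞}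
    (hF : AEMeasurable F μ) :
    ∫⁻ x in tsupport (A.psi i), F x ∂μ =
      ∫⁻ y in A.piece i, ENNReal.ofReal (J i y) * F ((A.chart i).symm y) := by
  have h1 : AEMeasurable F (μ.restrict (tsupport (A.psi i))) := hF.restrict
  rw [h.restrict_eq_map i] at h1 ⊢
  rw [lintegral_map' h1 ((aemeasurable_symm A i).mono_ac (withDensity_absolutelyContinuous _ _)),
    lintegral_withDensity_eq_lintegral_mul₀ (h.aemeasurable_J i) (h.aemeasurable_comp i hF)]
  rfl

theorem setIntegral_eq (h : A.IsDensity μ κ J) (i : Fin A.card) {F : N → ℝ}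
    (hF : AEStronglyMeasurable F μ) :
    ∫ x in tsupport (A.psi i), F x ∂μ =
      ∫ y in A.piece i, J i y * F ((A.chart i).symm y) := by
  have h1 : AEStronglyMeasurable F (μ.restrict (tsupport (A.psi i))) := hF.restrict
  rw [h.restrict_eq_map i] at h1 ⊢
  rw [integral_map ((aemeasurable_symm A i).mono_ac (withDensity_absolutelyContinuous _ _)) h1,
    integral_withDensity_eq_integral_toReal_smul₀ (h.aemeasurable_J i)
      (Eventually.of_forall fun _ => ENNReal.ofReal_lt_top)]
  refine setIntegral_congr_fun (A.measurableSet_piece i) fun y hy => ?_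
  simp only [smul_eq_mul, ENNReal.toReal_ofReal (h.J_pos hy).le]

theorem isFiniteMeasure (h : A.IsDensity μ κ J) : IsFiniteMeasure μ := by
  constructor
  have hcov : (univ : Set N) ⊆ ⋃ i, tsupport (A.psi i) := fun x _ =>
    mem_iUnion.2 (A.exists_mem_tsupport x)
  refine (measure_mono hcov).trans_lt ((measure_iUnion_fintype_le μ _).trans_lt ?_)
  refine ENNReal.sum_lt_top.2 fun i _ => ?_
  have h1 := h.setLIntegral_eq i (F := fun _ => 1) aemeasurable_const
  simp only [lintegral_const, one_mul, Measure.restrict_apply_univ, mul_one] at h1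
  rw [h1]
  calc ∫⁻ y in A.piece i, ENNReal.ofReal (J i y) ≤ ∫⁻ y in A.piece i, (κ : ℝ≥0∞) := by
        refine setLIntegral_mono' (A.measurableSet_piece i) fun y hy => ?_
        rw [← ENNReal.ofReal_coe_nnreal]
        exact ENNReal.ofReal_le_ofReal (h.upper i y hy)
    _ = κ * volume (A.piece i) := by simp
    _ < ⊤ := ENNReal.mul_lt_top ENNReal.coe_lt_top (A.isCompact_piece i).measure_lt_top

theorem setLIntegral_comp_le (h : A.IsDensity μ κ J) (i : Fin A.card) {F : N → ℝ≥0∞}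
    (hF : AEMeasurable F μ) :
    ∫⁻ y in A.piece i, F ((A.chart i).symm y) ≤ κ * ∫⁻ x in tsupport (A.psi i), F x ∂μ := by
  rw [h.setLIntegral_eq i hF, ← lintegral_const_mul' _ _ ENNReal.coe_ne_top]
  refine setLIntegral_mono' (A.measurableSet_piece i) fun y hy => ?_
  rw [← mul_assoc]
  refine le_mul_of_one_le_left' ?_
  rw [← ENNReal.ofReal_coe_nnreal, ← ENNReal.ofReal_mul κ.coe_nonneg, ← ENNReal.ofReal_one]
  refine ENNReal.ofReal_le_ofReal ?_
  have h1 := h.lower i y hy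
  have h2 : (0 : ℝ) < κ := h.pos
  calc (1 : ℝ) = κ * (κ : ℝ)⁻¹ := by field_simp
    _ ≤ κ * J i y := by gcongr

theorem setLIntegral_le_comp (h : A.IsDensity μ κ J) (i : Fin A.card) {F : N → ℝ≥0∞}
    (hF : AEMeasurable F μ) :
    ∫⁻ x in tsupport (A.psi i), F x ∂μ ≤ κ * ∫⁻ y in A.piece i, F ((A.chart i).symm y) := by
  rw [h.setLIntegral_eq i hF, ← lintegral_const_mul' _ _ ENNReal.coe_ne_top]
  refine setLIntegral_mono' (A.measurableSet_piece i) fun y hy => ?_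
  gcongr
  rw [← ENNReal.ofReal_coe_nnreal]
  exact ENNReal.ofReal_le_ofReal (h.upper i y hy)

theorem lintegral_loc_sq_le (h : A.IsDensity μ κ J) (i : Fin A.card) {u : N → ℝ}
    (hu : AEStronglyMeasurable u μ) :
    ∫⁻ y, ‖A.loc i u y‖ₑ ^ 2 ≤ κ * ∫⁻ x, ‖A.psi i x * u x‖ₑ ^ 2 ∂μ := by
  rw [lintegral_loc_sq]
  refine (h.setLIntegral_comp_le i (F := fun x => ‖A.psi i x * u x‖ₑ ^ 2)
    (((continuous_psi A i).aestronglyMeasurable.mul hu).enorm.pow_const 2)).trans ?_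
  gcongr
  exact Measure.restrict_le_self

theorem lintegral_psi_sq_le (h : A.IsDensity μ κ J) (i : Fin A.card) {u : N → ℝ}
    (hu : AEStronglyMeasurable u μ) :
    ∫⁻ x, ‖A.psi i x * u x‖ₑ ^ 2 ∂μ ≤ κ * ∫⁻ y, ‖A.loc i u y‖ₑ ^ 2 := by
  rw [lintegral_loc_sq]
  refine le_trans (le_of_eq ?_) (h.setLIntegral_le_comp i (F := fun x => ‖A.psi i x * u x‖ₑ ^ 2)
    (((continuous_psi A i).aestronglyMeasurable.mul hu).enorm.pow_const 2))
  refine (setLIntegral_eq_of_support_subset fun x hx => ?_).symm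
  by_contra hx'
  simp [image_eq_zero_of_notMem_tsupport hx'] at hx

theorem memLp_loc (h : A.IsDensity μ κ J) (i : Fin A.card) {u : N → ℝ} (hu : MemLp u 2 μ) :
    MemLp (A.loc i u) 2 := by
  refine ⟨?_, ?_⟩
  · rw [A.loc_eq_indicator, aestronglyMeasurable_indicator_iff (A.measurableSet_piece i)]
    exact (((continuous_psi A i).comp_continuousOn
      (A.continuousOn_symm i)).aestronglyMeasurable (A.measurableSet_piece i)).mul
        (h.aestronglyMeasurable_comp i hu.1)
  · rw [eLpNorm_lt_top_iff_lintegral_rpow_enorm_lt_top (by norm_num) (by norm_num)]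
    have h1 := hu.2
    rw [eLpNorm_lt_top_iff_lintegral_rpow_enorm_lt_top (by norm_num) (by norm_num)] at h1
    simp only [ENNReal.toReal_ofNat, ENNReal.rpow_ofNat] at h1 ⊢
    refine (h.lintegral_loc_sq_le i hu.1).trans_lt (ENNReal.mul_lt_top ENNReal.coe_lt_top ?_)
    refine (lintegral_mono fun x => ?_).trans_lt h1
    have : ‖A.psi i x * u x‖ₑ ≤ ‖u x‖ₑ := by
      rw [enorm_mul]
      refine mul_le_of_le_one_left' ?_
      rw [← ofReal_norm, Real.norm_of_nonneg (A.psi_nonneg i x), ← ENNReal.ofReal_one]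
      exact ENNReal.ofReal_le_ofReal (A.psi_le_one i x)
    simp only
    gcongr

theorem integrable_loc (h : A.IsDensity μ κ J) (i : Fin A.card) {u : N → ℝ} (hu : MemLp u 2 μ) :
    Integrable (A.loc i u) := by
  have h1 := h.memLp_loc i hu
  have h2 : Function.support (A.loc i u) ⊆ A.piece i := by
    rw [A.loc_eq_indicator]; exact support_indicator_subset
  rw [← integrableOn_iff_integrable_of_support_subset h2]
  have : IsFiniteMeasure (volume.restrict (A.piece i)) :=
    ⟨by simpa using (A.isCompact_piece i).measure_lt_top⟩
  exact (h1.restrict (A.piece i)).integrable (by norm_num)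

theorem sobNormSq_congr (h : A.IsDensity μ κ J) (s : ℝ) {u v : N → ℝ} (huv : u =ᵐ[μ] v) :
    A.sobNormSq s u = A.sobNormSq s v := by
  rw [sobNormSq_eq, sobNormSq_eq]
  refine Finset.sum_congr rfl fun i _ => fourierSobNormSq_congr s ?_
  rw [A.loc_eq_indicator, A.loc_eq_indicator]
  have h1 := (ae_restrict_iff' (A.measurableSet_piece i)).1 (h.ae_comp i huv)
  filter_upwards [h1] with y hy
  by_cases hyp : y ∈ A.piece i
  · rw [indicator_of_mem hyp, indicator_of_mem hyp, hy hyp]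
  · rw [indicator_of_notMem hyp, indicator_of_notMem hyp]

theorem sobNormSq_zero_eq (h : A.IsDensity μ κ J) {u : N → ℝ} (hu : MemLp u 2 μ) :
    A.sobNormSq 0 u = ∑ i, ∫⁻ y, ‖A.loc i u y‖ₑ ^ 2 := by
  rw [sobNormSq_eq]
  exact Finset.sum_congr rfl fun i _ =>
    fourierSobNormSq_zero (h.integrable_loc i hu) (h.memLp_loc i hu)

theorem sobNormSq_zero_le (h : A.IsDensity μ κ J) {u : N → ℝ} (hu : MemLp u 2 μ) :
    A.sobNormSq 0 u ≤ κ * ∫⁻ x, ‖u x‖ₑ ^ 2 ∂μ := by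
  rw [h.sobNormSq_zero_eq hu]
  calc _ ≤ ∑ i, κ * ∫⁻ x, ‖A.psi i x * u x‖ₑ ^ 2 ∂μ :=
        Finset.sum_le_sum fun i _ => h.lintegral_loc_sq_le i hu.1
    _ = κ * ∫⁻ x, ∑ i, ‖A.psi i x * u x‖ₑ ^ 2 ∂μ := by
      rw [← Finset.mul_sum, lintegral_finsetSum' _ fun i _ =>
        aemeasurable_psi_mul_sq A hu.1 i]
    _ ≤ _ := by gcongr with x; exact (sum_enorm_sq_le A x (u x)).1

theorem le_sobNormSq_zero (h : A.IsDensity μ κ J) {u : N → ℝ} (hu : MemLp u 2 μ) :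
    ∫⁻ x, ‖u x‖ₑ ^ 2 ∂μ ≤ A.card * κ * A.sobNormSq 0 u := by
  rw [h.sobNormSq_zero_eq hu]
  calc _ ≤ ∫⁻ x, A.card * ∑ i, ‖A.psi i x * u x‖ₑ ^ 2 ∂μ :=
        lintegral_mono fun x => (sum_enorm_sq_le A x (u x)).2
    _ = A.card * ∑ i, ∫⁻ x, ‖A.psi i x * u x‖ₑ ^ 2 ∂μ := by
      rw [lintegral_const_mul' _ _ (ENNReal.natCast_ne_top _), lintegral_finsetSum' _ fun i _ =>
        aemeasurable_psi_mul_sq A hu.1 i]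
    _ ≤ A.card * ∑ i, κ * ∫⁻ y, ‖A.loc i u y‖ₑ ^ 2 := by
      gcongr with i; exact h.lintegral_psi_sq_le i hu.1
    _ = _ := by rw [← Finset.mul_sum, mul_assoc]

end IsDensity

end SobolevAtlas

end ManifoldNorms

/-! ### The Sobolev spaces as subspaces of `L²(μ)`, closedness and interpolation. -/

section SobolevSpace

open Filter Topology

variable {d : ℕ} {N : Type*} [TopologicalSpace N] [ChartedSpace (EuclideanSpace ℝ (Fin d)) N]

theorem MeasureTheory.Lp.lintegral_enorm_sq {α : Type*} [MeasurableSpace α] {ν : Measure α}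
    (u : Lp ℝ 2 ν) : ∫⁻ x, ‖u x‖ₑ ^ 2 ∂ν = ‖u‖ₑ ^ 2 := by
  rw [Lp.enorm_def, eLpNorm_eq_lintegral_rpow_enorm_toReal (by norm_num) (by norm_num)]
  simp only [ENNReal.toReal_ofNat, ENNReal.rpow_ofNat, one_div]
  rw [← ENNReal.rpow_natCast, ← ENNReal.rpow_mul]
  norm_num

namespace SobolevAtlas

theorem nrm_sq (A : SobolevAtlas d N) (s : ℝ) (u : N → ℝ) :
    A.nrm s u ^ 2 = (A.sobNormSq s u).toReal := Real.sq_sqrt ENNReal.toReal_nonneg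

theorem nrm_nonneg (A : SobolevAtlas d N) (s : ℝ) (u : N → ℝ) : 0 ≤ A.nrm s u := Real.sqrt_nonneg _

theorem sobNormSq_mono (A : SobolevAtlas d N) {s s' : ℝ} (hs : s ≤ s') (u : N → ℝ) :
    A.sobNormSq s u ≤ A.sobNormSq s' u :=
  Finset.sum_le_sum fun _ _ => fourierSobNormSq_mono hs _

theorem MemSob.mono {A : SobolevAtlas d N} {s s' : ℝ} {u : N → ℝ} (hu : A.MemSob s' u)
    (hs : s ≤ s') : A.MemSob s u := (A.sobNormSq_mono hs u).trans_lt hu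

theorem nrm_mono {A : SobolevAtlas d N} {s s' : ℝ} {u : N → ℝ} (hu : A.MemSob s' u)
    (hs : s ≤ s') : A.nrm s u ≤ A.nrm s' u :=
  Real.sqrt_le_sqrt (ENNReal.toReal_mono hu.ne (A.sobNormSq_mono hs u))

theorem sobNormSq_const_mul (A : SobolevAtlas d N) (s c : ℝ) (u : N → ℝ) :
    A.sobNormSq s (fun x => c * u x) = ENNReal.ofReal (c ^ 2) * A.sobNormSq s u := by
  rw [sobNormSq_eq, sobNormSq_eq, Finset.mul_sum]
  refine Finset.sum_congr rfl fun i _ => ?_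
  rw [A.loc_const_mul, fourierSobNormSq_const_mul]

theorem sobNormSq_eq_ofReal {A : SobolevAtlas d N} {s : ℝ} {u : N → ℝ} (hu : A.MemSob s u) :
    A.sobNormSq s u = ENNReal.ofReal (A.nrm s u ^ 2) := by
  rw [nrm_sq, ENNReal.ofReal_toReal hu.ne]

theorem sobNormSq_le_ofReal_iff {A : SobolevAtlas d N} {s C : ℝ} (hC : 0 ≤ C) {u : N → ℝ} :
    A.sobNormSq s u ≤ ENNReal.ofReal (C ^ 2) ↔ A.MemSob s u ∧ A.nrm s u ≤ C := by
  constructor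
  · intro h
    refine ⟨h.trans_lt ENNReal.ofReal_lt_top, ?_⟩
    refine Real.sqrt_le_iff.2 ⟨hC, ?_⟩
    exact ENNReal.toReal_le_of_le_ofReal (sq_nonneg C) h
  · rintro ⟨h, h'⟩
    rw [sobNormSq_eq_ofReal h]
    exact ENNReal.ofReal_le_ofReal (pow_le_pow_left₀ (A.nrm_nonneg s u) h' 2)

namespace IsDensity

variable [MeasurableSpace N] {A : SobolevAtlas d N} {μ : Measure N} {κ : ℝ≥0}
  {J : Fin A.card → EuclideanSpace ℝ (Fin d) → ℝ} [CompactSpace N] [BorelSpace N]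

theorem sobNormSq_add_le (h : A.IsDensity μ κ J) (s : ℝ) {u v : N → ℝ} (hu : MemLp u 2 μ)
    (hv : MemLp v 2 μ) :
    A.sobNormSq s (fun x => u x + v x) ≤ 2 * A.sobNormSq s u + 2 * A.sobNormSq s v := by
  rw [sobNormSq_eq, sobNormSq_eq, sobNormSq_eq, Finset.mul_sum, Finset.mul_sum,
    ← Finset.sum_add_distrib]
  refine Finset.sum_le_sum fun i _ => ?_
  rw [A.loc_add]
  exact fourierSobNormSq_add_le s (h.integrable_loc i hu) (h.integrable_loc i hv)

theorem sobNormSq_coe_add_le (h : A.IsDensity μ κ J) (s : ℝ) (u v : Lp ℝ 2 μ) :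
    A.sobNormSq s (u + v : Lp ℝ 2 μ) ≤ 2 * A.sobNormSq s u + 2 * A.sobNormSq s v := by
  rw [h.sobNormSq_congr s (Lp.coeFn_add u v)]
  exact h.sobNormSq_add_le s (Lp.memLp u) (Lp.memLp v)

theorem sobNormSq_coe_smul (h : A.IsDensity μ κ J) (s c : ℝ) (u : Lp ℝ 2 μ) :
    A.sobNormSq s (c • u : Lp ℝ 2 μ) = ENNReal.ofReal (c ^ 2) * A.sobNormSq s u := by
  rw [h.sobNormSq_congr s (Lp.coeFn_smul c u), ← A.sobNormSq_const_mul]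
  rfl

theorem sobNormSq_coe_zero (h : A.IsDensity μ κ J) (s : ℝ) :
    A.sobNormSq s (0 : Lp ℝ 2 μ) = 0 := by
  have := h.sobNormSq_coe_smul s 0 0
  simpa using this

/-- The space `H^s` as a subspace of `L²`. -/
noncomputable def sobolevSpace (h : A.IsDensity μ κ J) (s : ℝ) : Submodule ℝ (Lp ℝ 2 μ) where
  carrier := {u | A.MemSob s u}
  add_mem' := fun {u v} hu hv => (h.sobNormSq_coe_add_le s u v).trans_lt
    (ENNReal.add_lt_top.2 ⟨ENNReal.mul_lt_top (by norm_num) hu, ENNReal.mul_lt_top (by norm_num) hv⟩)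
  zero_mem' := by
    change A.sobNormSq s (0 : Lp ℝ 2 μ) < ⊤
    rw [h.sobNormSq_coe_zero]
    exact ENNReal.zero_lt_top
  smul_mem' := fun c u hu => by
    change A.sobNormSq s (c • u : Lp ℝ 2 μ) < ⊤
    rw [h.sobNormSq_coe_smul]
    exact ENNReal.mul_lt_top ENNReal.ofReal_lt_top hu

theorem sobNormSq_zero_coe_le (h : A.IsDensity μ κ J) (u : Lp ℝ 2 μ) :
    A.sobNormSq 0 u ≤ κ * ‖u‖ₑ ^ 2 := by
  rw [← Lp.lintegral_enorm_sq]
  exact h.sobNormSq_zero_le (Lp.memLp u)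

theorem memSob_zero (h : A.IsDensity μ κ J) (u : Lp ℝ 2 μ) : A.MemSob 0 u :=
  (h.sobNormSq_zero_coe_le u).trans_lt
    (ENNReal.mul_lt_top ENNReal.coe_lt_top (ENNReal.pow_lt_top enorm_lt_top))

theorem nrm_zero_sq_le (h : A.IsDensity μ κ J) (u : Lp ℝ 2 μ) :
    A.nrm 0 u ^ 2 ≤ κ * ‖u‖ ^ 2 := by
  rw [nrm_sq]
  refine ENNReal.toReal_le_of_le_ofReal (by positivity) ((h.sobNormSq_zero_coe_le u).trans ?_)
  rw [ENNReal.ofReal_mul (by positivity), ENNReal.ofReal_coe_nnreal,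
    ENNReal.ofReal_pow (norm_nonneg _), ofReal_norm]

theorem norm_sq_le (h : A.IsDensity μ κ J) (u : Lp ℝ 2 μ) :
    ‖u‖ ^ 2 ≤ A.card * κ * A.nrm 0 u ^ 2 := by
  have h1 := h.le_sobNormSq_zero (Lp.memLp u)
  rw [Lp.lintegral_enorm_sq, sobNormSq_eq_ofReal (h.memSob_zero u), ← ofReal_norm,
    ← ENNReal.ofReal_pow (norm_nonneg _), ← ENNReal.ofReal_coe_nnreal, ← ENNReal.ofReal_natCast,
    ← ENNReal.ofReal_mul (by positivity), ← ENNReal.ofReal_mul (by positivity)] at h1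
  exact (ENNReal.ofReal_le_ofReal_iff (by positivity)).1 h1

theorem nrm_coe_smul (h : A.IsDensity μ κ J) (s c : ℝ) (u : Lp ℝ 2 μ) :
    A.nrm s (c • u : Lp ℝ 2 μ) = |c| * A.nrm s u := by
  rw [nrm, nrm, h.sobNormSq_coe_smul, ENNReal.toReal_mul, ENNReal.toReal_ofReal (sq_nonneg c),
    Real.sqrt_mul (sq_nonneg c), Real.sqrt_sq_eq_abs]

theorem nrm_sq_coe_add_le (h : A.IsDensity μ κ J) {s : ℝ} {u v : Lp ℝ 2 μ} (hu : A.MemSob s u)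
    (hv : A.MemSob s v) :
    A.nrm s (u + v : Lp ℝ 2 μ) ^ 2 ≤ 2 * A.nrm s u ^ 2 + 2 * A.nrm s v ^ 2 := by
  rw [nrm_sq]
  refine ENNReal.toReal_le_of_le_ofReal (by positivity) ((h.sobNormSq_coe_add_le s u v).trans ?_)
  rw [sobNormSq_eq_ofReal hu, sobNormSq_eq_ofReal hv, ENNReal.ofReal_add (by positivity)
    (by positivity), ENNReal.ofReal_mul (by norm_num), ENNReal.ofReal_mul (by norm_num)]
  simp

/-- Cauchy–Schwarz on the compact piece. It converts `L²` convergence into the `L¹` convergence on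
which the pointwise control of Fourier transforms rests. -/
theorem integral_abs_loc_le (h : A.IsDensity μ κ J) (i : Fin A.card) :
    ∃ C : ℝ, ∀ u : Lp ℝ 2 μ, ∫ y, ‖A.loc i u y‖ ≤ C * ‖u‖ := by
  have hfin : IsFiniteMeasure (volume.restrict (A.piece i)) :=
    ⟨by simpa using (A.isCompact_piece i).measure_lt_top⟩
  refine ⟨Real.sqrt (volume.real (A.piece i)) * Real.sqrt κ, fun u => ?_⟩
  have hm := h.memLp_loc i (Lp.memLp u)
  have hsupp : Function.support (A.loc i u) ⊆ A.piece i := by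
    rw [A.loc_eq_indicator]; exact support_indicator_subset
  have h1 : ∫ y, ‖A.loc i u y‖ = ∫ y in A.piece i, 1 * ‖A.loc i u y‖ := by
    simp only [one_mul]
    refine (setIntegral_eq_integral_of_forall_compl_eq_zero fun y hy => ?_).symm
    rw [Function.notMem_support.1 fun hy' => hy (hsupp hy'), norm_zero]
  have h2 := integral_mul_le_Lp_mul_Lq_of_nonneg (μ := volume.restrict (A.piece i))
    (p := 2) (q := 2) (Real.HolderConjugate.two_two) (f := fun _ => 1)
    (g := fun y => ‖A.loc i u y‖) (Eventually.of_forall fun _ => zero_le_one)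
    (Eventually.of_forall fun _ => norm_nonneg _) (memLp_const 1)
    (by simpa using (hm.restrict (A.piece i)).norm)
  rw [h1]
  refine h2.trans ?_
  rw [mul_assoc]
  refine mul_le_mul ?_ ?_ (by positivity) (by positivity)
  · simp [Real.sqrt_eq_rpow]
  · rw [← Real.sqrt_eq_rpow, ← Real.sqrt_sq (norm_nonneg u), ← Real.sqrt_mul (by positivity)]
    refine Real.sqrt_le_sqrt ?_
    simp only [Real.rpow_ofNat]
    calc ∫ y in A.piece i, ‖A.loc i u y‖ ^ 2
        = (∫⁻ y in A.piece i, ‖A.loc i u y‖ₑ ^ 2).toReal := by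
          rw [integral_eq_lintegral_of_nonneg_ae (Eventually.of_forall fun _ => sq_nonneg _)
            ((hm.restrict _).1.norm.pow 2)]
          congr 1
          refine lintegral_congr fun y => ?_
          rw [ENNReal.ofReal_pow (norm_nonneg _), ofReal_norm]
      _ ≤ κ * ‖u‖ ^ 2 := by
          refine ENNReal.toReal_le_of_le_ofReal (by positivity) ?_
          refine (setLIntegral_le_lintegral _ _).trans ?_
          have h3 := h.sobNormSq_zero_coe_le u
          rw [h.sobNormSq_zero_eq (Lp.memLp u)] at h3
          refine (Finset.single_le_sum (f := fun i => ∫⁻ y, ‖A.loc i u y‖ₑ ^ 2)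
            (fun _ _ => zero_le) (Finset.mem_univ i)).trans (h3.trans ?_)
          rw [ENNReal.ofReal_mul (by positivity), ENNReal.ofReal_coe_nnreal,
            ENNReal.ofReal_pow (norm_nonneg _), ofReal_norm]

theorem loc_coe_sub_ae (h : A.IsDensity μ κ J) (i : Fin A.card) (u v : Lp ℝ 2 μ) :
    A.loc i (u - v : Lp ℝ 2 μ) =ᵐ[volume] fun y => A.loc i u y - A.loc i v y := by
  rw [← A.loc_sub, A.loc_eq_indicator, A.loc_eq_indicator]
  have h1 := (ae_restrict_iff' (A.measurableSet_piece i)).1 (h.ae_comp i (Lp.coeFn_sub u v))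
  filter_upwards [h1] with y hy
  by_cases hyp : y ∈ A.piece i
  · rw [indicator_of_mem hyp, indicator_of_mem hyp, hy hyp]; rfl
  · rw [indicator_of_notMem hyp, indicator_of_notMem hyp]

theorem sobNormSq_le_of_tendsto (h : A.IsDensity μ κ J) (s : ℝ) {u : ℕ → Lp ℝ 2 μ} {v : Lp ℝ 2 μ}
    (hu : Tendsto u atTop (𝓝 v)) {C : ℝ≥0∞} (hC : ∀ᶠ n in atTop, A.sobNormSq s (u n) ≤ C) :
    A.sobNormSq s v ≤ C := by
  have h1 := sum_fourierSobNormSq_le_of_tendsto s (k := fun n i => A.loc i (u n))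
    (l := fun i => A.loc i v) (fun n i => h.integrable_loc i (Lp.memLp _))
    (fun i => h.integrable_loc i (Lp.memLp _)) (fun i => ?_)
  · rw [sobNormSq_eq]
    refine h1.trans ?_
    refine (liminf_le_liminf hC).trans ?_
    simp
  · obtain ⟨D, hD⟩ := h.integral_abs_loc_le i
    have h2 : Tendsto (fun n => D * ‖u n - v‖) atTop (𝓝 0) := by
      simpa using (tendsto_iff_norm_sub_tendsto_zero.1 hu).const_mul D
    refine squeeze_zero (fun n => by positivity) (fun n => ?_) h2
    refine le_trans (le_of_eq ?_) (hD (u n - v))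
    refine integral_congr_ae ?_
    filter_upwards [h.loc_coe_sub_ae i (u n) v] with y hy
    rw [hy]

theorem isClosedNorm (h : A.IsDensity μ κ J) (s : ℝ) :
    IsClosedNorm (h.sobolevSpace s) (fun u : Lp ℝ 2 μ => A.nrm s u) where
  nonneg u := A.nrm_nonneg s u
  closed u x C hu huC hx := by
    have hC : 0 ≤ C := (A.nrm_nonneg s (u 0)).trans (huC 0)
    refine (sobNormSq_le_ofReal_iff hC).1 (h.sobNormSq_le_of_tendsto s hx ?_)
    exact Eventually.of_forall fun n => (sobNormSq_le_ofReal_iff hC).2 ⟨hu n, huC n⟩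

theorem nrm_half_sq_le (h : A.IsDensity μ κ J) {u v : Lp ℝ 2 μ} (hu : A.MemSob 1 u)
    (hv : A.MemSob 1 v) {δ : ℝ} (hδ : 0 < δ) :
    A.nrm (1 / 2) u ^ 2 ≤ A.nrm (1 / 2) v ^ 2 + δ⁻¹ * (κ * ‖u - v‖ ^ 2) +
      δ * (A.nrm 1 u ^ 2 + A.nrm 1 v ^ 2) := by
  have hz : ∀ i, fourierSobNormSq 0 (fun y => A.loc i u y - A.loc i v y) =
      fourierSobNormSq 0 (A.loc i (u - v : Lp ℝ 2 μ)) := fun i =>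
    (fourierSobNormSq_congr 0 (h.loc_coe_sub_ae i u v)).symm
  have h1 : A.sobNormSq (1 / 2) u ≤ A.sobNormSq (1 / 2) v +
      ENNReal.ofReal δ⁻¹ * A.sobNormSq 0 (u - v : Lp ℝ 2 μ) +
      ENNReal.ofReal δ * (A.sobNormSq 1 u + A.sobNormSq 1 v) := by
    simp only [sobNormSq_eq]
    rw [Finset.mul_sum, ← Finset.sum_add_distrib, ← Finset.sum_add_distrib, Finset.mul_sum,
      ← Finset.sum_add_distrib]
    refine Finset.sum_le_sum fun i _ => ?_
    rw [← hz]
    exact fourierSobNormSq_interp (h.integrable_loc i (Lp.memLp u))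
      (h.integrable_loc i (Lp.memLp v)) hδ
  have hh : (1 / 2 : ℝ) ≤ 1 := by norm_num
  have h2 := h.nrm_zero_sq_le (u - v)
  rw [sobNormSq_eq_ofReal (hu.mono hh), sobNormSq_eq_ofReal (hv.mono hh),
    sobNormSq_eq_ofReal hu, sobNormSq_eq_ofReal hv, sobNormSq_eq_ofReal (h.memSob_zero _),
    ← ENNReal.ofReal_add (by positivity) (by positivity), ← ENNReal.ofReal_mul (by positivity),
    ← ENNReal.ofReal_mul (by positivity), ← ENNReal.ofReal_add (by positivity) (by positivity),
    ← ENNReal.ofReal_add (by positivity) (by positivity),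
    ENNReal.ofReal_le_ofReal_iff (by positivity)] at h1
  have h3 := mul_le_mul_of_nonneg_left h2 (inv_nonneg.2 hδ.le)
  linarith

end IsDensity

end SobolevAtlas

end SobolevSpace

/-! ### Change of charts for compactly supported functions. -/

section Localization

open Filter Topology

variable {d : ℕ} {N : Type*} [TopologicalSpace N] [ChartedSpace (EuclideanSpace ℝ (Fin d)) N]

local notation "𝔼" => EuclideanSpace ℝ (Fin d)

namespace SobolevAtlas

theorem contMDiffOn_chart (A : SobolevAtlas d N) (i : Fin A.card) :
    ContMDiffOn (𝓡 d) (𝓡 d) 1 (A.chart i) (A.chart i).source :=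
  (contMDiffOn_of_mem_maximalAtlas (A.chart_mem i)).of_le one_le_two

theorem contMDiffOn_chart_symm (A : SobolevAtlas d N) (i : Fin A.card) :
    ContMDiffOn (𝓡 d) (𝓡 d) 1 (A.chart i).symm (A.chart i).target :=
  (contMDiffOn_symm_of_mem_maximalAtlas (A.chart_mem i)).of_le one_le_two

theorem contDiffOn_comp_symm (A : SobolevAtlas d N) (i : Fin A.card) {u : N → ℝ}
    (hu : ContMDiff (𝓡 d) 𝓘(ℝ, ℝ) 1 u) :
    ContDiffOn ℝ 1 (fun y => u ((A.chart i).symm y)) (A.chart i).target :=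
  (hu.comp_contMDiffOn (A.contMDiffOn_chart_symm i)).contDiffOn

theorem support_loc_subset (A : SobolevAtlas d N) (i : Fin A.card) (u : N → ℝ) :
    Function.support (A.loc i u) ⊆ A.piece i := by
  rw [A.loc_eq_indicator]
  exact support_indicator_subset

theorem contDiff_loc [CompactSpace N] (A : SobolevAtlas d N) (i : Fin A.card) {u : N → ℝ}
    (hu : ContMDiff (𝓡 d) 𝓘(ℝ, ℝ) 1 u) : ContDiff ℝ 1 (A.loc i u) := by
  rw [contDiff_iff_contDiffAt]
  intro y
  by_cases hy : y ∈ A.piece i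
  · have hyt := A.piece_subset_target i hy
    have hn := (A.chart i).open_target.mem_nhds hyt
    have h1 := ((A.contDiffOn_comp_symm i ((A.psi_contMDiff i).of_le one_le_two)).mul
      (A.contDiffOn_comp_symm i hu)).contDiffAt hn
    refine h1.congr_of_eventuallyEq ?_
    filter_upwards [hn] with z hz
    rw [loc, indicator_of_mem hz]
  · have h1 : A.loc i u =ᶠ[𝓝 y] fun _ => 0 := by
      filter_upwards [(A.isCompact_piece i).isClosed.isOpen_compl.mem_nhds hy] with z hz
      exact Function.notMem_support.1 fun h => hz (A.support_loc_subset i u h)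
    exact contDiffAt_const.congr_of_eventuallyEq h1

theorem hasCompactSupport_loc [CompactSpace N] (A : SobolevAtlas d N) (i : Fin A.card)
    (u : N → ℝ) : HasCompactSupport (A.loc i u) :=
  (A.isCompact_piece i).of_isClosed_subset (isClosed_tsupport _)
    (closure_minimal (A.support_loc_subset i u) (A.isCompact_piece i).isClosed)

theorem memSob_one_of_contMDiff [CompactSpace N] (A : SobolevAtlas d N) {u : N → ℝ}
    (hu : ContMDiff (𝓡 d) 𝓘(ℝ, ℝ) 1 u) : A.MemSob 1 u := by
  rw [MemSob, sobNormSq_eq]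
  exact ENNReal.sum_lt_top.2 fun i _ =>
    fourierSobNormSq_one_lt_top (A.contDiff_loc i hu) (A.hasCompactSupport_loc i u)

/-- The function `k ∘ φ_i`, extended by zero outside the domain of `φ_i`. -/
noncomputable def pull (A : SobolevAtlas d N) (i : Fin A.card) (k : 𝔼 → ℝ) : N → ℝ :=
  (A.chart i).source.indicator (fun x => k (A.chart i x))

theorem pull_sub (A : SobolevAtlas d N) (i : Fin A.card) (k l : 𝔼 → ℝ) :
    A.pull i (fun y => k y - l y) = fun x => A.pull i k x - A.pull i l x := by
  ext x
  simp only [pull, indicator]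
  split_ifs <;> ring

theorem pull_loc (A : SobolevAtlas d N) (i : Fin A.card) (u : N → ℝ) :
    A.pull i (A.loc i u) = fun x => A.psi i x * u x := by
  ext x
  by_cases hx : x ∈ (A.chart i).source
  · rw [pull, indicator_of_mem hx, loc, indicator_of_mem ((A.chart i).map_source hx),
      (A.chart i).left_inv hx]
  · rw [pull, indicator_of_notMem hx,
      image_eq_zero_of_notMem_tsupport fun h => hx (A.psi_tsupport i h), zero_mul]

theorem contMDiff_pull [T2Space N] (A : SobolevAtlas d N) (i : Fin A.card) {k : 𝔼 → ℝ}
    (hk : ContDiff ℝ 1 k) {Q : Set 𝔼} (hQ : IsCompact Q) (hQt : Q ⊆ (A.chart i).target)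
    (hkQ : Function.support k ⊆ Q) : ContMDiff (𝓡 d) 𝓘(ℝ, ℝ) 1 (A.pull i k) := by
  intro x
  by_cases hx : x ∈ (A.chart i).source
  · have hn := (A.chart i).open_source.mem_nhds hx
    have h1 : ContMDiffAt (𝓡 d) 𝓘(ℝ, ℝ) 1 (fun x => k (A.chart i x)) x :=
      (hk.contMDiff.comp_contMDiffOn (A.contMDiffOn_chart i)).contMDiffAt hn
    refine h1.congr_of_eventuallyEq ?_
    filter_upwards [hn] with z hz
    rw [pull, indicator_of_mem hz]
  · have hc : IsClosed ((A.chart i).symm '' Q) :=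
      (hQ.image_of_continuousOn ((A.chart i).continuousOn_symm.mono hQt)).isClosed
    have hxQ : x ∉ (A.chart i).symm '' Q := by
      rintro ⟨y, hy, rfl⟩
      exact hx ((A.chart i).map_target (hQt hy))
    have h1 : A.pull i k =ᶠ[𝓝 x] fun _ => 0 := by
      filter_upwards [hc.isOpen_compl.mem_nhds hxQ] with z hz
      by_cases hzs : z ∈ (A.chart i).source
      · rw [pull, indicator_of_mem hzs]
        exact Function.notMem_support.1 fun h => hz ⟨_, hkQ h, (A.chart i).left_inv hzs⟩
      · rw [pull, indicator_of_notMem hzs]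
    exact contMDiffAt_const.congr_of_eventuallyEq h1

/-- The change of coordinates from the `i`-th to the `j`-th chart. -/
noncomputable def transition (A : SobolevAtlas d N) (i j : Fin A.card) :
    OpenPartialHomeomorph 𝔼 𝔼 := (A.chart i).symm.trans (A.chart j)

theorem contDiffOn_transition (A : SobolevAtlas d N) (i j : Fin A.card) :
    ContDiffOn ℝ 1 (A.transition i j) (A.transition i j).source := by
  have h1 : ContMDiffOn (𝓡 d) (𝓡 d) 1 (A.chart j ∘ (A.chart i).symm)
      ((A.chart i).target ∩ (A.chart i).symm ⁻¹' (A.chart j).source) :=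
    (A.contMDiffOn_chart j).comp' (A.contMDiffOn_chart_symm i)
  refine ContMDiffOn.contDiffOn ?_
  rwa [transition, OpenPartialHomeomorph.trans_source]

theorem transition_symm (A : SobolevAtlas d N) (i j : Fin A.card) :
    (A.transition i j).symm = A.transition j i := by
  simp [transition, OpenPartialHomeomorph.trans_symm_eq_symm_trans_symm]

/-- The part of `Q` that the `i`-th chart maps to the support of the `j`-th function of the
partition. -/
def overlap (A : SobolevAtlas d N) (i j : Fin A.card) (Q : Set 𝔼) : Set 𝔼 :=
  Q ∩ (A.chart i).symm ⁻¹' tsupport (A.psi j)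

theorem isCompact_overlap (A : SobolevAtlas d N) (i j : Fin A.card) {Q : Set 𝔼}
    (hQ : IsCompact Q) (hQt : Q ⊆ (A.chart i).target) : IsCompact (A.overlap i j Q) :=
  hQ.of_isClosed_subset (((A.chart i).continuousOn_symm.mono hQt).preimage_isClosed_of_isClosed
    hQ.isClosed (isClosed_tsupport _)) inter_subset_left

theorem overlap_subset (A : SobolevAtlas d N) (i j : Fin A.card) {Q : Set 𝔼}
    (hQt : Q ⊆ (A.chart i).target) : A.overlap i j Q ⊆ (A.transition i j).source := by
  rintro y ⟨hy, hy'⟩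
  rw [transition, OpenPartialHomeomorph.trans_source]
  exact ⟨hQt hy, A.psi_tsupport j hy'⟩

theorem support_loc_pull_subset (A : SobolevAtlas d N) (i j : Fin A.card) {Q : Set 𝔼}
    {k : 𝔼 → ℝ} (hkQ : Function.support k ⊆ Q) :
    Function.support (A.loc j (A.pull i k)) ⊆ A.transition i j '' A.overlap i j Q := by
  intro y hy
  rw [Function.mem_support, loc, indicator_apply_ne_zero] at hy
  obtain ⟨hyt, hy⟩ := hy
  rw [Function.mem_support] at hy
  have h1 := left_ne_zero_of_mul hy
  have h2 := right_ne_zero_of_mul hy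
  rw [pull, indicator_apply_ne_zero] at h2
  obtain ⟨hys, h2⟩ := h2
  refine ⟨A.chart i ((A.chart j).symm y), ⟨hkQ h2, ?_⟩, ?_⟩
  · rw [mem_preimage, (A.chart i).left_inv hys]
    exact subset_tsupport _ h1
  · simp [transition, (A.chart i).left_inv hys, (A.chart j).right_inv hyt]

theorem loc_pull_eq (A : SobolevAtlas d N) (i j : Fin A.card) (k : 𝔼 → ℝ) {y : 𝔼}
    (hy : y ∈ (A.transition j i).source) :
    A.loc j (A.pull i k) y = A.psi j ((A.chart j).symm y) * k (A.transition j i y) := by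
  rw [transition, OpenPartialHomeomorph.trans_source] at hy
  rw [loc, indicator_of_mem (show y ∈ (A.chart j).target from hy.1), pull,
    indicator_of_mem (show (A.chart j).symm y ∈ (A.chart i).source from hy.2)]
  rfl

theorem image_overlap_subset (A : SobolevAtlas d N) (i j : Fin A.card) {Q : Set 𝔼}
    (hQt : Q ⊆ (A.chart i).target) :
    A.transition i j '' A.overlap i j Q ⊆ (A.transition j i).source := by
  rintro _ ⟨x, hx, rfl⟩
  rw [← A.transition_symm i j]
  exact (A.transition i j).map_source (A.overlap_subset i j hQt hx)

/-- Change of variables; the Jacobian determinant of the `C¹` transition map is bounded on the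
compact overlap. -/
theorem exists_setLIntegral_transition_le (A : SobolevAtlas d N) (i j : Fin A.card) {Q : Set 𝔼}
    (hQ : IsCompact Q) (hQt : Q ⊆ (A.chart i).target) :
    ∃ C : ℝ≥0, ∀ F : 𝔼 → ℝ≥0∞,
      ∫⁻ y in A.transition i j '' A.overlap i j Q, F (A.transition j i y) ≤ C * ∫⁻ x, F x := by
  set σ := A.transition i j with hσ
  have hc := A.isCompact_overlap i j hQ hQt
  have hs := A.overlap_subset i j hQt
  have hdet : ContinuousOn (fun x => (fderiv ℝ σ x).det) (A.overlap i j Q) :=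
    ContinuousLinearMap.continuous_det.comp_continuousOn
      (((A.contDiffOn_transition i j).continuousOn_fderiv_of_isOpen σ.open_source le_rfl).mono hs)
  obtain ⟨C, hC⟩ := hc.exists_bound_of_continuousOn hdet
  refine ⟨C.toNNReal, fun F => ?_⟩
  have hd : ∀ x ∈ A.overlap i j Q, HasFDerivWithinAt σ (fderiv ℝ σ x) (A.overlap i j Q) x :=
    fun x hx => ((((A.contDiffOn_transition i j).differentiableOn one_ne_zero).differentiableAt
      (σ.open_source.mem_nhds (hs hx))).hasFDerivAt).hasFDerivWithinAt
  rw [lintegral_image_eq_lintegral_abs_det_fderiv_mul volume hc.isClosed.measurableSet hd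
    (σ.injOn.mono hs)]
  calc _ ≤ ∫⁻ x in A.overlap i j Q, C.toNNReal * F x := by
        refine setLIntegral_mono' hc.isClosed.measurableSet fun x hx => ?_
        rw [← A.transition_symm i j, ← hσ, σ.left_inv (hs hx)]
        gcongr
        exact ENNReal.ofReal_le_ofReal (hC x hx)
    _ ≤ ∫⁻ x, C.toNNReal * F x := setLIntegral_le_lintegral _ _
    _ = _ := lintegral_const_mul' _ _ ENNReal.coe_ne_top

theorem exists_lintegral_loc_pull_le (A : SobolevAtlas d N) (i j : Fin A.card) {Q : Set 𝔼}
    (hQ : IsCompact Q) (hQt : Q ⊆ (A.chart i).target) :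
    ∃ C : ℝ≥0, ∀ k : 𝔼 → ℝ, Function.support k ⊆ Q →
      ∫⁻ y, ‖A.loc j (A.pull i k) y‖ₑ ^ 2 ≤ C * ∫⁻ x, ‖k x‖ₑ ^ 2 := by
  obtain ⟨C, hC⟩ := A.exists_setLIntegral_transition_le i j hQ hQt
  refine ⟨C, fun k hk => ?_⟩
  have hc := ((A.isCompact_overlap i j hQ hQt).image_of_continuousOn
    ((A.transition i j).continuousOn.mono (A.overlap_subset i j hQt)))
  refine le_trans ?_ (hC fun x => ‖k x‖ₑ ^ 2)
  rw [← setLIntegral_eq_of_support_subset (s := A.transition i j '' A.overlap i j Q)]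
  · refine setLIntegral_mono' hc.isClosed.measurableSet fun y hy => ?_
    rw [A.loc_pull_eq i j k (A.image_overlap_subset i j hQt hy), enorm_mul]
    gcongr
    refine mul_le_of_le_one_left' ?_
    rw [← ofReal_norm, Real.norm_of_nonneg (A.psi_nonneg j _), ← ENNReal.ofReal_one]
    exact ENNReal.ofReal_le_ofReal (A.psi_le_one j _)
  · intro y hy
    refine A.support_loc_pull_subset i j hk ?_
    rw [Function.mem_support] at hy ⊢
    intro h0
    simp [h0] at hy

/-- Product and chain rule on the compact overlap, where the derivatives of the cutoff and of the
transition map are bounded by `a` and `b`. -/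
theorem exists_lintegral_fderiv_loc_pull_le [T2Space N] [CompactSpace N] (A : SobolevAtlas d N)
    (i j : Fin A.card) {Q : Set 𝔼} (hQ : IsCompact Q) (hQt : Q ⊆ (A.chart i).target) :
    ∃ C : ℝ≥0, ∀ k : 𝔼 → ℝ, ContDiff ℝ 1 k → Function.support k ⊆ Q →
      ∫⁻ y, ‖fderiv ℝ (A.loc j (A.pull i k)) y‖ₑ ^ 2 ≤
        C * ((∫⁻ x, ‖k x‖ₑ ^ 2) + ∫⁻ x, ‖fderiv ℝ k x‖ₑ ^ 2) := by
  obtain ⟨C, hC⟩ := A.exists_setLIntegral_transition_le i j hQ hQt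
  set s := A.transition i j '' A.overlap i j Q with hs
  set τ := A.transition j i with hτ
  let m : 𝔼 → ℝ := fun y => A.psi j ((A.chart j).symm y)
  have hc : IsCompact s := ((A.isCompact_overlap i j hQ hQt).image_of_continuousOn
    ((A.transition i j).continuousOn.mono (A.overlap_subset i j hQt)))
  have hsτ : s ⊆ τ.source := A.image_overlap_subset i j hQt
  have hst : τ.source ⊆ (A.chart j).target := by
    rw [hτ, transition, OpenPartialHomeomorph.trans_source]
    exact inter_subset_left
  have hm : ContDiffOn ℝ 1 m τ.source :=
    (A.contDiffOn_comp_symm j ((A.psi_contMDiff j).of_le one_le_two)).mono hst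
  have hτc : ContDiffOn ℝ 1 τ τ.source := A.contDiffOn_transition j i
  obtain ⟨a, ha⟩ := hc.exists_bound_of_continuousOn
    ((hm.continuousOn_fderiv_of_isOpen τ.open_source le_rfl).mono hsτ)
  obtain ⟨b, hb⟩ := hc.exists_bound_of_continuousOn
    ((hτc.continuousOn_fderiv_of_isOpen τ.open_source le_rfl).mono hsτ)
  refine ⟨(2 * (a ^ 2 + b ^ 2)).toNNReal * C, fun k hk hkQ => ?_⟩
  have hsupp : Function.support (fun y => ‖fderiv ℝ (A.loc j (A.pull i k)) y‖ₑ ^ 2) ⊆ s := by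
    intro y hy
    by_contra hys
    have h1 : A.loc j (A.pull i k) =ᶠ[𝓝 y] fun _ => 0 := by
      filter_upwards [hc.isClosed.isOpen_compl.mem_nhds hys] with z hz
      exact Function.notMem_support.1 fun h => hz (A.support_loc_pull_subset i j hkQ h)
    rw [Function.mem_support, h1.fderiv_eq] at hy
    refine hy ?_
    rw [fderiv_const_apply, ← ofReal_norm, norm_zero]
    simp
  rw [← setLIntegral_eq_of_support_subset hsupp]
  have hpt : ∀ y ∈ s, ‖fderiv ℝ (A.loc j (A.pull i k)) y‖ₑ ^ 2 ≤
      (2 * (a ^ 2 + b ^ 2)).toNNReal * (‖k (τ y)‖ₑ ^ 2 + ‖fderiv ℝ k (τ y)‖ₑ ^ 2) := by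
    intro y hy
    have hn := τ.open_source.mem_nhds (hsτ hy)
    have h1 : A.loc j (A.pull i k) =ᶠ[𝓝 y] fun z => m z * k (τ z) := by
      filter_upwards [hn] with z hz
      exact A.loc_pull_eq i j k hz
    have hdm : HasFDerivAt m (fderiv ℝ m y) y :=
      ((hm.differentiableOn one_ne_zero).differentiableAt hn).hasFDerivAt
    have hdτ : HasFDerivAt τ (fderiv ℝ τ y) y :=
      ((hτc.differentiableOn one_ne_zero).differentiableAt hn).hasFDerivAt
    have hdk : HasFDerivAt k (fderiv ℝ k (τ y)) (τ y) :=
      (hk.differentiable one_ne_zero _).hasFDerivAt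
    have hd : HasFDerivAt (fun z => m z * k (τ z))
        (m y • (fderiv ℝ k (τ y)).comp (fderiv ℝ τ y) + k (τ y) • fderiv ℝ m y) y :=
      hdm.mul (hdk.comp y hdτ)
    rw [h1.fderiv_eq, hd.fderiv]
    have hmy : ‖m y‖ ≤ 1 := by
      rw [Real.norm_of_nonneg (A.psi_nonneg j _)]
      exact A.psi_le_one j _
    have h2 : ‖m y • (fderiv ℝ k (τ y)).comp (fderiv ℝ τ y) + k (τ y) • fderiv ℝ m y‖ ^ 2 ≤
        2 * (a ^ 2 + b ^ 2) * (‖k (τ y)‖ ^ 2 + ‖fderiv ℝ k (τ y)‖ ^ 2) := by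
      have h3 : ‖m y • (fderiv ℝ k (τ y)).comp (fderiv ℝ τ y) + k (τ y) • fderiv ℝ m y‖ ≤
          ‖fderiv ℝ k (τ y)‖ * b + ‖k (τ y)‖ * a := by
        refine (norm_add_le _ _).trans (add_le_add ?_ ?_)
        · rw [norm_smul]
          calc _ ≤ 1 * (‖fderiv ℝ k (τ y)‖ * ‖fderiv ℝ τ y‖) := by
                gcongr; exact ContinuousLinearMap.opNorm_comp_le _ _
            _ ≤ _ := by rw [one_mul]; gcongr; exact hb y hy
        · rw [norm_smul]; gcongr; exact ha y hy
      have h4 := pow_le_pow_left₀ (norm_nonneg _) h3 2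
      have h5 : 0 ≤ (‖fderiv ℝ k (τ y)‖ * b - ‖k (τ y)‖ * a) ^ 2 := sq_nonneg _
      have h6 : 0 ≤ ‖fderiv ℝ k (τ y)‖ ^ 2 * a ^ 2 + ‖k (τ y)‖ ^ 2 * b ^ 2 := by positivity
      nlinarith
    have h3 := ENNReal.ofReal_le_ofReal h2
    rw [ENNReal.ofReal_mul (by positivity), ENNReal.ofReal_add (by positivity) (by positivity),
      ENNReal.ofReal_pow (norm_nonneg _), ENNReal.ofReal_pow (norm_nonneg _),
      ENNReal.ofReal_pow (norm_nonneg _), ofReal_norm, ofReal_norm, ofReal_norm] at h3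
    exact h3
  calc _ ≤ ∫⁻ y in s, (2 * (a ^ 2 + b ^ 2)).toNNReal *
          (‖k (τ y)‖ₑ ^ 2 + ‖fderiv ℝ k (τ y)‖ₑ ^ 2) :=
        setLIntegral_mono' hc.isClosed.measurableSet hpt
    _ ≤ C * ∫⁻ x, (2 * (a ^ 2 + b ^ 2)).toNNReal * (‖k x‖ₑ ^ 2 + ‖fderiv ℝ k x‖ₑ ^ 2) :=
        hC fun x => (2 * (a ^ 2 + b ^ 2)).toNNReal * (‖k x‖ₑ ^ 2 + ‖fderiv ℝ k x‖ₑ ^ 2)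
    _ = _ := by
        rw [lintegral_const_mul' _ _ ENNReal.coe_ne_top, lintegral_add_left
          (hk.continuous.measurable.enorm.pow_const 2), ENNReal.coe_mul]
        ring

/-- For compactly supported `C¹` functions Plancherel identifies the `H¹` norm with an `L²` norm of
function and gradient, and these transform locally under a change of chart. -/
theorem exists_sobNormSq_pull_le [T2Space N] [CompactSpace N] (A : SobolevAtlas d N)
    (i : Fin A.card) {Q : Set 𝔼} (hQ : IsCompact Q) (hQt : Q ⊆ (A.chart i).target) :
    ∃ C : ℝ≥0, ∀ k : 𝔼 → ℝ, ContDiff ℝ 1 k → Function.support k ⊆ Q →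
      A.sobNormSq 1 (A.pull i k) ≤ C * fourierSobNormSq 1 k := by
  choose C hC using fun j => A.exists_lintegral_loc_pull_le i j hQ hQt
  choose D hD using fun j => A.exists_lintegral_fderiv_loc_pull_le i j hQ hQt
  refine ⟨∑ j, (C j + d * (D j * (1 + d))), fun k hk hkQ => ?_⟩
  have hkc : HasCompactSupport k := hQ.of_isClosed_subset (isClosed_tsupport _)
    (closure_minimal hkQ hQ.isClosed)
  have h0 : ∫⁻ x, ‖k x‖ₑ ^ 2 ≤ fourierSobNormSq 1 k := by
    rw [fourierSobNormSq_one hk hkc]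
    exact le_self_add
  rw [sobNormSq_eq, ENNReal.ofNNReal_finsetSum, Finset.sum_mul]
  refine Finset.sum_le_sum fun j _ => ?_
  have hp := A.contMDiff_pull i hk hQ hQt hkQ
  refine (fourierSobNormSq_one_le (A.contDiff_loc j hp) (A.hasCompactSupport_loc j _)).trans ?_
  calc _ ≤ C j * (∫⁻ x, ‖k x‖ₑ ^ 2) +
          d * (D j * ((∫⁻ x, ‖k x‖ₑ ^ 2) + ∫⁻ x, ‖fderiv ℝ k x‖ₑ ^ 2)) := by
        gcongr
        · exact hC j k hkQ
        · exact hD j k hk hkQ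
    _ ≤ C j * fourierSobNormSq 1 k +
          d * (D j * (fourierSobNormSq 1 k + d * fourierSobNormSq 1 k)) := by
        gcongr
        exact lintegral_fderiv_sq_le hk hkc
    _ = _ := by push_cast; ring

end SobolevAtlas

end Localization

/-! ### Density of `C¹` functions in `H¹`. -/

section Density

open Filter Topology

variable {d : ℕ} {N : Type*} [TopologicalSpace N] [ChartedSpace (EuclideanSpace ℝ (Fin d)) N]

namespace SobolevAtlas

namespace IsDensity

variable [MeasurableSpace N] {A : SobolevAtlas d N} {μ : Measure N} {κ : ℝ≥0}
  {J : Fin A.card → EuclideanSpace ℝ (Fin d) → ℝ} [BorelSpace N]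

theorem memLp_psi_mul (A : SobolevAtlas d N) (i : Fin A.card) {u : N → ℝ} (hu : MemLp u 2 μ) :
    MemLp (fun x => A.psi i x * u x) 2 μ := by
  refine hu.of_le ((continuous_psi A i).aestronglyMeasurable.mul hu.1)
    (Eventually.of_forall fun x => ?_)
  rw [norm_mul, Real.norm_of_nonneg (A.psi_nonneg i x)]
  exact mul_le_of_le_one_left (norm_nonneg _) (A.psi_le_one i x)

variable [CompactSpace N]

theorem memLp_of_continuous (h : A.IsDensity μ κ J) {u : N → ℝ} (hu : Continuous u) :
    MemLp u 2 μ := by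
  have := h.isFiniteMeasure
  exact hu.memLp_of_hasCompactSupport (HasCompactSupport.of_compactSpace u)

variable [T2Space N]

/-- The localized function is mollified in its chart and pulled back. The chart-change estimate is
available only for `C¹` functions, so the error is estimated between two mollifications; the finer
one then tends to `ψ_i u` in `L²`, and lower semicontinuity of the norm transfers the bound. -/
theorem exists_contMDiff_near_psi_mul (h : A.IsDensity μ κ J) (i : Fin A.card) {u : N → ℝ}
    (hu : MemLp u 2 μ) (hu1 : fourierSobNormSq 1 (A.loc i u) < ⊤) {ε : ℝ≥0∞} (hε : ε ≠ 0) :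
    ∃ v : N → ℝ, ContMDiff (𝓡 d) 𝓘(ℝ, ℝ) 1 v ∧
      A.sobNormSq 1 (fun x => A.psi i x * u x - v x) ≤ ε := by
  set k := A.loc i u with hk
  have hki : Integrable k := h.integrable_loc i hu
  have hk2 : MemLp k 2 := h.memLp_loc i hu
  obtain ⟨l, hl2, hli, hls, hlt⟩ := exists_mollification hki
  obtain ⟨δ, hδ, hδt⟩ := (A.isCompact_piece i).exists_cthickening_subset_open
    (A.chart i).open_target (A.piece_subset_target i)
  set Q := Metric.cthickening δ (A.piece i) with hQdef
  have hQ : IsCompact Q := (A.isCompact_piece i).cthickening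
  have hlQ : ∀ᶠ n in atTop, Function.support (l n) ⊆ Q := by
    filter_upwards [tendsto_one_div_add_atTop_nhds_zero_nat.eventually_le_const hδ] with n hn
    exact (hls n).trans ((Metric.cthickening_mono hn _).trans
      (Metric.cthickening_subset_of_subset _ (A.support_loc_subset i u)))
  have hkQ : Function.support k ⊆ Q :=
    (A.support_loc_subset i u).trans (Metric.self_subset_cthickening _)
  obtain ⟨C, hC⟩ := A.exists_sobNormSq_pull_le i hQ hδt
  choose E hE using fun j => A.exists_lintegral_loc_pull_le i j hQ hδt
  have hC1 : (4 * (C + 1 : ℝ≥0∞)) ≠ ⊤ := ENNReal.mul_ne_top (by norm_num) (by simp)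
  have hC0 : (4 * (C + 1 : ℝ≥0∞)) ≠ 0 := by simp
  -- The factor `4` pays for the quadratic triangle inequality between two mollifications; `C + 1`
  -- avoids dividing by zero.
  have hη : (0 : ℝ≥0∞) < ε / (4 * (C + 1)) := ENNReal.div_pos hε hC1
  have hl1 : ∀ n, ContDiff ℝ 1 (l n) := fun n => (hl2 n).of_le one_le_two
  obtain ⟨n, hn⟩ := eventually_atTop.1 (hlQ.and ((hlt 1 hu1).eventually_le_const hη))
  have hw : ∀ m ≥ n, ContMDiff (𝓡 d) 𝓘(ℝ, ℝ) 1 (A.pull i (l m)) := fun m hm =>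
    A.contMDiff_pull i (hl1 m) hQ hδt (hn m hm).1
  have hwL : ∀ m ≥ n, MemLp (A.pull i (l m)) 2 μ := fun m hm =>
    h.memLp_of_continuous (hw m hm).continuous
  have hpu : A.pull i k = fun x => A.psi i x * u x := A.pull_loc i u
  have hψu : MemLp (A.pull i k) 2 μ := by rw [hpu]; exact memLp_psi_mul A i hu
  refine ⟨A.pull i (l n), hw n le_rfl, ?_⟩
  have hbound : ∀ m ≥ n, A.sobNormSq 1 (fun x => A.pull i (l m) x - A.pull i (l n) x) ≤ ε := by
    intro m hm
    rw [← A.pull_sub]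
    have hsub : Function.support (fun y => l m y - l n y) ⊆ Q :=
      (Function.support_sub _ _).trans (union_subset (hn m hm).1 (hn n le_rfl).1)
    refine (hC _ ((hl1 m).sub (hl1 n)) hsub).trans ?_
    have h1 : (fun y => l m y - l n y) = fun y => (l m y - k y) + (-1) * (l n y - k y) := by
      ext y; ring
    have h2 : fourierSobNormSq 1 (fun y => l m y - l n y) ≤ 4 * (ε / (4 * (C + 1))) := by
      rw [h1]
      refine (fourierSobNormSq_add_le 1 ((hli m).sub hki) (((hli n).sub hki).const_mul (-1))).trans ?_
      rw [fourierSobNormSq_const_mul]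
      simp only [even_two, Even.neg_pow, one_pow, ENNReal.ofReal_one, one_mul]
      calc _ ≤ 2 * (ε / (4 * (C + 1))) + 2 * (ε / (4 * (C + 1))) := by
            gcongr
            · exact (hn m hm).2
            · exact (hn n le_rfl).2
        _ = _ := by rw [← add_mul]; norm_num
    calc C * fourierSobNormSq 1 (fun y => l m y - l n y)
        ≤ (C + 1) * (4 * (ε / (4 * (C + 1)))) := by gcongr; exact le_self_add
      _ = (4 * (C + 1)) * (ε / (4 * (C + 1))) := by ring
      _ ≤ ε := ENNReal.mul_div_le
  let U : ℕ → Lp ℝ 2 μ := fun m =>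
    ((hwL (m + n) (by omega)).sub (hwL n le_rfl)).toLp (A.pull i (l (m + n)) - A.pull i (l n))
  let W : Lp ℝ 2 μ := (hψu.sub (hwL n le_rfl)).toLp (A.pull i k - A.pull i (l n))
  have hU : ∀ m, A.sobNormSq 1 (U m) ≤ ε := fun m => by
    rw [h.sobNormSq_congr 1 (MemLp.coeFn_toLp _)]
    exact hbound (m + n) (by omega)
  have hlim : Tendsto U atTop (𝓝 W) := by
    rw [tendsto_iff_norm_sub_tendsto_zero]
    have h1 : Tendsto (fun m => A.card * κ * ((∑ j, (E j : ℝ≥0∞)) *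
        fourierSobNormSq 1 (fun y => l (m + n) y - k y))) atTop (𝓝 0) := by
      have := (ENNReal.Tendsto.const_mul (a := A.card * κ * ∑ j, (E j : ℝ≥0∞))
        ((tendsto_add_atTop_iff_nat n).2 (hlt 1 hu1)) (Or.inr ?_))
      · simpa [mul_assoc] using this
      · exact ENNReal.mul_ne_top (ENNReal.mul_ne_top (by simp) (by simp))
          (ENNReal.sum_ne_top.2 fun _ _ => ENNReal.coe_ne_top)
    have h2 : ∀ m, ‖U m - W‖ₑ ^ 2 ≤ A.card * κ * ((∑ j, (E j : ℝ≥0∞)) *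
        fourierSobNormSq 1 (fun y => l (m + n) y - k y)) := by
      intro m
      have hae : (U m - W : Lp ℝ 2 μ) =ᵐ[μ] A.pull i (fun y => l (m + n) y - k y) := by
        rw [A.pull_sub]
        filter_upwards [Lp.coeFn_sub (U m) W, MemLp.coeFn_toLp ((hwL (m + n) (by omega)).sub
          (hwL n le_rfl)), MemLp.coeFn_toLp (hψu.sub (hwL n le_rfl))] with x h3 h4 h5
        rw [h3, Pi.sub_apply, h4, h5, Pi.sub_apply, Pi.sub_apply]
        ring
      rw [← Lp.lintegral_enorm_sq]
      refine (h.le_sobNormSq_zero (Lp.memLp _)).trans ?_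
      gcongr
      rw [h.sobNormSq_congr 0 hae, h.sobNormSq_zero_eq ((memLp_congr_ae hae).1 (Lp.memLp _)),
        Finset.sum_mul]
      refine Finset.sum_le_sum fun j _ => ?_
      refine (hE j _ ((Function.support_sub _ _).trans
        (union_subset (hn (m + n) (by omega)).1 hkQ))).trans ?_
      gcongr
      have h6 : HasCompactSupport (l (m + n)) := hQ.of_isClosed_subset (isClosed_tsupport _)
        (closure_minimal (hn (m + n) (by omega)).1 hQ.isClosed)
      rw [← fourierSobNormSq_zero (k := fun y => l (m + n) y - k y) ((hli (m + n)).sub hki)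
        (((hl1 (m + n)).continuous.memLp_of_hasCompactSupport h6).sub hk2)]
      exact fourierSobNormSq_mono zero_le_one _
    have h3 : Tendsto (fun m => ‖U m - W‖ₑ ^ 2) atTop (𝓝 0) :=
      tendsto_of_tendsto_of_tendsto_of_le_of_le tendsto_const_nhds h1 (fun _ => zero_le) h2
    have h4 := (ENNReal.tendsto_toReal ENNReal.zero_ne_top).comp h3
    have h5 := (Real.continuous_sqrt.tendsto _).comp h4
    simpa [Function.comp_def, toReal_enorm] using h5
  have hfin := h.sobNormSq_le_of_tendsto 1 hlim (Eventually.of_forall hU)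
  rw [h.sobNormSq_congr 1 (MemLp.coeFn_toLp _)] at hfin
  refine le_trans (le_of_eq ?_) hfin
  congr 1
  ext x
  rw [Pi.sub_apply, hpu]

theorem exists_contMDiff_near (h : A.IsDensity μ κ J) {u : N → ℝ} (hu : MemLp u 2 μ)
    (hu1 : A.MemSob 1 u) {ε : ℝ≥0∞} (hε : ε ≠ 0) :
    ∃ v : N → ℝ, ContMDiff (𝓡 d) 𝓘(ℝ, ℝ) 1 v ∧ A.sobNormSq 1 (fun x => u x - v x) ≤ ε := by
  have key : ∀ s : Finset (Fin A.card), ∀ ε : ℝ≥0∞, ε ≠ 0 → ∃ v : N → ℝ,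
      ContMDiff (𝓡 d) 𝓘(ℝ, ℝ) 1 v ∧
        A.sobNormSq 1 (fun x => ∑ i ∈ s, A.psi i x * u x - v x) ≤ ε := by
    intro s
    induction s using Finset.induction_on with
    | empty =>
      intro ε hε
      refine ⟨fun _ => 0, contMDiff_const, ?_⟩
      have := A.sobNormSq_const_mul 1 0 (fun _ => 0)
      simp only [mul_zero, ne_eq, OfNat.ofNat_ne_zero, not_false_eq_true, zero_pow,
        ENNReal.ofReal_zero, zero_mul] at this
      simp [this]
    | insert i s his ih =>
      intro ε hε
      have hε4 : ε / 4 ≠ 0 := (ENNReal.div_pos hε (by norm_num)).ne'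
      obtain ⟨v, hv, hv'⟩ := ih (ε / 4) hε4
      obtain ⟨w, hw, hw'⟩ := h.exists_contMDiff_near_psi_mul i hu
        (lt_of_le_of_lt (Finset.single_le_sum (f := fun i => fourierSobNormSq 1 (A.loc i u))
          (fun _ _ => zero_le) (Finset.mem_univ i)) hu1) hε4
      refine ⟨fun x => w x + v x, hw.add hv, ?_⟩
      have h1 : (fun x => ∑ j ∈ insert i s, A.psi j x * u x - (w x + v x)) =
          fun x => (A.psi i x * u x - w x) + (∑ j ∈ s, A.psi j x * u x - v x) := by
        ext x
        rw [Finset.sum_insert his]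
        ring
      rw [h1]
      refine (h.sobNormSq_add_le 1 ((memLp_psi_mul A i hu).sub (h.memLp_of_continuous
        hw.continuous)) ((memLp_finsetSum s fun j _ => memLp_psi_mul A j hu).sub
          (h.memLp_of_continuous hv.continuous))).trans ?_
      calc _ ≤ 2 * (ε / 4) + 2 * (ε / 4) :=
            add_le_add (mul_le_mul' le_rfl hw') (mul_le_mul' le_rfl hv')
        _ = 4 * (ε / 4) := by rw [← add_mul]; norm_num
        _ ≤ ε := ENNReal.mul_div_le
  obtain ⟨v, hv, hv'⟩ := key Finset.univ ε hε
  refine ⟨v, hv, ?_⟩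
  simpa only [← Finset.sum_mul, A.psi_sum, one_mul] using hv'

theorem exists_contMDiff_seq (h : A.IsDensity μ κ J) {u : Lp ℝ 2 μ} (hu : A.MemSob 1 u) :
    ∃ (v : ℕ → N → ℝ) (U : ℕ → Lp ℝ 2 μ), (∀ n, ContMDiff (𝓡 d) 𝓘(ℝ, ℝ) 1 (v n)) ∧
      (∀ n, U n =ᵐ[μ] v n) ∧ (∀ n, A.MemSob 1 (U n)) ∧ (∀ n, A.MemSob 1 (u - U n : Lp ℝ 2 μ)) ∧
      Tendsto (fun n => A.nrm 1 (u - U n : Lp ℝ 2 μ)) atTop (𝓝 0) ∧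
      Tendsto U atTop (𝓝 u) := by
  have hpos : ∀ n : ℕ, ENNReal.ofReal ((1 / ((n : ℝ) + 1)) ^ 2) ≠ 0 := fun n => by
    rw [Ne, ENNReal.ofReal_eq_zero, not_le]
    positivity
  choose v hv hvu using fun n => h.exists_contMDiff_near (Lp.memLp u) hu (hpos n)
  have hvL := fun n => h.memLp_of_continuous (hv n).continuous
  have hae : ∀ n, (u - (hvL n).toLp (v n) : Lp ℝ 2 μ) =ᵐ[μ] fun x => u x - v n x := fun n => by
    filter_upwards [Lp.coeFn_sub u ((hvL n).toLp (v n)), (hvL n).coeFn_toLp] with x h1 h2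
    rw [h1, Pi.sub_apply, h2]
  have hle : ∀ n, A.sobNormSq 1 (u - (hvL n).toLp (v n) : Lp ℝ 2 μ) ≤
      ENNReal.ofReal ((1 / ((n : ℝ) + 1)) ^ 2) := fun n => by
    rw [h.sobNormSq_congr 1 (hae n)]
    exact hvu n
  have hn := fun n => (sobNormSq_le_ofReal_iff (by positivity)).1 (hle n)
  have hlim : Tendsto (fun n => A.nrm 1 (u - (hvL n).toLp (v n) : Lp ℝ 2 μ)) atTop (𝓝 0) :=
    squeeze_zero (fun n => A.nrm_nonneg _ _) (fun n => (hn n).2)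
      tendsto_one_div_add_atTop_nhds_zero_nat
  refine ⟨v, fun n => (hvL n).toLp (v n), hv, fun n => (hvL n).coeFn_toLp, fun n => ?_,
    fun n => (hn n).1, hlim, ?_⟩
  · rw [MemSob, h.sobNormSq_congr 1 (hvL n).coeFn_toLp]
    exact A.memSob_one_of_contMDiff (hv n)
  · rw [tendsto_iff_norm_sub_tendsto_zero]
    have h1 : Tendsto (fun n => Real.sqrt (A.card * κ *
        A.nrm 1 (u - (hvL n).toLp (v n) : Lp ℝ 2 μ) ^ 2)) atTop (𝓝 0) := by
      simpa using ((hlim.pow 2).const_mul (A.card * κ : ℝ)).sqrt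
    refine squeeze_zero (fun n => norm_nonneg _) (fun n => ?_) h1
    rw [norm_sub_rev]
    refine Real.le_sqrt_of_sq_le ((h.norm_sq_le _).trans ?_)
    gcongr
    · exact A.nrm_nonneg _ _
    · exact nrm_mono (hn n).1 zero_le_one

end IsDensity

end SobolevAtlas

end Density

/-! ### The weighted inner product as a continuous bilinear form. -/

section WeightedForm

open Filter Topology

variable {α : Type*} [MeasurableSpace α] {ν : Measure α} {ρ : α → ℝ} {K : ℝ≥0}

theorem MeasureTheory.Lp.integrable_mul (u v : Lp ℝ 2 ν) : Integrable (fun x => u x * v x) ν :=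
  (Lp.memLp u).integrable_mul (Lp.memLp v)

theorem MeasureTheory.Lp.integral_abs_mul_le (u v : Lp ℝ 2 ν) :
    ∫ x, |u x * v x| ∂ν ≤ ‖u‖ * ‖v‖ := by
  have h1 : inner ℝ |u| |v| = ∫ x, |u x * v x| ∂ν := by
    rw [L2.inner_def]
    refine integral_congr_ae ?_
    filter_upwards [Lp.coeFn_abs u, Lp.coeFn_abs v] with x h1 h2
    rw [h1, h2, abs_mul]
    simp [mul_comm]
  rw [← h1]
  refine (real_inner_le_norm _ _).trans (le_of_eq ?_)
  rw [norm_abs_eq_norm, norm_abs_eq_norm]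

theorem wip_integrable (hm : AEStronglyMeasurable ρ ν) (hρ : ∀ x, |ρ x| ≤ K) (u v : Lp ℝ 2 ν) :
    Integrable (fun x => u x * v x * ρ x) ν :=
  (Lp.integrable_mul u v).mul_bdd hm (Eventually.of_forall hρ)

theorem abs_wip_le (hm : AEStronglyMeasurable ρ ν) (hρ : ∀ x, |ρ x| ≤ K) (u v : Lp ℝ 2 ν) :
    |wip ν ρ u v| ≤ K * ‖u‖ * ‖v‖ := by
  have h1 : |wip ν ρ u v| ≤ ∫ x, K * |u x * v x| ∂ν := by
    refine (abs_integral_le_integral_abs).trans (integral_mono (wip_integrable hm hρ u v).abs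
      ((Lp.integrable_mul u v).abs.const_mul K) fun x => ?_)
    simp only
    rw [abs_mul, mul_comm]
    exact mul_le_mul_of_nonneg_right (hρ x) (abs_nonneg _)
  rw [integral_const_mul] at h1
  have h2 := Lp.integral_abs_mul_le u v
  rw [mul_assoc]
  exact h1.trans (mul_le_mul_of_nonneg_left h2 K.coe_nonneg)

theorem wip_comm (u v : α → ℝ) : wip ν ρ u v = wip ν ρ v u := by
  simp only [wip]
  exact integral_congr_ae (Eventually.of_forall fun x => by ring_nf)

theorem wip_congr {u u' v v' : α → ℝ} (hu : u =ᵐ[ν] u') (hv : v =ᵐ[ν] v') :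
    wip ν ρ u v = wip ν ρ u' v' := by
  refine integral_congr_ae ?_
  filter_upwards [hu, hv] with x h1 h2
  rw [h1, h2]

open Classical in
/-- The bilinear form `⟨u, v⟩ = ∫ u v ρ` on `L²`, for a bounded measurable weight `ρ`. -/
noncomputable def weightedForm (ν : Measure α) (ρ : α → ℝ) : Lp ℝ 2 ν →L[ℝ] Lp ℝ 2 ν →L[ℝ] ℝ :=
  if h : AEStronglyMeasurable ρ ν ∧ ∃ K : ℝ≥0, ∀ x, |ρ x| ≤ K then
    LinearMap.mkContinuous₂
      (LinearMap.mk₂ ℝ (fun u v : Lp ℝ 2 ν => wip ν ρ u v)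
        (fun u u' v => by
          rw [wip_congr (Lp.coeFn_add u u') EventuallyEq.rfl]
          simp only [wip]
          rw [← integral_add (wip_integrable h.1 h.2.choose_spec u v)
            (wip_integrable h.1 h.2.choose_spec u' v)]
          exact integral_congr_ae (Eventually.of_forall fun x => by
            simp only [Pi.add_apply]; ring))
        (fun c u v => by
          rw [wip_congr (Lp.coeFn_smul c u) EventuallyEq.rfl]
          simp only [wip, smul_eq_mul]
          rw [← integral_const_mul]
          exact integral_congr_ae (Eventually.of_forall fun x => by
            simp only [Pi.smul_apply, smul_eq_mul]; ring))
        (fun u v v' => by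
          rw [wip_congr EventuallyEq.rfl (Lp.coeFn_add v v')]
          simp only [wip]
          rw [← integral_add (wip_integrable h.1 h.2.choose_spec u v)
            (wip_integrable h.1 h.2.choose_spec u v')]
          exact integral_congr_ae (Eventually.of_forall fun x => by
            simp only [Pi.add_apply]; ring))
        (fun c u v => by
          rw [wip_congr EventuallyEq.rfl (Lp.coeFn_smul c v)]
          simp only [wip, smul_eq_mul]
          rw [← integral_const_mul]
          exact integral_congr_ae (Eventually.of_forall fun x => by
            simp only [Pi.smul_apply, smul_eq_mul]; ring)))
      h.2.choose (fun u v => abs_wip_le h.1 h.2.choose_spec u v)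
  else 0

theorem weightedForm_apply (hm : AEStronglyMeasurable ρ ν) (hρ : ∀ x, |ρ x| ≤ K)
    (u v : Lp ℝ 2 ν) : weightedForm ν ρ u v = wip ν ρ u v := by
  rw [weightedForm, dif_pos ⟨hm, K, hρ⟩]
  rfl

theorem norm_sq_le_wip (hm : AEStronglyMeasurable ρ ν) (hρ : ∀ x, |ρ x| ≤ K) {c : ℝ}
    (hc : 0 < c) (hcρ : ∀ x, c⁻¹ ≤ ρ x) (u : Lp ℝ 2 ν) : ‖u‖ ^ 2 ≤ c * wip ν ρ u u := by
  rw [← real_inner_self_eq_norm_sq, L2.inner_def, wip, ← integral_const_mul]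
  refine integral_mono ?_ ((wip_integrable hm hρ u u).const_mul c) fun x => ?_
  · simpa [pow_two] using Lp.integrable_mul u u
  · have h1 : 1 ≤ c * ρ x := by
      calc (1 : ℝ) = c * c⁻¹ := by field_simp
        _ ≤ c * ρ x := by gcongr; exact hcρ x
    simp only [RCLike.inner_apply, conj_trivial]
    nlinarith [mul_self_nonneg (u x)]

end WeightedForm

/-! ### Global continuity and boundedness of weights that are Lipschitz in charts. -/

section ManifoldWeights

open Filter Topology

variable {d : ℕ} {N : Type*} [TopologicalSpace N] [ChartedSpace (EuclideanSpace ℝ (Fin d)) N]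

namespace SobolevAtlas

theorem LipBounded.continuous {A : SobolevAtlas d N} {K : ℝ≥0} {ρ : N → ℝ}
    (h : A.LipBounded K ρ) : Continuous ρ := by
  refine LocallyFinite.continuous (f := fun i => tsupport (A.psi i)) (locallyFinite_of_finite _)
    (eq_univ_of_forall fun x => mem_iUnion.2 (A.exists_mem_tsupport x))
    (fun i => isClosed_tsupport _) fun i => ?_
  have h1 : ContinuousOn (fun x => ρ ((A.chart i).symm (A.chart i x))) (tsupport (A.psi i)) :=
    (h i).1.continuousOn.comp ((A.chart i).continuousOn.mono (A.psi_tsupport i))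
      fun x hx => ⟨x, hx, rfl⟩
  refine h1.congr fun x hx => ?_
  simp only
  rw [(A.chart i).left_inv (A.psi_tsupport i hx)]

theorem LipBounded.abs_le {A : SobolevAtlas d N} {K : ℝ≥0} {ρ : N → ℝ}
    (h : A.LipBounded K ρ) (x : N) : |ρ x| ≤ K := by
  obtain ⟨i, hi⟩ := A.exists_mem_tsupport x
  have h1 := (h i).2 (A.chart i x) ⟨x, hi, rfl⟩
  rwa [(A.chart i).left_inv (A.psi_tsupport i hi)] at h1

end SobolevAtlas

end ManifoldWeights

/-! ### Integration by parts along Lipschitz vector fields. -/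

section Divergence

open Filter Topology

variable {d : ℕ}

local notation "𝔼" => EuclideanSpace ℝ (Fin d)

theorem LipschitzOnWith.smul_of_bounded {α F : Type*} [PseudoMetricSpace α] [NormedAddCommGroup F]
    [NormedSpace ℝ F] {s : Set α} {a : α → ℝ} {b : α → F} {K L M P : ℝ≥0}
    (ha : LipschitzOnWith K a s) (hb : LipschitzOnWith L b s) (haM : ∀ x ∈ s, |a x| ≤ M)
    (hbP : ∀ x ∈ s, ‖b x‖ ≤ P) : LipschitzOnWith (M * L + K * P) (fun x => a x • b x) s := by
  refine LipschitzOnWith.of_dist_le_mul fun x hx y hy => ?_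
  have h1 := ha.dist_le_mul x hx y hy
  have h2 := hb.dist_le_mul x hx y hy
  rw [dist_eq_norm] at h1 h2 ⊢
  have h3 : a x • b x - a y • b y = a x • (b x - b y) + (a x - a y) • b y := by
    rw [smul_sub, sub_smul]; abel
  rw [h3]
  refine (norm_add_le _ _).trans ?_
  rw [norm_smul, norm_smul]
  push_cast
  calc ‖a x‖ * ‖b x - b y‖ + ‖a x - a y‖ * ‖b y‖
      ≤ M * (L * dist x y) + (K * dist x y) * P := by
        gcongr
        · exact haM x hx
        · exact hbP y hy
    _ = _ := by ring

/-- The derivative is moved onto the Lipschitz factor, whose directional derivatives are bounded by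
`L * ‖v‖`. -/
theorem abs_integral_fderiv_apply_mul_le {k g : 𝔼 → ℝ} (hk : ContDiff ℝ 1 k)
    (hkc : HasCompactSupport k) {L : ℝ≥0} (hg : LipschitzWith L g) (v : 𝔼) :
    |∫ y, fderiv ℝ k y v * g y| ≤ L * ‖v‖ * ∫ y, |k y| := by
  obtain ⟨D, hD⟩ := hk.lipschitzWith_of_hasCompactSupport hkc one_ne_zero
  have h1 := hg.integral_lineDeriv_mul_eq (μ := volume) hD hkc v
  have h2 : ∫ y, fderiv ℝ k y v * g y = -∫ y, lineDeriv ℝ g y v * k y := by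
    rw [h1, ← integral_neg]
    refine integral_congr_ae (Eventually.of_forall fun y => ?_)
    simp only
    rw [(hk.differentiable one_ne_zero y).lineDeriv_eq_fderiv, map_neg]
    ring
  rw [h2, abs_neg, ← integral_const_mul]
  refine abs_integral_le_integral_abs.trans (integral_mono_of_nonneg
    (Eventually.of_forall fun _ => abs_nonneg _)
    ((hk.continuous.integrable_of_hasCompactSupport hkc).abs.const_mul _)
    (Eventually.of_forall fun y => ?_))
  simp only
  rw [abs_mul]
  gcongr
  exact norm_lineDeriv_le_of_lipschitz ℝ hg

/-- The coordinates of `b` are extended to Lipschitz functions on the whole space, which does not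
affect the integral because the derivative of `k` vanishes off `s`. The factor `d` counts
coordinates. -/
theorem abs_setIntegral_fderiv_apply_le {k : 𝔼 → ℝ} (hk : ContDiff ℝ 1 k) {s : Set 𝔼}
    (hs : IsCompact s) (hks : Function.support k ⊆ s) {b : 𝔼 → 𝔼} {L : ℝ≥0}
    (hb : LipschitzOnWith L b s) :
    |∫ y in s, fderiv ℝ k y (b y)| ≤ d * L * ∫ y, |k y| := by
  have hkc : HasCompactSupport k := hs.of_isClosed_subset (isClosed_tsupport _)
    (closure_minimal hks hs.isClosed)
  have hcoord : ∀ l : Fin d, LipschitzOnWith L (fun y => b y l) s := fun l => by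
    refine LipschitzOnWith.of_dist_le_mul fun x hx y hy => ?_
    refine le_trans ?_ (hb.dist_le_mul x hx y hy)
    rw [dist_eq_norm, dist_eq_norm]
    exact PiLp.norm_apply_le (b x - b y) l
  choose g hg hbg using fun l => (hcoord l).extend_real
  have hfd : ∀ y ∉ s, fderiv ℝ k y = 0 := fun y hy => by
    have h1 : k =ᶠ[𝓝 y] fun _ => 0 := by
      filter_upwards [hs.isClosed.isOpen_compl.mem_nhds hy] with z hz
      exact Function.notMem_support.1 fun h => hz (hks h)
    rw [h1.fderiv_eq, fderiv_const_apply]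
  have h1 : ∫ y in s, fderiv ℝ k y (b y) =
      ∑ l, ∫ y, fderiv ℝ k y (EuclideanSpace.single l 1) * g l y := by
    rw [← integral_finsetSum]
    · refine Eq.trans ?_ (setIntegral_eq_integral_of_forall_compl_eq_zero (s := s) ?_)
      · refine setIntegral_congr_fun hs.isClosed.measurableSet fun y hy => ?_
        have h2 : b y = ∑ l, g l y • EuclideanSpace.single l (1 : ℝ) := by
          have := (EuclideanSpace.basisFun (Fin d) ℝ).sum_repr (b y)
          simp only [EuclideanSpace.basisFun_repr, EuclideanSpace.basisFun_apply] at this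
          rw [← this]
          refine Finset.sum_congr rfl fun l _ => ?_
          rw [← hbg l hy]
        rw [h2, map_sum (fderiv ℝ k y)]
        refine Finset.sum_congr rfl fun l _ => ?_
        rw [map_smul, smul_eq_mul, mul_comm]
      · intro y hy
        simp [hfd y hy]
    · intro l _
      refine Continuous.integrable_of_hasCompactSupport
        (((hk.continuous_fderiv one_ne_zero).clm_apply continuous_const).mul (hg l).continuous) ?_
      refine hs.of_isClosed_subset (isClosed_tsupport _) (closure_minimal ?_ hs.isClosed)
      intro y hy
      by_contra hys
      simp [hfd y hys] at hy
  rw [h1]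
  refine (Finset.abs_sum_le_sum_abs _ _).trans ?_
  calc _ ≤ ∑ _l : Fin d, L * ∫ y, |k y| := by
        refine Finset.sum_le_sum fun l _ => ?_
        have := abs_integral_fderiv_apply_mul_le hk hkc (hg l) (EuclideanSpace.single l 1)
        rwa [PiLp.norm_single, norm_one, mul_one] at this
    _ = _ := by simp [mul_assoc]

end Divergence

/-! ### Approximate skewness of a derivation with Lipschitz coefficients. -/

section Derivation

open Filter Topology

variable {d : ℕ} {N : Type*} [TopologicalSpace N] [ChartedSpace (EuclideanSpace ℝ (Fin d)) N]

namespace SobolevAtlas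

theorem contMDiff_psi_mul (A : SobolevAtlas d N) (i : Fin A.card) {q : N → ℝ}
    (hq : ContMDiff (𝓡 d) 𝓘(ℝ, ℝ) 1 q) :
    ContMDiff (𝓡 d) 𝓘(ℝ, ℝ) 1 (fun x => A.psi i x * q x) :=
  ((A.psi_contMDiff i).of_le one_le_two).mul hq

/-- The derivative `du(V)` of a function along a vector field. -/
noncomputable def dirDeriv (V : (x : N) → TangentSpace (𝓡 d) x) (u : N → ℝ) (x : N) : ℝ :=
  mfderiv (𝓡 d) 𝓘(ℝ, ℝ) u x (V x)

theorem dirDeriv_mul (V : (x : N) → TangentSpace (𝓡 d) x) {z w : N → ℝ}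
    (hz : ContMDiff (𝓡 d) 𝓘(ℝ, ℝ) 1 z) (hw : ContMDiff (𝓡 d) 𝓘(ℝ, ℝ) 1 w) (x : N) :
    dirDeriv V (fun x => z x * w x) x = z x * dirDeriv V w x + w x * dirDeriv V z x := by
  have h1 := ((hz.mdifferentiableAt one_ne_zero (x := x)).hasMFDerivAt.mul
    (hw.mdifferentiableAt one_ne_zero (x := x)).hasMFDerivAt).mfderiv
  exact congrArg (fun T : TangentSpace (𝓡 d) x →L[ℝ] ℝ => T (V x)) h1

theorem dirDeriv_psi_mul_eq_zero (A : SobolevAtlas d N) (i : Fin A.card)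
    (V : (x : N) → TangentSpace (𝓡 d) x) (q : N → ℝ) {x : N} (hx : x ∉ tsupport (A.psi i)) :
    dirDeriv V (fun x => A.psi i x * q x) x = 0 := by
  have h1 : (fun x => A.psi i x * q x) =ᶠ[𝓝 x] fun _ => 0 := by
    filter_upwards [(isClosed_tsupport (A.psi i)).isOpen_compl.mem_nhds hx] with z hz
    rw [image_eq_zero_of_notMem_tsupport hz, zero_mul]
  rw [dirDeriv, h1.mfderiv_eq, mfderiv_const]
  rfl

theorem dirDeriv_psi_mul_eq [CompactSpace N] (A : SobolevAtlas d N) (i : Fin A.card) {q : N → ℝ}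
    (hq : ContMDiff (𝓡 d) 𝓘(ℝ, ℝ) 1 q) (V : (x : N) → TangentSpace (𝓡 d) x)
    {y : EuclideanSpace ℝ (Fin d)} (hy : y ∈ A.piece i) :
    dirDeriv V (fun x => A.psi i x * q x) ((A.chart i).symm y) =
      fderiv ℝ (A.loc i q) y (A.coeff V i y) := by
  have hyt := A.piece_subset_target i hy
  set x := (A.chart i).symm y with hx
  have hxs : x ∈ (A.chart i).source := (A.chart i).map_target hyt
  have hxy : A.chart i x = y := (A.chart i).right_inv hyt
  have hn := (A.chart i).open_source.mem_nhds hxs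
  have h1 : (fun x => A.psi i x * q x) =ᶠ[𝓝 x] A.loc i q ∘ A.chart i := by
    filter_upwards [hn] with z hz
    rw [Function.comp_apply, loc, indicator_of_mem ((A.chart i).map_source hz),
      (A.chart i).left_inv hz]
  have hd1 : MDifferentiableAt 𝓘(ℝ, EuclideanSpace ℝ (Fin d)) 𝓘(ℝ, ℝ) (A.loc i q)
      (A.chart i x) := ((A.contDiff_loc i hq).differentiable one_ne_zero _).mdifferentiableAt
  have hd2 : MDifferentiableAt (𝓡 d) 𝓘(ℝ, EuclideanSpace ℝ (Fin d)) (A.chart i) x :=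
    ((A.contMDiffOn_chart i).contMDiffAt hn).mdifferentiableAt one_ne_zero
  rw [dirDeriv, h1.mfderiv_eq, mfderiv_comp x hd1 hd2, mfderiv_eq_fderiv, hxy]
  rfl

namespace IsDensity

variable [MeasurableSpace N] {A : SobolevAtlas d N} {μ : Measure N} {κ : ℝ≥0}
  {J : Fin A.card → EuclideanSpace ℝ (Fin d) → ℝ} [CompactSpace N] [BorelSpace N]

theorem integral_abs_loc_le_integral (h : A.IsDensity μ κ J) (i : Fin A.card) {q : N → ℝ}
    (hq : Continuous q) :
    ∫ y, |A.loc i q y| ≤ κ * ∫ x, A.psi i x * |q x| ∂μ := by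
  have hc : Continuous fun x => A.psi i x * |q x| := (continuous_psi A i).mul hq.abs
  have h1 : ∫ x, A.psi i x * |q x| ∂μ = ∫ x in tsupport (A.psi i), A.psi i x * |q x| ∂μ := by
    refine (setIntegral_eq_integral_of_forall_compl_eq_zero fun x hx => ?_).symm
    rw [image_eq_zero_of_notMem_tsupport hx, zero_mul]
  have hco : ContinuousOn (fun y => A.psi i ((A.chart i).symm y) * |q ((A.chart i).symm y)|)
      (A.piece i) := hc.comp_continuousOn (A.continuousOn_symm i)
  rw [h1, h.setIntegral_eq i hc.aestronglyMeasurable, ← integral_const_mul]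
  have h2 : ∫ y, |A.loc i q y| =
      ∫ y in A.piece i, A.psi i ((A.chart i).symm y) * |q ((A.chart i).symm y)| := by
    rw [← setIntegral_eq_integral_of_forall_compl_eq_zero (s := A.piece i)]
    · refine setIntegral_congr_fun (A.measurableSet_piece i) fun y hy => ?_
      rw [A.loc_eq_indicator, indicator_of_mem hy, abs_mul, abs_of_nonneg (A.psi_nonneg i _)]
    · intro y hy
      rw [A.loc_eq_indicator, indicator_of_notMem hy, abs_zero]
  rw [h2]
  refine setIntegral_mono_on (hco.integrableOn_compact (A.isCompact_piece i))
    ((continuousOn_const.mul ((h.lip i).continuousOn.mul hco)).integrableOn_compact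
      (A.isCompact_piece i)) (A.measurableSet_piece i) fun y hy => ?_
  have h3 : (1 : ℝ) ≤ κ * J i y := by
    have h4 : (0 : ℝ) < κ := h.pos
    calc (1 : ℝ) = κ * (κ : ℝ)⁻¹ := by field_simp
      _ ≤ κ * J i y := by gcongr; exact h.lower i y hy
  have h4 : 0 ≤ A.psi i ((A.chart i).symm y) * |q ((A.chart i).symm y)| :=
    mul_nonneg (A.psi_nonneg i _) (abs_nonneg _)
  nlinarith

/-- In the chart the field is `J ρ V`, a product of three bounded Lipschitz factors with Lipschitz
constant `3 κ K²`. The second `κ` comes from returning to an integral over `μ`. -/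
theorem abs_integral_mfderiv_psi_mul_le (h : A.IsDensity μ κ J) (i : Fin A.card) {q : N → ℝ}
    (hq : ContMDiff (𝓡 d) 𝓘(ℝ, ℝ) 1 q) {K : ℝ≥0} {ρ : N → ℝ} (hρ : A.LipBounded K ρ)
    {V : (x : N) → TangentSpace (𝓡 d) x} (hV : A.LipField K V)
    (hm : AEStronglyMeasurable (fun x => dirDeriv V (fun x => A.psi i x * q x) x * ρ x) μ) :
    |∫ x, dirDeriv V (fun x => A.psi i x * q x) x * ρ x ∂μ| ≤
      3 * d * κ ^ 2 * K ^ 2 * ∫ x, A.psi i x * |q x| ∂μ := by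
  have h1 : ∫ x, dirDeriv V (fun x => A.psi i x * q x) x * ρ x ∂μ =
      ∫ y in A.piece i, fderiv ℝ (A.loc i q) y
        ((J i y • ρ ((A.chart i).symm y)) • A.coeff V i y) := by
    rw [← setIntegral_eq_integral_of_forall_compl_eq_zero (s := tsupport (A.psi i)),
      h.setIntegral_eq i hm]
    · refine setIntegral_congr_fun (A.measurableSet_piece i) fun y hy => ?_
      rw [A.dirDeriv_psi_mul_eq i hq V hy, map_smul, smul_eq_mul, smul_eq_mul]
      ring
    · intro x hx
      rw [A.dirDeriv_psi_mul_eq_zero i V q hx, zero_mul]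
  have hJ : ∀ y ∈ A.piece i, |J i y| ≤ κ := fun y hy => by
    rw [abs_of_pos (h.J_pos hy)]
    exact h.upper i y hy
  have hL1 := (h.lip i).smul_of_bounded (hρ i).1 hJ (fun y hy => (hρ i).2 y hy)
  have hL2 := hL1.smul_of_bounded (hV i).1 (M := κ * K) (fun y hy => by
    rw [smul_eq_mul, abs_mul, NNReal.coe_mul]
    exact mul_le_mul (hJ y hy) ((hρ i).2 y hy) (abs_nonneg _) κ.coe_nonneg) (hV i).2
  rw [h1]
  refine (abs_setIntegral_fderiv_apply_le (A.contDiff_loc i hq) (A.isCompact_piece i)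
    (A.support_loc_subset i q) hL2).trans ?_
  refine (mul_le_mul_of_nonneg_left (h.integral_abs_loc_le_integral i hq.continuous)
    (by positivity)).trans (le_of_eq ?_)
  push_cast
  ring

/-- By Leibniz the two terms add up to the derivative of the product `z w`. The partition of unity
localizes it, and its integral is bounded by that of `|z w|`, hence by the `L²` norms. -/
theorem skew_of_contMDiff (h : A.IsDensity μ κ J) {K : ℝ≥0} {ρ : N → ℝ} (hρ : A.LipBounded K ρ)
    {V : (x : N) → TangentSpace (𝓡 d) x} (hV : A.LipField K V) {X : Lp ℝ 2 μ →ₗ[ℝ] Lp ℝ 2 μ}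
    (hX : ∀ (u : N → ℝ) (U : Lp ℝ 2 μ), ContMDiff (𝓡 d) 𝓘(ℝ, ℝ) 1 u → U =ᵐ[μ] u →
      X U =ᵐ[μ] dirDeriv V u)
    {z w : N → ℝ} (hz : ContMDiff (𝓡 d) 𝓘(ℝ, ℝ) 1 z) (hw : ContMDiff (𝓡 d) 𝓘(ℝ, ℝ) 1 w)
    {Z W : Lp ℝ 2 μ} (hZ : Z =ᵐ[μ] z) (hW : W =ᵐ[μ] w) :
    |wip μ ρ (X Z) W + wip μ ρ Z (X W)| ≤ 3 * d * κ ^ 2 * K ^ 2 * ‖Z‖ * ‖W‖ := by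
  have hfin := h.isFiniteMeasure
  have hρm : AEStronglyMeasurable ρ μ := hρ.continuous.aestronglyMeasurable
  let q : N → ℝ := fun x => z x * w x
  have hq : ContMDiff (𝓡 d) 𝓘(ℝ, ℝ) 1 q := hz.mul hw
  have hqL : MemLp q 2 μ := h.memLp_of_continuous hq.continuous
  have hpL : ∀ i, MemLp (fun x => A.psi i x * q x) 2 μ := fun i => memLp_psi_mul A i hqL
  let P : Fin A.card → Lp ℝ 2 μ := fun i => (hpL i).toLp _
  have hP : (∑ i, P i : Lp ℝ 2 μ) =ᵐ[μ] q := by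
    have h1 : ∀ᵐ x ∂μ, ∀ i, P i x = A.psi i x * q x :=
      ae_all_iff.2 fun i => (hpL i).coeFn_toLp
    filter_upwards [h1, Lp.coeFn_finsetSum Finset.univ P] with x h2 h3
    rw [h3, Finset.sum_apply, Finset.sum_congr rfl fun i _ => h2 i, ← Finset.sum_mul, A.psi_sum,
      one_mul]
  have hXP : ∀ i, X (P i) =ᵐ[μ] fun x =>
      dirDeriv V (fun x => A.psi i x * q x) x := fun i =>
    hX _ _ (A.contMDiff_psi_mul i hq) (hpL i).coeFn_toLp
  have hXint : ∀ i, Integrable (fun x => X (P i) x * ρ x) μ := fun i =>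
    ((Lp.memLp (X (P i))).integrable (by norm_num)).mul_bdd hρm (Eventually.of_forall hρ.abs_le)
  have hsum : wip μ ρ (X Z) W + wip μ ρ Z (X W) = ∑ i, ∫ x, X (P i) x * ρ x ∂μ := by
    rw [← integral_finsetSum _ fun i _ => hXint i, wip, wip,
      ← integral_add (wip_integrable hρm hρ.abs_le _ _) (wip_integrable hρm hρ.abs_le _ _)]
    refine integral_congr_ae ?_
    have hXsum : X (∑ i, P i) = ∑ i, X (P i) := map_sum X P Finset.univ
    have h1 := hX q _ hq hP
    rw [hXsum] at h1
    filter_upwards [hX z Z hz hZ, hX w W hw hW, hZ, hW, h1,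
      Lp.coeFn_finsetSum Finset.univ fun i => X (P i)] with x h2 h3 h4 h5 h6 h7
    rw [← Finset.sum_mul]
    have h8 : ∑ i, X (P i) x = dirDeriv V q x := by
      rw [← h6, h7, Finset.sum_apply]
    rw [h8, h2, h3, h4, h5, dirDeriv_mul V hz hw]
    ring
  rw [hsum]
  refine (Finset.abs_sum_le_sum_abs _ _).trans ?_
  have hterm : ∀ i, |∫ x, X (P i) x * ρ x ∂μ| ≤
      3 * d * κ ^ 2 * K ^ 2 * ∫ x, A.psi i x * |q x| ∂μ := fun i => by
    have h1 : (fun x => X (P i) x * ρ x) =ᵐ[μ] fun x =>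
        dirDeriv V (fun x => A.psi i x * q x) x * ρ x := by
      filter_upwards [hXP i] with x hx
      rw [hx]
    rw [integral_congr_ae h1]
    exact h.abs_integral_mfderiv_psi_mul_le i hq hρ hV ((hXint i).1.congr h1)
  refine (Finset.sum_le_sum fun i _ => hterm i).trans ?_
  rw [← Finset.mul_sum, ← integral_finsetSum]
  · simp only [← Finset.sum_mul, A.psi_sum, one_mul]
    rw [mul_assoc _ ‖Z‖]
    gcongr
    refine le_trans (le_of_eq ?_) (Lp.integral_abs_mul_le Z W)
    refine integral_congr_ae ?_
    filter_upwards [hZ, hW] with x h1 h2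
    rw [h1, h2]
  · intro i _
    exact ((continuous_psi A i).mul hq.continuous.abs).integrable_of_hasCompactSupport
      (HasCompactSupport.of_compactSpace _)

variable [T2Space N]

/-- The left side is continuous along approximations in `H¹` and the right side involves only `L²`
norms, so density of `C¹` functions suffices. -/
theorem skew (h : A.IsDensity μ κ J) {K : ℝ≥0} {ρ : N → ℝ} (hρ : A.LipBounded K ρ)
    {V : (x : N) → TangentSpace (𝓡 d) x} (hV : A.LipField K V) {X : Lp ℝ 2 μ →ₗ[ℝ] Lp ℝ 2 μ}
    (hX : ∀ (u : N → ℝ) (U : Lp ℝ 2 μ), ContMDiff (𝓡 d) 𝓘(ℝ, ℝ) 1 u → U =ᵐ[μ] u →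
      X U =ᵐ[μ] dirDeriv V u)
    {L : ℝ} (hXb : ∀ u : Lp ℝ 2 μ, A.MemSob 1 u → ‖X u‖ ≤ L * A.nrm 1 u)
    {z w : Lp ℝ 2 μ} (hz : A.MemSob 1 z) (hw : A.MemSob 1 w) :
    |wip μ ρ (X z) w + wip μ ρ z (X w)| ≤ 3 * d * κ ^ 2 * K ^ 2 * ‖z‖ * ‖w‖ := by
  have hρm : AEStronglyMeasurable ρ μ := hρ.continuous.aestronglyMeasurable
  have hlim : ∀ u : Lp ℝ 2 μ, A.MemSob 1 u → ∃ (v : ℕ → N → ℝ) (U : ℕ → Lp ℝ 2 μ),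
      (∀ n, ContMDiff (𝓡 d) 𝓘(ℝ, ℝ) 1 (v n)) ∧ (∀ n, U n =ᵐ[μ] v n) ∧
      Tendsto U atTop (𝓝 u) ∧ Tendsto (fun n => X (U n)) atTop (𝓝 (X u)) := by
    intro u hu
    obtain ⟨v, U, hv, hU, -, hUm, hn, hU'⟩ := h.exists_contMDiff_seq hu
    refine ⟨v, U, hv, hU, hU', ?_⟩
    rw [tendsto_iff_norm_sub_tendsto_zero]
    have h1 : Tendsto (fun n => L * A.nrm 1 (u - U n : Lp ℝ 2 μ)) atTop (𝓝 0) := by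
      simpa using hn.const_mul L
    refine squeeze_zero (fun n => norm_nonneg _) (fun n => ?_) h1
    rw [norm_sub_rev, ← map_sub]
    exact hXb _ (hUm n)
  obtain ⟨v, U, hv, hU, hUl, hXU⟩ := hlim z hz
  obtain ⟨v', U', hv', hU', hUl', hXU'⟩ := hlim w hw
  have h1 := fun n => h.skew_of_contMDiff hρ hV hX (hv n) (hv' n) (hU n) (hU' n)
  simp only [← weightedForm_apply hρm hρ.abs_le] at h1 ⊢
  have hp : ∀ {a b : ℕ → Lp ℝ 2 μ} {a₀ b₀ : Lp ℝ 2 μ}, Tendsto a atTop (𝓝 a₀) →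
      Tendsto b atTop (𝓝 b₀) → Tendsto (fun n => weightedForm μ ρ (a n) (b n)) atTop
        (𝓝 (weightedForm μ ρ a₀ b₀)) := fun ha hb =>
    ((weightedForm μ ρ).isBoundedBilinearMap.continuous.tendsto _).comp (ha.prodMk_nhds hb)
  exact le_of_tendsto_of_tendsto' ((hp hXU hUl').add (hp hUl hXU')).abs
    ((hUl.norm.const_mul _).mul hUl'.norm) h1

end IsDensity

end SobolevAtlas

end Derivation

/-! ### Uniform bounds for the operators on the manifold. -/

section Operators

open Filter Topology

/-- A functional that is bounded on a subspace is represented by a coercive symmetric form. -/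
theorem exists_form_eq_of_bounded {H : Type*} [NormedAddCommGroup H] [InnerProductSpace ℝ H]
    [CompleteSpace H] {κ : ℝ} {p : H →L[ℝ] H →L[ℝ] ℝ} (hκ : 0 < κ)
    (hp : ∀ u, ‖u‖ ^ 2 ≤ κ * p u u) (hsymm : ∀ u v, p u v = p v u) {V : Submodule ℝ H}
    {T : H →ₗ[ℝ] ℝ} {C : ℝ} (hT : ∀ z ∈ V, |T z| ≤ C * ‖z‖) : ∃ w, ∀ z ∈ V, T z = p z w := by
  let F : StrongDual ℝ V := (T.comp V.subtype).mkContinuous C fun z => hT z z.2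
  obtain ⟨G, hG, -⟩ := exists_extension_norm_eq V F
  obtain ⟨w, hw⟩ := exists_eq_inner_of_coercive hκ hp ((InnerProductSpace.toDual ℝ H).symm G)
  refine ⟨w, fun z hz => ?_⟩
  rw [hsymm, hw, InnerProductSpace.toDual_symm_apply]
  exact (hG ⟨z, hz⟩).symm

variable {d : ℕ} {N : Type*} [TopologicalSpace N] [ChartedSpace (EuclideanSpace ℝ (Fin d)) N]

namespace SobolevAtlas

namespace IsDensity

variable [MeasurableSpace N] {A : SobolevAtlas d N} {μ : Measure N} {κ : ℝ≥0}
  {J : Fin A.card → EuclideanSpace ℝ (Fin d) → ℝ} [BorelSpace N]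
  {K : ℝ≥0} {ρ : ℝ → N → ℝ} {B X S : ℝ → Lp ℝ 2 μ →ₗ[ℝ] Lp ℝ 2 μ}

theorem form_apply (hρ : AdmissibleWeights A μ K ρ) {t : ℝ} (ht : t ∈ Icc (0 : ℝ) 1)
    (u v : Lp ℝ 2 μ) : weightedForm μ (ρ t) u v = wip μ (ρ t) u v :=
  weightedForm_apply (hρ.lip t ht).continuous.aestronglyMeasurable (hρ.lip t ht).abs_le u v

theorem abs_form_le (hρ : AdmissibleWeights A μ K ρ) {t : ℝ} (ht : t ∈ Icc (0 : ℝ) 1)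
    (u v : Lp ℝ 2 μ) : |weightedForm μ (ρ t) u v| ≤ K * ‖u‖ * ‖v‖ := by
  rw [form_apply hρ ht]
  exact abs_wip_le (hρ.lip t ht).continuous.aestronglyMeasurable (hρ.lip t ht).abs_le u v

theorem form_symm (hρ : AdmissibleWeights A μ K ρ) {t : ℝ} (ht : t ∈ Icc (0 : ℝ) 1)
    (u v : Lp ℝ 2 μ) : weightedForm μ (ρ t) u v = weightedForm μ (ρ t) v u := by
  rw [form_apply hρ ht, form_apply hρ ht, wip_comm]

theorem norm_sq_le_form (hK : 0 < K) (hρ : AdmissibleWeights A μ K ρ) {t : ℝ}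
    (ht : t ∈ Icc (0 : ℝ) 1) (u : Lp ℝ 2 μ) : ‖u‖ ^ 2 ≤ K * weightedForm μ (ρ t) u u := by
  rw [form_apply hρ ht]
  exact norm_sq_le_wip (hρ.lip t ht).continuous.aestronglyMeasurable (hρ.lip t ht).abs_le
    (NNReal.coe_pos.2 hK) (hρ.lower t ht) u

theorem abs_form_sub_le (hρ : AdmissibleWeights A μ K ρ) {s t : ℝ} (hs : s ∈ Icc (0 : ℝ) 1)
    (ht : t ∈ Icc (0 : ℝ) 1) (u v : Lp ℝ 2 μ) :
    |weightedForm μ (ρ s) u v - weightedForm μ (ρ t) u v| ≤ K * K * |s - t| * ‖u‖ * ‖v‖ := by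
  rw [form_apply hρ hs, form_apply hρ ht]
  obtain ⟨γ, hγ⟩ := hρ.deriv
  have h1 := Convex.norm_image_sub_le_of_norm_hasDerivWithin_le
    (f := fun s => wip μ (ρ s) u v) (C := K * K * ‖u‖ * ‖v‖) (s := Icc (0 : ℝ) 1)
    (fun r hr => (hγ r hr).2.2 u v) (fun r hr => ?_) (convex_Icc 0 1) ht hs
  · rw [Real.norm_eq_abs, Real.norm_eq_abs] at h1
    refine h1.trans (le_of_eq (by ring))
  · obtain ⟨hm, hb, -⟩ := hγ r hr
    have h2 : wip μ (ρ r) (fun x => γ r x * u x) v = wip μ (fun x => γ r x * ρ r x) u v := by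
      simp only [wip]
      exact integral_congr_ae (Eventually.of_forall fun x => by ring_nf)
    rw [h2, Real.norm_eq_abs]
    have h3 := abs_wip_le (K := K * K) (ρ := fun x => γ r x * ρ r x)
      (hm.aestronglyMeasurable.mul (hρ.lip r hr).continuous.aestronglyMeasurable)
      (fun x => by
        rw [abs_mul, NNReal.coe_mul]
        exact mul_le_mul (hb x) ((hρ.lip r hr).abs_le x) (abs_nonneg _) K.coe_nonneg) u v
    simpa only [NNReal.coe_mul] using h3

theorem norm_B_le (hK : 0 < K) (hρ : AdmissibleWeights A μ K ρ)
    (hB : AdmissibleB A μ K ρ B) {t : ℝ} (ht : t ∈ Icc (0 : ℝ) 1) {u : Lp ℝ 2 μ}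
    (hu : A.MemSob 1 u) : ‖B t u‖ ≤ K * A.nrm 1 u := by
  have h1 := (hB.first_order t ht u hu).2
  rw [← form_apply hρ ht] at h1
  have h3 := norm_sq_le_form hK hρ ht (B t u)
  refine (pow_le_pow_iff_left₀ (norm_nonneg _)
    (mul_nonneg K.coe_nonneg (A.nrm_nonneg 1 u)) two_ne_zero).1 (h3.trans ?_)
  calc (K : ℝ) * weightedForm μ (ρ t) (B t u) (B t u) ≤ K * (K * A.nrm 1 u ^ 2) := by gcongr
    _ = _ := by ring

variable [CompactSpace N]

theorem norm_le (h : A.IsDensity μ κ J) (u : Lp ℝ 2 μ) :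
    ‖u‖ ≤ (1 + A.card * κ) * A.nrm 0 u := by
  have h1 := h.norm_sq_le u
  have h2 := A.nrm_nonneg 0 u
  have h3 : (0 : ℝ) ≤ A.card * κ := by positivity
  refine (pow_le_pow_iff_left₀ (norm_nonneg _) (by positivity) two_ne_zero).1 (h1.trans ?_)
  rw [mul_pow]
  gcongr
  nlinarith

theorem nrm_zero_le (h : A.IsDensity μ κ J) (u : Lp ℝ 2 μ) : A.nrm 0 u ≤ (1 + κ) * ‖u‖ := by
  have h1 := h.nrm_zero_sq_le u
  have h3 : (0 : ℝ) ≤ κ := κ.coe_nonneg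
  refine (pow_le_pow_iff_left₀ (A.nrm_nonneg 0 u) (by positivity) two_ne_zero).1 (h1.trans ?_)
  rw [mul_pow]
  gcongr
  nlinarith

theorem norm_le_nrm_one (h : A.IsDensity μ κ J) {u : Lp ℝ 2 μ} (hu : A.MemSob 1 u) :
    ‖u‖ ≤ (1 + A.card * κ) * A.nrm 1 u :=
  (h.norm_le u).trans (mul_le_mul_of_nonneg_left (nrm_mono hu zero_le_one) (by positivity))

theorem norm_B_sub_le (h : A.IsDensity μ κ J) (hK : 0 < K) (hρ : AdmissibleWeights A μ K ρ)
    (hB : AdmissibleB A μ K ρ B) {s t : ℝ} (hs : s ∈ Icc (0 : ℝ) 1) (ht : t ∈ Icc (0 : ℝ) 1)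
    {u : Lp ℝ 2 μ} (hu : A.MemSob 1 u) :
    ‖B s u - B t u‖ ≤ (1 + A.card * κ) * K * |s - t| * A.nrm 1 u := by
  obtain ⟨D, hD⟩ := hB.deriv
  -- The weak derivative at time `r` is stated for the weight `ρ r`. Testing with `v / ρ r` turns
  -- each of these pairings into the same unweighted inner product, to which the mean value
  -- inequality applies.
  have hinner : ∀ r ∈ Icc (0 : ℝ) 1, ∀ v : Lp ℝ 2 μ, ∃ v' : Lp ℝ 2 μ, ∀ w : Lp ℝ 2 μ,
      wip μ (ρ r) w v' = inner ℝ w v := by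
    intro r hr v
    have hpos : ∀ x, 0 < ρ r x := fun x =>
      (inv_pos.2 (NNReal.coe_pos.2 hK)).trans_le (hρ.lower r hr x)
    have hc : Continuous fun x => (ρ r x)⁻¹ :=
      (hρ.lip r hr).continuous.inv₀ fun x => (hpos x).ne'
    have hv' : MemLp (fun x => (ρ r x)⁻¹ * v x) 2 μ := by
      refine (Lp.memLp v).of_le_mul (c := K) (hc.aestronglyMeasurable.mul (Lp.memLp v).1)
        (Eventually.of_forall fun x => ?_)
      rw [norm_mul, Real.norm_of_nonneg (inv_nonneg.2 (hpos x).le)]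
      gcongr
      exact inv_le_of_inv_le₀ (NNReal.coe_pos.2 hK) (hρ.lower r hr x)
    refine ⟨hv'.toLp _, fun w => ?_⟩
    rw [L2.inner_def, wip]
    refine integral_congr_ae ?_
    filter_upwards [hv'.coeFn_toLp] with x hx
    rw [hx]
    have := (hpos x).ne'
    simp only [RCLike.inner_apply, conj_trivial]
    field_simp
  have hderiv : ∀ v : Lp ℝ 2 μ, ∀ r ∈ Icc (0 : ℝ) 1,
      HasDerivWithinAt (fun s => inner ℝ (B s u) v) (inner ℝ (D r u) v) (Icc 0 1) r := by
    intro v r hr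
    obtain ⟨v', hv'⟩ := hinner r hr v
    have := (hD r hr u hu).2 v'
    simpa only [hv'] using this
  set v := B s u - B t u with hv
  have h1 := Convex.norm_image_sub_le_of_norm_hasDerivWithin_le
    (f := fun s => inner ℝ (B s u) v) (C := (1 + A.card * κ) * (K * A.nrm 1 u) * ‖v‖)
    (s := Icc (0 : ℝ) 1) (fun r hr => hderiv v r hr) (fun r hr => ?_) (convex_Icc 0 1) ht hs
  · rw [← inner_sub_left, ← hv, real_inner_self_eq_norm_sq, Real.norm_eq_abs, Real.norm_eq_abs,
      abs_of_nonneg (sq_nonneg _)] at h1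
    rcases (norm_nonneg v).eq_or_lt with h0 | h0
    · rw [← h0]
      have := A.nrm_nonneg 1 u
      positivity
    · refine le_of_mul_le_mul_right ?_ h0
      calc ‖v‖ * ‖v‖ = ‖v‖ ^ 2 := (sq _).symm
        _ ≤ _ := h1
        _ = _ := by ring
  · refine (norm_inner_le_norm _ _).trans ?_
    gcongr
    exact (h.norm_le _).trans (by gcongr; exact (hD r hr u hu).1)

theorem form_shift_pos (h : A.IsDensity μ κ J) (hK : 0 < K) (hρ : AdmissibleWeights A μ K ρ)
    (hB : AdmissibleB A μ K ρ B) {t : ℝ} (ht : t ∈ Icc (0 : ℝ) 1) {u : Lp ℝ 2 μ}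
    (hu : A.MemSob 1 u) :
    -(K ^ 2 * κ) * weightedForm μ (ρ t) u u ≤ weightedForm μ (ρ t) (B t u) u := by
  have h1 := (hB.form t ht u hu).1
  rw [← form_apply hρ ht] at h1
  have h2 := h.nrm_zero_sq_le u
  have h3 := norm_sq_le_form hK hρ ht u
  have h4 : 0 ≤ (K : ℝ)⁻¹ * A.nrm (1 / 2) u ^ 2 := by positivity
  have h5 : (K : ℝ) * A.nrm 0 u ^ 2 ≤ K * (κ * (K * weightedForm μ (ρ t) u u)) := by
    gcongr
    exact h2.trans (by gcongr)
  nlinarith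

theorem nrm_one_sq_le (h : A.IsDensity μ κ J) (hK : 0 < K) (hρ : AdmissibleWeights A μ K ρ)
    (hB : AdmissibleB A μ K ρ B) {t : ℝ} (ht : t ∈ Icc (0 : ℝ) 1) {u : Lp ℝ 2 μ}
    (hu : A.MemSob 1 u) :
    A.nrm 1 u ^ 2 ≤ K * weightedForm μ (ρ t) (B t u) (B t u) +
      K ^ 3 * κ * weightedForm μ (ρ t) u u := by
  have h1 := (hB.first_order t ht u hu).1
  rw [← form_apply hρ ht] at h1
  have h2 := h.nrm_zero_sq_le u
  have h3 := norm_sq_le_form hK hρ ht u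
  have hK' : (0 : ℝ) < K := hK
  have h5 : (K : ℝ) * A.nrm 0 u ^ 2 ≤ K * (κ * (K * weightedForm μ (ρ t) u u)) := by
    gcongr
    exact h2.trans (by gcongr)
  have h6 : (K : ℝ)⁻¹ * A.nrm 1 u ^ 2 ≤ weightedForm μ (ρ t) (B t u) (B t u) +
    K * (κ * (K * weightedForm μ (ρ t) u u)) := by linarith
  rw [inv_mul_le_iff₀ hK'] at h6
  linarith

theorem norm_X_le (h : A.IsDensity μ κ J) (hX : AdmissibleX A μ K X) {t : ℝ}
    (ht : t ∈ Icc (0 : ℝ) 1) {u : Lp ℝ 2 μ} (hu : A.MemSob 1 u) :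
    ‖X t u‖ ≤ (1 + A.card * κ) * K * A.nrm 1 u := by
  obtain ⟨V, hV⟩ := hX
  rw [mul_assoc]
  exact (h.norm_le _).trans (by gcongr; exact (hV t ht).2.2 u hu)

theorem norm_S_le (h : A.IsDensity μ κ J) (hS : AdmissibleS A μ K S) {t : ℝ}
    (ht : t ∈ Icc (0 : ℝ) 1) {u : Lp ℝ 2 μ} (hu : A.MemSob 1 u) :
    ‖S t u‖ ≤ (1 + A.card * κ) * K * (1 + κ) * ‖u‖ := by
  calc ‖S t u‖ ≤ (1 + A.card * κ) * A.nrm 0 (S t u) := h.norm_le _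
    _ ≤ (1 + A.card * κ) * (K * A.nrm 0 u) := by gcongr; exact (hS t ht u hu).2.2
    _ ≤ (1 + A.card * κ) * (K * ((1 + κ) * ‖u‖)) := by gcongr; exact h.nrm_zero_le u
    _ = _ := by ring

theorem nrm_one_add_le (h : A.IsDensity μ κ J) {u v : Lp ℝ 2 μ} (hu : A.MemSob 1 u)
    (hv : A.MemSob 1 v) : A.nrm 1 (u + v : Lp ℝ 2 μ) ≤ 2 * (A.nrm 1 u + A.nrm 1 v) := by
  have h1 := A.nrm_nonneg 1 u
  have h2 := A.nrm_nonneg 1 v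
  refine (pow_le_pow_iff_left₀ (A.nrm_nonneg 1 _) (by positivity) two_ne_zero).1
    ((h.nrm_sq_coe_add_le hu hv).trans ?_)
  nlinarith [mul_nonneg h1 h2]

variable [T2Space N]

theorem abs_skew_le (h : A.IsDensity μ κ J) (hρ : AdmissibleWeights A μ K ρ)
    (hX : AdmissibleX A μ K X) {t : ℝ} (ht : t ∈ Icc (0 : ℝ) 1) {u v : Lp ℝ 2 μ}
    (hu : A.MemSob 1 u) (hv : A.MemSob 1 v) :
    |weightedForm μ (ρ t) (X t u) v + weightedForm μ (ρ t) u (X t v)| ≤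
      3 * d * κ ^ 2 * K ^ 2 * ‖u‖ * ‖v‖ := by
  have hXb := fun u hu => h.norm_X_le hX ht (u := u) hu
  obtain ⟨V, hV⟩ := hX
  rw [form_apply hρ ht, form_apply hρ ht]
  exact h.skew (hρ.lip t ht) (hV t ht).1 (hV t ht).2.1 hXb hu hv

/-- The weak commutator presupposes an adjoint `w` of `X` at `v`. By skewness `z ↦ ⟨X z, v⟩` is
bounded for the `L²` norm on `H¹`, so `w` exists by Hahn–Banach and Riesz. As `B t u` is in `H¹`,
pairing it with `w` gives `⟨X B u, v⟩`. -/
theorem abs_commutator_le (h : A.IsDensity μ κ J) (hK : 0 < K) (hρ : AdmissibleWeights A μ K ρ)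
    (hX : AdmissibleX A μ K X) (hBX : CommutatorBounded A μ K ρ B X) {t : ℝ}
    (ht : t ∈ Icc (0 : ℝ) 1) {u v : Lp ℝ 2 μ} (hu : A.MemSob 1 u) (hBu : A.MemSob 1 (B t u))
    (hv : A.MemSob 1 v) :
    |weightedForm μ (ρ t) (X t u) (B t v) - weightedForm μ (ρ t) (X t (B t u)) v| ≤
      K * (1 + κ) * A.nrm 1 u * ‖v‖ := by
  obtain ⟨w, hw⟩ := exists_form_eq_of_bounded (p := weightedForm μ (ρ t)) (NNReal.coe_pos.2 hK)
    (norm_sq_le_form hK hρ ht) (form_symm hρ ht) (V := h.sobolevSpace 1)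
    (T := ((weightedForm μ (ρ t)).flip v).toLinearMap ∘ₗ X t)
    (C := 3 * d * κ ^ 2 * K ^ 2 * ‖v‖ + K * ‖X t v‖) (fun z hz => by
      have h1 := h.abs_skew_le hρ hX ht hz hv
      have h2 := abs_form_le hρ ht z (X t v)
      have h3 : weightedForm μ (ρ t) (X t z) v = (weightedForm μ (ρ t) (X t z) v +
        weightedForm μ (ρ t) z (X t v)) - weightedForm μ (ρ t) z (X t v) := by ring
      change |weightedForm μ (ρ t) (X t z) v| ≤ _
      rw [h3]
      refine (abs_sub _ _).trans ((add_le_add h1 h2).trans (le_of_eq (by ring))))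
  have hw' : ∀ z : Lp ℝ 2 μ, A.MemSob 1 z →
      weightedForm μ (ρ t) (X t z) v = weightedForm μ (ρ t) z w := fun z hz => hw z hz
  have h1 := hBX t ht u v w hu hv fun z hz => by
    rw [← form_apply hρ ht, ← form_apply hρ ht]
    exact hw' z hz
  rw [← form_apply hρ ht, ← form_apply hρ ht, ← hw' _ hBu] at h1
  refine h1.trans ?_
  have h2 := A.nrm_nonneg 1 u
  calc (K : ℝ) * A.nrm 1 u * A.nrm 0 v ≤ K * A.nrm 1 u * ((1 + κ) * ‖v‖) := by
        gcongr; exact h.nrm_zero_le v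
    _ = _ := by ring

end IsDensity

end SobolevAtlas

end Operators

/-! ### The shifted problem as an instance of the abstract evolution. -/

section Assembly

open Filter Topology

variable {d : ℕ} {N : Type*} [TopologicalSpace N] [ChartedSpace (EuclideanSpace ℝ (Fin d)) N]

namespace SobolevAtlas

namespace IsDensity

variable [MeasurableSpace N] {A : SobolevAtlas d N} {μ : Measure N} {κ : ℝ≥0}
  {J : Fin A.card → EuclideanSpace ℝ (Fin d) → ℝ} [CompactSpace N] [BorelSpace N] [T2Space N]
  {K : ℝ≥0}

theorem exists_isFirstOrderSystem (h : A.IsDensity μ κ J) (hK : 0 < K) :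
    ∃ L₀ : ℝ, ∀ L ≥ L₀, ∀ (ρ : ℝ → N → ℝ) (B X S : ℝ → Lp ℝ 2 μ →ₗ[ℝ] Lp ℝ 2 μ),
      AdmissibleWeights A μ K ρ → AdmissibleB A μ K ρ B → AdmissibleX A μ K X →
      AdmissibleS A μ K S → CommutatorBounded A μ K ρ B X → ∀ t ∈ Icc (0 : ℝ) 1,
        IsFirstOrderSystem L (h.sobolevSpace 1) (fun u : Lp ℝ 2 μ => A.nrm 1 u)
          (weightedForm μ (ρ t)) (B t + (K ^ 2 * κ + 1 : ℝ) • LinearMap.id) (X t)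
          (S t + (K ^ 2 * κ + 1 : ℝ) • LinearMap.id) := by
  -- By `form_shift_pos`, `B` is bounded below by `-K ^ 2 * κ`; the extra `1` gives `A ≥ 1`.
  obtain ⟨c, hc⟩ : ∃ c : ℝ, c = K ^ 2 * κ + 1 := ⟨_, rfl⟩
  rw [← hc]
  have hc1 : 1 ≤ c := by rw [hc]; exact le_add_of_nonneg_left (by positivity)
  have hc0 : 0 ≤ c := zero_le_one.trans hc1
  obtain ⟨a, ha⟩ : ∃ a : ℝ, a = 1 + A.card * κ := ⟨_, rfl⟩
  have ha0 : 0 ≤ a := by rw [ha]; positivity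
  have hK0 : (0 : ℝ) ≤ K := K.coe_nonneg
  have hκ0 : (0 : ℝ) ≤ κ := κ.coe_nonneg
  obtain ⟨L₀, h1, hLK, hLn, hLA, hLX, hLs, hLc, hLS, hLS'⟩ : ∃ L₀ : ℝ, 1 ≤ L₀ ∧ K ≤ L₀ ∧
      2 * K + 2 * c ^ 2 * K + K ^ 3 * κ ≤ L₀ ∧ K + c * a ≤ L₀ ∧ a * K ≤ L₀ ∧
      3 * d * κ ^ 2 * K ^ 2 ≤ L₀ ∧ K * (1 + κ) ≤ L₀ ∧ 2 * (K + c) ≤ L₀ ∧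
      a * K * (1 + κ) + c ≤ L₀ := by
    have e1 : 0 ≤ 2 * K + 2 * c ^ 2 * K + K ^ 3 * κ := by positivity
    have e2 : 0 ≤ c * a := by positivity
    have e3 : 0 ≤ a * K := by positivity
    have e4 : (0 : ℝ) ≤ 3 * d * κ ^ 2 * K ^ 2 := by positivity
    have e5 : (0 : ℝ) ≤ K * (1 + κ) := by positivity
    have e6 : (0 : ℝ) ≤ a * K * (1 + κ) := by positivity
    refine ⟨1 + K + (2 * K + 2 * c ^ 2 * K + K ^ 3 * κ) + (K + c * a) + a * K +
      3 * d * κ ^ 2 * K ^ 2 + K * (1 + κ) + 2 * (K + c) + (a * K * (1 + κ) + c),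
      ?_, ?_, ?_, ?_, ?_, ?_, ?_, ?_, ?_⟩ <;> linarith
  refine ⟨L₀, fun L hL ρ B X S hρ hB hX hS hBX t ht => ?_⟩
  have hp0 : ∀ u, 0 ≤ weightedForm μ (ρ t) u u := fun u => by
    have h2 := norm_sq_le_form hK hρ ht u
    have hK' : (0 : ℝ) < K := hK
    exact nonneg_of_mul_nonneg_right ((sq_nonneg _).trans h2) hK'
  have hpos : ∀ u ∈ h.sobolevSpace 1, weightedForm μ (ρ t) u u ≤
      weightedForm μ (ρ t) (B t u + c • u) u := fun u hu => by
    have h2 := h.form_shift_pos hK hρ hB ht hu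
    rw [map_add, map_smul, add_apply, smul_apply, smul_eq_mul, hc]
    linarith
  refine ⟨h1.trans hL, form_symm hρ ht, fun u v => ?_, fun u => ?_, fun u hu v hv => ?_,
    fun u w hw => ?_, hpos, fun u hu => ?_, fun u hu => ?_, fun u hu => ?_, fun u hu v hv => ?_,
    fun u hu hAu v hv => ?_, fun u hu => ?_, fun u hu => ?_, fun u hu => ?_⟩
  · exact (abs_form_le hρ ht u v).trans (by gcongr; exact hLK.trans hL)
  · exact (norm_sq_le_form hK hρ ht u).trans (mul_le_mul_of_nonneg_right (hLK.trans hL) (hp0 u))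
  · have h2 := hB.symm t ht u v hu hv
    rw [← form_apply hρ ht, ← form_apply hρ ht] at h2
    simp only [LinearMap.add_apply, LinearMap.smul_apply, LinearMap.id_apply, map_add, map_smul,
      add_apply, smul_apply, h2]
  · refine hB.adjoint_domain t ht u (w - c • u) fun v hv => ?_
    have h2 := hw v hv
    simp only [LinearMap.add_apply, LinearMap.smul_apply, LinearMap.id_apply, map_add,
      map_smul] at h2
    rw [← form_apply hρ ht, ← form_apply hρ ht, map_sub, map_smul, sub_apply, smul_apply, ← h2]
    ring
  · have h2 := h.nrm_one_sq_le hK hρ hB ht hu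
    simp only [LinearMap.add_apply, LinearMap.smul_apply, LinearMap.id_apply]
    have h3 := hpos u hu
    set w := B t u + c • u with hw
    have h4 := hp0 (B t u + (2 * c) • u)
    have h5 := hp0 (w - u)
    have h6 := form_symm hρ ht (B t u) u
    have h7 := form_symm hρ ht w u
    have h8 : weightedForm μ (ρ t) u u ≤ weightedForm μ (ρ t) w w := by
      simp only [map_sub, sub_apply] at h5
      linarith
    have h9 : weightedForm μ (ρ t) (B t u) (B t u) ≤
        2 * weightedForm μ (ρ t) w w + 2 * c ^ 2 * weightedForm μ (ρ t) u u := by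
      rw [hw]
      simp only [map_add, map_smul, add_apply, smul_apply, smul_eq_mul] at h4 ⊢
      nlinarith
    calc A.nrm 1 u ^ 2 ≤ _ := h2
      _ ≤ K * (2 * weightedForm μ (ρ t) w w + 2 * c ^ 2 * weightedForm μ (ρ t) w w) +
          K ^ 3 * κ * weightedForm μ (ρ t) w w := by
        have h10 : 2 * c ^ 2 * weightedForm μ (ρ t) u u ≤ 2 * c ^ 2 * weightedForm μ (ρ t) w w := by
          gcongr
        gcongr
        linarith
      _ = (2 * K + 2 * c ^ 2 * K + K ^ 3 * κ) * weightedForm μ (ρ t) w w := by ring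
      _ ≤ L * weightedForm μ (ρ t) w w :=
        mul_le_mul_of_nonneg_right (hLn.trans hL) (hp0 w)
  · simp only [LinearMap.add_apply, LinearMap.smul_apply, LinearMap.id_apply]
    have h2 := norm_B_le hK hρ hB ht hu
    have h3 := h.norm_le_nrm_one hu
    rw [← ha] at h3
    calc ‖B t u + c • u‖ ≤ ‖B t u‖ + c * ‖u‖ := by
          refine (norm_add_le _ _).trans (le_of_eq ?_)
          rw [norm_smul, Real.norm_of_nonneg hc0]
      _ ≤ K * A.nrm 1 u + c * (a * A.nrm 1 u) := by gcongr
      _ = (K + c * a) * A.nrm 1 u := by ring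
      _ ≤ L * A.nrm 1 u := mul_le_mul_of_nonneg_right (hLA.trans hL) (A.nrm_nonneg 1 u)
  · refine (h.norm_X_le hX ht hu).trans ?_
    rw [← ha]
    exact mul_le_mul_of_nonneg_right (hLX.trans hL) (A.nrm_nonneg 1 u)
  · exact (h.abs_skew_le hρ hX ht hu hv).trans (by gcongr; exact hLs.trans hL)
  · simp only [LinearMap.add_apply, LinearMap.smul_apply, LinearMap.id_apply] at hAu ⊢
    have hBu : B t u ∈ h.sobolevSpace 1 := by
      have := (h.sobolevSpace 1).sub_mem hAu ((h.sobolevSpace 1).smul_mem c hu)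
      rwa [add_sub_cancel_right] at this
    have h2 := h.abs_commutator_le hK hρ hX hBX ht hu hBu hv
    have h3 : weightedForm μ (ρ t) (X t u) (B t v + c • v) -
        weightedForm μ (ρ t) (X t (B t u + c • u)) v =
        weightedForm μ (ρ t) (X t u) (B t v) - weightedForm μ (ρ t) (X t (B t u)) v := by
      simp only [map_add, map_smul, add_apply, smul_apply]
      ring
    rw [h3]
    refine h2.trans ?_
    have := A.nrm_nonneg 1 u
    gcongr
    exact hLc.trans hL
  · exact (h.sobolevSpace 1).add_mem (hS t ht u hu).1 ((h.sobolevSpace 1).smul_mem c hu)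
  · simp only [LinearMap.add_apply, LinearMap.smul_apply, LinearMap.id_apply]
    refine (h.nrm_one_add_le (hS t ht u hu).1 ((h.sobolevSpace 1).smul_mem c hu)).trans ?_
    rw [h.nrm_coe_smul, abs_of_nonneg hc0]
    calc 2 * (A.nrm 1 (S t u) + c * A.nrm 1 u) ≤ 2 * (K * A.nrm 1 u + c * A.nrm 1 u) := by
          gcongr; exact (hS t ht u hu).2.1
      _ = 2 * (K + c) * A.nrm 1 u := by ring
      _ ≤ L * A.nrm 1 u := mul_le_mul_of_nonneg_right (hLS.trans hL) (A.nrm_nonneg 1 u)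
  · simp only [LinearMap.add_apply, LinearMap.smul_apply, LinearMap.id_apply]
    have h2 := h.norm_S_le hS ht hu
    rw [← ha] at h2
    calc ‖S t u + c • u‖ ≤ ‖S t u‖ + c * ‖u‖ := by
          refine (norm_add_le _ _).trans (le_of_eq ?_)
          rw [norm_smul, Real.norm_of_nonneg hc0]
      _ ≤ a * K * (1 + κ) * ‖u‖ + c * ‖u‖ := by gcongr
      _ = (a * K * (1 + κ) + c) * ‖u‖ := by ring
      _ ≤ L * ‖u‖ := mul_le_mul_of_nonneg_right (hLS'.trans hL) (norm_nonneg u)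

/-- Solutions of the equation on the manifold are solutions of the abstract evolution equation
for the shifted operators `B + c` and `S + c`, with uniform constants. -/
theorem exists_isEvolution (h : A.IsDensity μ κ J) (hK : 0 < K) :
    ∃ L : ℝ, A.card * κ ≤ L ∧ κ ≤ L ∧
      ∀ (ρ : ℝ → N → ℝ) (B X S : ℝ → Lp ℝ 2 μ →ₗ[ℝ] Lp ℝ 2 μ),
      AdmissibleWeights A μ K ρ → AdmissibleB A μ K ρ B → AdmissibleX A μ K X →
      AdmissibleS A μ K S → CommutatorBounded A μ K ρ B X →
      ∀ f : ℝ → Lp ℝ 2 μ, IsEvolutionSolution A μ B X S f → A.MemSob 1 (f 0) →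
        ∃ g : ℝ → Lp ℝ 2 μ, IsEvolution L (h.sobolevSpace 1) (fun u : Lp ℝ 2 μ => A.nrm 1 u)
          (fun t => weightedForm μ (ρ t)) (fun t => B t + (K ^ 2 * κ + 1 : ℝ) • LinearMap.id) X
          (fun t => S t + (K ^ 2 * κ + 1 : ℝ) • LinearMap.id) f g := by
  obtain ⟨L₀, hL₀⟩ := h.exists_isFirstOrderSystem (K := K) hK
  obtain ⟨L, hL, hLp, hLA, hLm, hLκ⟩ : ∃ L : ℝ, L₀ ≤ L ∧ K * K ≤ L ∧ (1 + A.card * κ) * K ≤ L ∧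
      A.card * κ ≤ L ∧ κ ≤ L := by
    have e1 : (0 : ℝ) ≤ K * K := by positivity
    have e2 : (0 : ℝ) ≤ (1 + A.card * κ) * K := by positivity
    have e3 : (0 : ℝ) ≤ A.card * κ := by positivity
    have e4 : (0 : ℝ) ≤ κ := κ.coe_nonneg
    refine ⟨|L₀| + K * K + (1 + A.card * κ) * K + A.card * κ + κ, ?_, ?_, ?_, ?_, ?_⟩ <;>
      linarith [le_abs_self L₀, abs_nonneg L₀]
  refine ⟨L, hLm, hLκ, fun ρ B X S hρ hB hX hS hBX f hf hf0 => ?_⟩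
  obtain ⟨hmem, -, g, hg, hfg, hae⟩ := hf
  refine ⟨g, ⟨h.isClosedNorm 1, hL₀ L hL ρ B X S hρ hB hX hS hBX, fun s hs t ht u v => ?_,
    fun s hs t ht u hu => ?_, ?_, hfg, ?_, hf0⟩⟩
  · exact (abs_form_sub_le hρ hs ht u v).trans (by gcongr)
  · simp only [LinearMap.add_apply, LinearMap.smul_apply, LinearMap.id_apply,
      add_sub_add_right_eq_sub]
    refine (h.norm_B_sub_le hK hρ hB hs ht hu).trans ?_
    have := A.nrm_nonneg 1 u
    gcongr
  · rw [intervalIntegrable_iff_integrableOn_Icc_of_le zero_le_one]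
    exact hg.integrable (by norm_num)
  · filter_upwards [hmem, hae] with t h1 h2
    refine ⟨h1, ?_⟩
    -- The shifts by the same constant in `B` and in `S` cancel in the equation.
    rw [h2]
    simp only [LinearMap.add_apply, LinearMap.smul_apply, LinearMap.id_apply]
    abel

end IsDensity

end SobolevAtlas

end Assembly

/-! ### The two estimates on the manifold. -/

theorem mainTheorem3 {d : ℕ} {N : Type*} [TopologicalSpace N] [T2Space N] [CompactSpace N]
    [ChartedSpace (EuclideanSpace ℝ (Fin d)) N] [IsManifold (𝓡 d) 2 N]
    [MeasurableSpace N] [BorelSpace N]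
    (A : SobolevAtlas d N) (μ : Measure N) (hμ : A.LipDensity μ) (K : ℝ≥0) (hK : 0 < K) :
    (∃ C₁ C₂ : ℝ, 0 < C₁ ∧ 0 < C₂ ∧
      ∀ (ρ : ℝ → N → ℝ) (B X S : ℝ → Lp ℝ 2 μ →ₗ[ℝ] Lp ℝ 2 μ),
        AdmissibleWeights A μ K ρ → AdmissibleB A μ K ρ B → AdmissibleX A μ K X →
        AdmissibleS A μ K S → CommutatorBounded A μ K ρ B X →
        ∀ f : ℝ → Lp ℝ 2 μ, IsEvolutionSolution A μ B X S f → A.MemSob 1 (f 0) → f 0 ≠ 0 →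
          ∀ t ∈ Icc (0 : ℝ) 1, A.MemSob 1 (f t) ∧ f t ≠ 0 ∧
            freqRatio μ (ρ t) (B t) (f t) ≤
              Real.exp (C₁ * t) * (freqRatio μ (ρ 0) (B 0) (f 0) + C₂ / C₁) - C₂ / C₁) ∧
    (∃ C₂ C₃ : ℝ, 0 < C₂ ∧ 0 < C₃ ∧
      ∀ (ρ : ℝ → N → ℝ) (B X S : ℝ → Lp ℝ 2 μ →ₗ[ℝ] Lp ℝ 2 μ),
        AdmissibleWeights A μ K ρ → AdmissibleB A μ K ρ B → AdmissibleX A μ K X →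
        AdmissibleS A μ K S → CommutatorBounded A μ K ρ B X →
        ∀ f : ℝ → Lp ℝ 2 μ, IsEvolutionSolution A μ B X S f → A.MemSob 1 (f 0) →
          ∀ lam : ℝ, wip μ (ρ 0) (B 0 (f 0)) (B 0 (f 0)) ≤ lam * wip μ (ρ 0) (f 0) (f 0) →
            ∀ t ∈ Icc (0 : ℝ) 1, A.MemSob (1 / 2) (f t) ∧
              Real.exp (-(C₂ * lam + C₃) * t) * A.nrm (1 / 2) (f 0) ^ 2 ≤
                A.nrm (1 / 2) (f t) ^ 2) := by
  obtain ⟨κ, J, h⟩ := hμ.exists_isDensity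
  obtain ⟨L, hLm, hLκ, hL⟩ := h.exists_isEvolution hK
  obtain ⟨c, hc⟩ : ∃ c : ℝ, c = K ^ 2 * κ + 1 := ⟨_, rfl⟩
  rw [← hc] at hL
  have hc0 : 0 < c := by rw [hc]; positivity
  have hL0 : 0 < L := (NNReal.coe_pos.2 h.pos).trans_le hLκ
  have h01 : (0 : ℝ) ∈ Icc (0 : ℝ) 1 := ⟨le_rfl, zero_le_one⟩
  have hK' : (0 : ℝ) < K := hK
  have hpos : ∀ {ρ : ℝ → N → ℝ}, AdmissibleWeights A μ K ρ → ∀ {t : ℝ}, t ∈ Icc (0 : ℝ) 1 →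
      ∀ {u : Lp ℝ 2 μ}, u ≠ 0 → 0 < weightedForm μ (ρ t) u u := fun hρ t ht u hu => by
    have h1 := SobolevAtlas.IsDensity.norm_sq_le_form hK hρ ht u
    have h2 : 0 < ‖u‖ ^ 2 := pow_pos (norm_pos_iff.2 hu) 2
    exact pos_of_mul_pos_right (h2.trans_le h1) hK'.le
  constructor
  · obtain ⟨D, hD⟩ : ∃ D : ℝ, D = Real.exp (28 * L ^ 6) * (28 * L ^ 6 + 168 * c * L ^ 4) *
      (2 * (1 + c ^ 2)) := ⟨_, rfl⟩
    have hD0 : 0 < D := by rw [hD]; positivity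
    -- Equal constants make `C₂ / C₁ = 1`, the additive `1` of `frequency_bound`.
    refine ⟨D, D, hD0, hD0, fun ρ B X S hρ hB hX hS hBX f hf hf0 hne t ht => ?_⟩
    obtain ⟨g, hg⟩ := hL ρ B X S hρ hB hX hS hBX f hf hf0
    obtain ⟨h1, h2⟩ := hg.frequency_bound hc0.le (hpos hρ h01 hne) ht hD
    refine ⟨hg.mem ht, fun h0 => ?_, ?_⟩
    · rw [h0, map_zero] at h1
      exact lt_irrefl _ h1
    · simp only [LinearMap.add_apply, LinearMap.smul_apply, LinearMap.id_apply,
        add_sub_cancel_right, SobolevAtlas.IsDensity.form_apply hρ ht,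
        SobolevAtlas.IsDensity.form_apply hρ h01] at h2
      rw [div_self hD0.ne']
      exact h2
  · have hE : 0 < 22 * L ^ 6 * Real.exp (28 * L ^ 6) := by positivity
    -- The decay rate is `22 * L ^ 6 * exp (28 * L ^ 6)` times the initial ratio for `A = B + c`,
    -- and that ratio is at most `2 * lam + 2 * c ^ 2`.
    refine ⟨22 * L ^ 6 * Real.exp (28 * L ^ 6) * 2, 22 * L ^ 6 * Real.exp (28 * L ^ 6) *
      (2 * c ^ 2), by positivity, by positivity,
      fun ρ B X S hρ hB hX hS hBX f hf hf0 lam hlam t ht => ?_⟩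
    obtain ⟨g, hg⟩ := hL ρ B X S hρ hB hX hS hBX f hf hf0
    have hmem : ∀ {u : Lp ℝ 2 μ}, u ∈ h.sobolevSpace 1 → A.MemSob (1 / 2) u := fun hu =>
      SobolevAtlas.MemSob.mono hu (by norm_num)
    refine ⟨hmem (hg.mem ht), ?_⟩
    by_cases hne : f 0 = 0
    · have h1 : A.nrm (1 / 2) (f 0) = 0 := by
        rw [hne, SobolevAtlas.nrm, h.sobNormSq_coe_zero]
        simp
      rw [h1]
      simp only [ne_eq, OfNat.ofNat_ne_zero, not_false_eq_true, zero_pow, mul_zero]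
      positivity
    · have hp := hpos hρ h01 hne
      have h1 := hg.interpolated_lower_bound hp (q := fun u : Lp ℝ 2 μ => A.nrm (1 / 2) u ^ 2)
        (fun u hu => ?_) (fun u hu v hv δ hδ => ?_) ht
      · simp only [LinearMap.add_apply, LinearMap.smul_apply, LinearMap.id_apply] at h1
        refine le_trans ?_ h1
        gcongr
        · exact ht.1
        · have h2 : weightedForm μ (ρ 0) (B 0 (f 0) + c • f 0)
              (B 0 (f 0) + c • f 0) / weightedForm μ (ρ 0) (f 0) (f 0) ≤
                2 * lam + 2 * c ^ 2 := by
            rw [div_le_iff₀ hp]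
            rw [← SobolevAtlas.IsDensity.form_apply hρ h01,
              ← SobolevAtlas.IsDensity.form_apply hρ h01] at hlam
            -- Nonnegativity of the square of `(B - c) f` bounds that of `(B + c) f` by twice that
            -- of `B f` plus `2 c²` times that of `f`.
            have h3 := SobolevAtlas.IsDensity.norm_sq_le_form hK hρ h01 (B 0 (f 0) - c • f 0)
            have h4 := nonneg_of_mul_nonneg_right ((sq_nonneg _).trans h3) hK'
            have h5 := SobolevAtlas.IsDensity.form_symm hρ h01 (B 0 (f 0)) (f 0)
            simp only [map_add, map_sub, map_smul, add_apply, sub_apply, smul_apply,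
              smul_eq_mul] at h4 ⊢
            nlinarith
          calc _ = 22 * L ^ 6 * Real.exp (28 * L ^ 6) *
              (weightedForm μ (ρ 0) (B 0 (f 0) + c • f 0)
              (B 0 (f 0) + c • f 0) / weightedForm μ (ρ 0) (f 0) (f 0)) := by ring
            _ ≤ 22 * L ^ 6 * Real.exp (28 * L ^ 6) * (2 * lam + 2 * c ^ 2) := by gcongr
            _ = _ := by ring
      · refine (h.norm_sq_le u).trans (mul_le_mul hLm ?_ (sq_nonneg _) hL0.le)
        exact pow_le_pow_left₀ (A.nrm_nonneg 0 u)
          (SobolevAtlas.nrm_mono (hmem hu) (by norm_num)) 2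
      · refine (h.nrm_half_sq_le hu hv hδ).trans ?_
        gcongr
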